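/- Let $(M,g)$ be a smooth $n$-dimensional Riemannian manifold, $n\ge 2$. On $TM$ let $X^H_y,X^V_y$ be the horizontal lift (with respect to the Levi-Civita connection of $g$) and the vertical lift of $X$ at $y\in TM$, and let $t=\frac12 g(y,y)\in[0,\infty)$. Let $J$ and $G$ be the tensor fields of general natural lift type $$JX^H_y=a_1X^V_y+b_1g(X,y)y^V_y+a_4X^H_y+b_4g(X,y)y^H_y,\qquad JX^V_y=a_3X^V_y+b_3g(X,y)y^V_y-a_2X^H_y-b_2g(X,y)y^H_y,$$ $$G(X^H_y,Y^H_y)=c_1g(X,Y)+d_1g(X,y)g(Y,y),\quad G(X^V_y,Y^V_y)=c_2g(X,Y)+d_2g(X,y)g(Y,y),\quad G(X^V_y,Y^H_y)=c_3g(X,Y)+d_3g(X,y)g(Y,y),$$ where $a_\alpha,b_\alpha,c_\alpha,d_\alpha$ are smooth functions of $t\in[0,\infty)$. Assume that $(G,J)$ is almost anti-Hermitian: $J^2=-I$, $G$ is nondegenerate and $G(JX,JY)=-G(X,Y)$. Let $\nabla$ be the Levi-Civita connection of $G$, $F(X,Y,Z)=G((\nabla_XJ)Y,Z)$ and $\Phi(Z)=\sum_{a,b}G^{ab}F(e_a,e_b,Z)$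 for any frame $(e_a)$ of $T(TM)$, where $(G^{ab})$ is the inverse of the matrix $(G(e_a,e_b))$. Assume that $(TM,G,J)$ is an $\omega_1\oplus\omega_3$-manifold, that is, for all $X,Y,Z$, $$n[F(X,Y,Z)+F(Y,Z,X)+F(Z,X,Y)]=G(X,Y)\Phi(Z)+G(Z,X)\Phi(Y)+G(Y,Z)\Phi(X)+G(X,JY)\Phi(JZ)+G(Y,JZ)\Phi(JX)+G(Z,JX)\Phi(JY).$$ Then $(M,g)$ has constant sectional curvature $c$, and for every $t\ge0$ the following hold, with $'$ the derivative in $t$ (one-sided at $t=0$). (i) With $\Delta=(1+a_3^2)c_1^2-a_1c_3(2a_3c_1-a_1c_3)$, one has $a_1\ne0$, $a_1+2b_1t\neq0$ and $\Delta\neq0$. (ii) If $c_1(1+a_3^2)-a_1a_3c_3\ne0$ at $t$, then, with $D=[c_1(1+a_3^2)-a_1a_3c_3](a_1+2b_1t)$, $$a_1'=\frac{a_1^3(b_3-a_3')c_3-(1+a_3^2)cc_1(1+a_3^2+2a_3b_3t)}{D}+a_1^2\frac{a_3[c_1(a_3'-b_3)-b_1c_3]-2(d_1+a_3'b_1c_3t)}{D}+a_1\frac{b_1c_1(1+a_3^2+2a_3a_3't)+cc_3[a_3(1+a_3^2)-2b_3t(1-a_3^2)]}{D}.$$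 (iii) With $E=a_1\Delta(a_1+2b_1t)$, $$a_3'=\frac{a_1^4c_3(b_3c_3-2a_3d_3)-2(1+a_3^2)b_3cc_1t[(1+a_3^2)c_1-2a_1a_3c_3]}{E}-a_1^2(1+a_3^2)\frac{b_3(c_1^2+2cc_3^2t+4c_1d_1t)+2c_1[a_3d_1-b_1(c_3+2d_3t)]}{E}$$ $$\qquad+2a_1^3\frac{c_1d_3-c_3d_1+a_3^2(c_3d_1+c_1d_3)-a_3c_3[b_1(c_3+2d_3t)-2b_3d_1t]}{E}.$$ (iv) The derivatives $d_1'$ and $d_3'$ are rational functions of the other coefficients, their derivatives, $c$ and $t$, with denominators that vanish nowhere. Explicitly, with $u=a_1c_3-a_3c_1$, $u'=a_1'c_3+a_1c_3'-a_3'c_1-a_3c_1'$, $m=(a_1+2b_1t)d_3-(a_3+2b_3t)d_1+b_1c_3-b_3c_1$, $v=c_1+2d_1t$, $w=(a_1+2b_1t)(c_3+2d_3t)-(a_3+2b_3t)v$, $P=(mu+d_1c_1)/\Delta$, $Q=(d_1u-mc_1)/\Delta$, $$d_1'=Pc_1'+Qu'+\frac{2a_1(mQ+d_1P)-2b_1d_1+\frac{2cb_3}{a_1}(w+a_3v)}{a_1+2b_1t},$$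 $$d_3'=\frac{1}{a_1+2b_1t}\Big[Pu'-Qc_1'+\frac{2a_1(mP-d_1Q)-2b_1m+\frac{2cb_3}{a_1}(a_3w-v)}{a_1+2b_1t}-(a_1'+2b_1+2b_1't)d_3+(a_3'+2b_3+2b_3't)d_1+(a_3+2b_3t)d_1'-b_1'c_3-b_1c_3'+b_3'c_1+b_3c_1'\Big].$$ -/

import Mathlib

open scoped Manifold ContDiff Matrix

noncomputable section

namespace NaturalLift

/-! ### Tensor calculus in coordinates

A (semi-)Riemannian metric in coordinates `(p^a)_{a ∈ ι}` is a matrix valued function `G`, with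
`G p a b = G(∂_a, ∂_b)`; a field of endomorphisms is a matrix valued function `J`, with
`J ∂_b = ∑ a, J p a b ∂_a`. -/

section Coordinates

variable {ι : Type*} [Fintype ι] [DecidableEq ι]

/-- The partial derivative `∂f/∂p^a` at `p`. -/
def pd (a : ι) (f : (ι → ℝ) → ℝ) (p : ι → ℝ) : ℝ :=
  fderiv ℝ f p (Pi.single a 1)

/-- The Christoffel symbols `Γ^h_{ij}` of the Levi-Civita connection of `G`:
`∇_{∂_i} ∂_j = ∑ h, Γ^h_{ij} ∂_h`. -/
def christoffel (G : (ι → ℝ) → Matrix ι ι ℝ) (p : ι → ℝ) (h i j : ι) : ℝ :=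
  (1 / 2) * ∑ k, (G p)⁻¹ h k *
    (pd i (fun q => G q j k) p + pd j (fun q => G q i k) p - pd k (fun q => G q i j) p)

/-- The components `R^h_{kij}` of the curvature tensor of the Levi-Civita connection of `G`:
`R(∂_i, ∂_j) ∂_k = ∑ h, R^h_{kij} ∂_h`, where `R(X, Y) = [∇_X, ∇_Y] - ∇_{[X, Y]}`. -/
def curvature (G : (ι → ℝ) → Matrix ι ι ℝ) (p : ι → ℝ) (h k i j : ι) : ℝ :=
  pd i (fun q => christoffel G q h j k) p - pd j (fun q => christoffel G q h i k) p
    + ∑ l, (christoffel G p h i l * christoffel G p l j k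
        - christoffel G p h j l * christoffel G p l i k)

/-- The value `G(X, Y)` at the point `p`. -/
def pair (G : (ι → ℝ) → Matrix ι ι ℝ) (p X Y : ι → ℝ) : ℝ := X ⬝ᵥ (G p *ᵥ Y)

/-- The vector `(∇_X J) Y` at the point `p`, for the Levi-Civita connection `∇` of `G`. -/
def covDerivEnd (G J : (ι → ℝ) → Matrix ι ι ℝ) (p X Y : ι → ℝ) : ι → ℝ := fun d =>
  ∑ a, ∑ b, X a * Y b *
    (pd a (fun q => J q d b) p
      + ∑ e, (christoffel G p d a e * J p e b - J p d e * christoffel G p e a b))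

/-- The `(0,3)`-tensor `F(X, Y, Z) = G((∇_X J) Y, Z)`. -/
def tensorF (G J : (ι → ℝ) → Matrix ι ι ℝ) (p X Y Z : ι → ℝ) : ℝ :=
  pair G p (covDerivEnd G J p X Y) Z

/-- The 1-form `Φ(Z) = ∑ a b, G^{ab} F(e_a, e_b, Z)` associated with `F`. It does not depend on the
frame `(e_a)`; here the coordinate frame is used. -/
def formPhi (G J : (ι → ℝ) → Matrix ι ι ℝ) (p Z : ι → ℝ) : ℝ :=
  ∑ a, ∑ b, (G p)⁻¹ a b * tensorF G J p (Pi.single a 1) (Pi.single b 1) Z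

/-- The `ω₁ ⊕ ω₃` condition at the point `p` of a manifold of dimension `2n` with almost complex
structure `J` and Norden metric `G`. -/
def Omega13At (n : ℕ) (G J : (ι → ℝ) → Matrix ι ι ℝ) (p : ι → ℝ) : Prop :=
  ∀ X Y Z : ι → ℝ,
    (n : ℝ) * (tensorF G J p X Y Z + tensorF G J p Y Z X + tensorF G J p Z X Y) =
      pair G p X Y * formPhi G J p Z + pair G p Z X * formPhi G J p Y
        + pair G p Y Z * formPhi G J p X
        + pair G p X (J p *ᵥ Y) * formPhi G J p (J p *ᵥ Z)
        + pair G p Y (J p *ᵥ Z) * formPhi G J p (J p *ᵥ X)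
        + pair G p Z (J p *ᵥ X) * formPhi G J p (J p *ᵥ Y)

end Coordinates

/-! ### The coefficients of the general natural lifts -/

/-- Derivative of a function of the energy density `t ∈ [0, ∞)` (one-sided at `t = 0`). -/
def dt (f : ℝ → ℝ) (t : ℝ) : ℝ := derivWithin f (Set.Ici 0) t

/-- The coefficients, smooth functions on `[0, ∞)`, of a natural tensor field `J` of type `(1,1)`
on the tangent bundle. -/
structure EndCoeffs where
  (a₁ a₂ a₃ a₄ b₁ b₂ b₃ b₄ : ℝ → ℝ)
  smooth_a₁ : ContDiffOn ℝ ∞ a₁ (Set.Ici 0)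
  smooth_a₂ : ContDiffOn ℝ ∞ a₂ (Set.Ici 0)
  smooth_a₃ : ContDiffOn ℝ ∞ a₃ (Set.Ici 0)
  smooth_a₄ : ContDiffOn ℝ ∞ a₄ (Set.Ici 0)
  smooth_b₁ : ContDiffOn ℝ ∞ b₁ (Set.Ici 0)
  smooth_b₂ : ContDiffOn ℝ ∞ b₂ (Set.Ici 0)
  smooth_b₃ : ContDiffOn ℝ ∞ b₃ (Set.Ici 0)
  smooth_b₄ : ContDiffOn ℝ ∞ b₄ (Set.Ici 0)

/-- The coefficients, smooth functions on `[0, ∞)`, of a natural symmetric tensor field `G` of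
type `(0,2)` on the tangent bundle. -/
structure MetricCoeffs where
  (c₁ c₂ c₃ d₁ d₂ d₃ : ℝ → ℝ)
  smooth_c₁ : ContDiffOn ℝ ∞ c₁ (Set.Ici 0)
  smooth_c₂ : ContDiffOn ℝ ∞ c₂ (Set.Ici 0)
  smooth_c₃ : ContDiffOn ℝ ∞ c₃ (Set.Ici 0)
  smooth_d₁ : ContDiffOn ℝ ∞ d₁ (Set.Ici 0)
  smooth_d₂ : ContDiffOn ℝ ∞ d₂ (Set.Ici 0)
  smooth_d₃ : ContDiffOn ℝ ∞ d₃ (Set.Ici 0)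

/-! ### The lifts in an induced chart of the tangent bundle

In this section `g` is a Riemannian metric in coordinates `x = (x^1, …, x^n)`. Points of the tangent
bundle have the induced coordinates `p = (x, y)`, indexed by `Fin n ⊕ Fin n`. -/

section InducedChart

variable {n : ℕ}

/-- The base coordinates `x` of the point `p = (x, y)`. -/
def base (p : Fin n ⊕ Fin n → ℝ) : Fin n → ℝ := fun i => p (Sum.inl i)

/-- The fibre coordinates `y` of the point `p = (x, y)`. -/
def fib (p : Fin n ⊕ Fin n → ℝ) : Fin n → ℝ := fun i => p (Sum.inr i)

/-- `g_{0i} = ∑ h, y^h g_{hi}`. -/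
def lower (g : (Fin n → ℝ) → Matrix (Fin n) (Fin n) ℝ) (p : Fin n ⊕ Fin n → ℝ) : Fin n → ℝ :=
  fun i => ∑ h, fib p h * g (base p) h i

/-- The energy density `t = (1/2) ∑ i k, g_{ik} y^i y^k`. -/
def energy (g : (Fin n → ℝ) → Matrix (Fin n) (Fin n) ℝ) (p : Fin n ⊕ Fin n → ℝ) : ℝ :=
  (1 / 2) * ∑ i, ∑ k, g (base p) i k * fib p i * fib p k

/-- The matrix `N h i = Γ^h_{0i} = ∑ k, y^k Γ^h_{ki}`. -/
def nonlinConn (g : (Fin n → ℝ) → Matrix (Fin n) (Fin n) ℝ) (p : Fin n ⊕ Fin n → ℝ) :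
    Matrix (Fin n) (Fin n) ℝ :=
  fun h i => ∑ k, fib p k * christoffel g (base p) h k i

/-- The adapted frame `δ_i = ∂/∂x^i - ∑ h, Γ^h_{0i} ∂/∂y^h` (index `inl i`) and `∂_i = ∂/∂y^i`
(index `inr i`). The columns are the components in the natural frame of the induced chart. -/
def frame (g : (Fin n → ℝ) → Matrix (Fin n) (Fin n) ℝ) (p : Fin n ⊕ Fin n → ℝ) :
    Matrix (Fin n ⊕ Fin n) (Fin n ⊕ Fin n) ℝ :=
  Matrix.fromBlocks 1 0 (-nonlinConn g p) 1

/-- The dual coframe `dx^i`, `dy^i + ∑ h, Γ^i_{0h} dx^h`, as rows. -/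
def coframe (g : (Fin n → ℝ) → Matrix (Fin n) (Fin n) ℝ) (p : Fin n ⊕ Fin n → ℝ) :
    Matrix (Fin n ⊕ Fin n) (Fin n ⊕ Fin n) ℝ :=
  Matrix.fromBlocks 1 0 (nonlinConn g p) 1

theorem coframe_mul_frame (g : (Fin n → ℝ) → Matrix (Fin n) (Fin n) ℝ) (p : Fin n ⊕ Fin n → ℝ) :
    coframe g p * frame g p = 1 := by
  simp [coframe, frame, Matrix.fromBlocks_multiply]

/-- The block `X ↦ a(t) X + b(t) g(X, y) y`. -/
def endBlock (g : (Fin n → ℝ) → Matrix (Fin n) (Fin n) ℝ) (a b : ℝ → ℝ)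
    (p : Fin n ⊕ Fin n → ℝ) : Matrix (Fin n) (Fin n) ℝ :=
  a (energy g p) • (1 : Matrix (Fin n) (Fin n) ℝ)
    + b (energy g p) • Matrix.vecMulVec (fib p) (lower g p)

/-- The block `(X, Y) ↦ c(t) g(X, Y) + d(t) g(X, y) g(Y, y)`. -/
def metricBlock (g : (Fin n → ℝ) → Matrix (Fin n) (Fin n) ℝ) (c d : ℝ → ℝ)
    (p : Fin n ⊕ Fin n → ℝ) : Matrix (Fin n) (Fin n) ℝ :=
  c (energy g p) • g (base p)
    + d (energy g p) • Matrix.vecMulVec (lower g p) (lower g p)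

/-- The general natural tensor field `J` of type `(1,1)`, in the natural frame of the induced chart:
`J X^H = a₁ X^V + b₁ g(X, y) y^V + a₄ X^H + b₄ g(X, y) y^H`,
`J X^V = a₃ X^V + b₃ g(X, y) y^V - a₂ X^H - b₂ g(X, y) y^H`. -/
def liftJ (g : (Fin n → ℝ) → Matrix (Fin n) (Fin n) ℝ) (A : EndCoeffs)
    (p : Fin n ⊕ Fin n → ℝ) : Matrix (Fin n ⊕ Fin n) (Fin n ⊕ Fin n) ℝ :=
  frame g p *
    Matrix.fromBlocks (endBlock g A.a₄ A.b₄ p) (-endBlock g A.a₂ A.b₂ p)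
      (endBlock g A.a₁ A.b₁ p) (endBlock g A.a₃ A.b₃ p) *
    coframe g p

/-- The general natural metric `G`, in the natural frame of the induced chart:
`G(X^H, Y^H) = c₁ g(X, Y) + d₁ g(X, y) g(Y, y)`,
`G(X^V, Y^V) = c₂ g(X, Y) + d₂ g(X, y) g(Y, y)`,
`G(X^V, Y^H) = c₃ g(X, Y) + d₃ g(X, y) g(Y, y)`. -/
def liftG (g : (Fin n → ℝ) → Matrix (Fin n) (Fin n) ℝ) (C : MetricCoeffs)
    (p : Fin n ⊕ Fin n → ℝ) : Matrix (Fin n ⊕ Fin n) (Fin n ⊕ Fin n) ℝ :=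
  (coframe g p)ᵀ *
    Matrix.fromBlocks (metricBlock g C.c₁ C.d₁ p) (metricBlock g C.c₃ C.d₃ p)
      (metricBlock g C.c₃ C.d₃ p) (metricBlock g C.c₂ C.d₂ p) *
    coframe g p

end InducedChart

/-! ### Riemannian manifolds and their tangent bundles -/

section Manifold

variable {n : ℕ} {M : Type*} [TopologicalSpace M] [ChartedSpace (EuclideanSpace ℝ (Fin n)) M]
  [IsManifold (𝓡 n) ∞ M]

/-- Smooth Riemannian metrics on the `n`-dimensional smooth manifold `M`. -/
abbrev Metric (n : ℕ) (M : Type*) [TopologicalSpace M] [ChartedSpace (EuclideanSpace ℝ (Fin n)) M]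
    [IsManifold (𝓡 n) ∞ M] :=
  Bundle.ContMDiffRiemannianMetric (𝓡 n) ∞ (EuclideanSpace ℝ (Fin n))
    (fun x : M => TangentSpace (𝓡 n) x)

/-- The coordinate domain of the chart `e`: the open set of the coordinate tuples of its points. -/
def coordDomain (e : OpenPartialHomeomorph M (EuclideanSpace ℝ (Fin n))) : Set (Fin n → ℝ) :=
  {x | WithLp.toLp 2 x ∈ e.target}

/-- The coordinate vector `∂/∂x^i` of the chart `e`, at the point with coordinates `x`. -/
def coordVec (e : OpenPartialHomeomorph M (EuclideanSpace ℝ (Fin n))) (x : Fin n → ℝ) (i : Fin n) :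
    TangentSpace (𝓡 n) (e.symm (WithLp.toLp 2 x)) :=
  mfderiv (𝓡 n) (𝓡 n) e.symm (WithLp.toLp 2 x) (EuclideanSpace.single i (1 : ℝ))

/-- The components `g_{ij}` of the metric `g` in the chart `e`. -/
def Metric.inChart (g : Metric n M) (e : OpenPartialHomeomorph M (EuclideanSpace ℝ (Fin n)))
    (x : Fin n → ℝ) : Matrix (Fin n) (Fin n) ℝ :=
  fun i j => g.inner (e.symm (WithLp.toLp 2 x)) (coordVec e x i) (coordVec e x j)

/-- `(M, g)` has constant sectional curvature `c`: in every chart,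
`R^h_{kij} = c (δ^h_i g_{kj} - δ^h_j g_{ki})`. -/
def HasConstantSectionalCurvature (g : Metric n M) (c : ℝ) : Prop :=
  ∀ e ∈ atlas (EuclideanSpace ℝ (Fin n)) M, ∀ x ∈ coordDomain e, ∀ h k i j : Fin n,
    curvature (g.inChart e) x h k i j =
      c * ((if h = i then 1 else 0) * g.inChart e x k j
        - (if h = j then 1 else 0) * g.inChart e x k i)

/-- The general natural lifts `J` and `G` with the coefficients `A` and `C` form an almost
anti-Hermitian structure on the tangent bundle: at every point, `J² = -I`, the metric `G` is
nondegenerate, and `G(JX, JY) = -G(X, Y)` for all tangent vectors `X`, `Y`. -/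
def IsAlmostAntiHermitian (g : Metric n M) (A : EndCoeffs) (C : MetricCoeffs) : Prop :=
  ∀ e ∈ atlas (EuclideanSpace ℝ (Fin n)) M, ∀ p : Fin n ⊕ Fin n → ℝ, base p ∈ coordDomain e →
    liftJ (g.inChart e) A p * liftJ (g.inChart e) A p = -1 ∧
    (liftG (g.inChart e) C p).det ≠ 0 ∧
    ∀ X Y : Fin n ⊕ Fin n → ℝ,
      pair (liftG (g.inChart e) C) p (liftJ (g.inChart e) A p *ᵥ X) (liftJ (g.inChart e) A p *ᵥ Y)
        = -pair (liftG (g.inChart e) C) p X Y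

/-- The tangent bundle of `(M, g)`, with the general natural lifts `J` and `G` of coefficients `A`
and `C`, satisfies the condition that defines the `ω₁ ⊕ ω₃`-manifolds. -/
def IsOmega13 (g : Metric n M) (A : EndCoeffs) (C : MetricCoeffs) : Prop :=
  ∀ e ∈ atlas (EuclideanSpace ℝ (Fin n)) M, ∀ p : Fin n ⊕ Fin n → ℝ, base p ∈ coordDomain e →
    Omega13At n (liftG (g.inChart e) C) (liftJ (g.inChart e) A) p

end Manifold

end NaturalLift

end

/-! The `ω₁ ⊕ ω₃` identity is needed only on the diagonal X = Y = Z, where it reads n F(X,X,X) =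
G(X,X)Φ(X) + G(X,JX)Φ(JX). Since J is G-self-adjoint, the Koszul formula removes the Christoffel
symbols of G from F(X,X,X) (`tensorF_self`). In the adapted frame the connection of g drops out too,
except for one term R(·,·)y (`IsMetricOn.tensorF_lift_self`).

Fix y with g(y,y) = r = 2t > 0 and e ≠ 0 orthogonal to y, and let X run over the span of the lifts
of y and e. Then F(X,X,X) is a radial part, cubic in the y-components, plus a mixed part, linear in
the y-components and quadratic in the e-components. The coefficients involve only the 1-jets of the
coefficient functions at t and κ, minus the sectional curvature of the plane
(`IsMetricOn.tensorF_lift_span`). Averaging over e ↦ -e removes Φ on the lifts of e, so Φ(y^H) and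
Φ(y^V) are the only unknowns left (`omega13_of_point`).

They are eliminated in `Jet.Compatible.omega13`, using the bases y^H, Jy^H and e^H, Je^H. The Φ-side
of the mixed identity changes sign when e^H is replaced by Je^H, because G(JX,JY) = -G(X,Y); this
gives two equations free of Φ, linear in a₁', a₃' and κ. The other values, read as complex numbers,
say that mixed and radial parts are multiples of the same number Φ(y^H) - iΦ(Jy^H), with factors c₁
+ iu and (c₁ + r d₁) + i(u + r m). Eliminating that number gives d₁' and m'.

The coefficients of κ in the first two equations have sum of squares a positive multiple of Δ = c₁²
+ u² ≠ 0, so the jet at a single t determines κ (`Jet.Omega13.unique`). The jets depend neither on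
the point nor on the plane, so all sectional curvatures agree; Schur's lemma is not used and n = 2
is not special. The formulas are then linear algebra, and t = 0 follows by continuity
(`omega13_of_pos`). -/

noncomputable section
namespace NaturalLift

/-! ### Levi-Civita connection and the tensor F in coordinates -/

section PointwiseCoordinates

variable {ι : Type*} [Fintype ι]

theorem pair_eq_sum (G : (ι → ℝ) → Matrix ι ι ℝ) (p X Y : ι → ℝ) :
    pair G p X Y = ∑ i, ∑ j, X i * Y j * G p i j := by
  simp only [pair, dotProduct, Matrix.mulVec, Finset.mul_sum]
  exact Finset.sum_congr rfl fun i _ => Finset.sum_congr rfl fun j _ => by ring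

theorem pair_add_left (G : (ι → ℝ) → Matrix ι ι ℝ) (p X X' Y : ι → ℝ) :
    pair G p (X + X') Y = pair G p X Y + pair G p X' Y := by
  simp [pair, add_dotProduct]

theorem pair_add_right (G : (ι → ℝ) → Matrix ι ι ℝ) (p X Y Y' : ι → ℝ) :
    pair G p X (Y + Y') = pair G p X Y + pair G p X Y' := by
  simp [pair, Matrix.mulVec_add]

theorem pair_sub_left (G : (ι → ℝ) → Matrix ι ι ℝ) (p X X' Y : ι → ℝ) :
    pair G p (X - X') Y = pair G p X Y - pair G p X' Y := by
  simp [pair, sub_dotProduct]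

theorem pair_sub_right (G : (ι → ℝ) → Matrix ι ι ℝ) (p X Y Y' : ι → ℝ) :
    pair G p X (Y - Y') = pair G p X Y - pair G p X Y' := by
  simp [pair, Matrix.mulVec_sub]

theorem pair_neg_left (G : (ι → ℝ) → Matrix ι ι ℝ) (p X Y : ι → ℝ) :
    pair G p (-X) Y = -pair G p X Y := by
  simp [pair]

theorem pair_neg_right (G : (ι → ℝ) → Matrix ι ι ℝ) (p X Y : ι → ℝ) :
    pair G p X (-Y) = -pair G p X Y := by
  simp [pair, Matrix.mulVec_neg]

theorem pair_smul_left (G : (ι → ℝ) → Matrix ι ι ℝ) (p : ι → ℝ) (s : ℝ) (X Y : ι → ℝ) :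
    pair G p (s • X) Y = s * pair G p X Y := by
  simp [pair]

theorem pair_smul_right (G : (ι → ℝ) → Matrix ι ι ℝ) (p : ι → ℝ) (s : ℝ) (X Y : ι → ℝ) :
    pair G p X (s • Y) = s * pair G p X Y := by
  simp [pair, Matrix.mulVec_smul]

theorem pair_zero_left (G : (ι → ℝ) → Matrix ι ι ℝ) (p Y : ι → ℝ) : pair G p 0 Y = 0 := by
  simp [pair]

theorem pair_zero_right (G : (ι → ℝ) → Matrix ι ι ℝ) (p X : ι → ℝ) : pair G p X 0 = 0 := by
  simp [pair]

theorem pair_comm {G : (ι → ℝ) → Matrix ι ι ℝ} (hG : ∀ q i j, G q i j = G q j i) (p X Y : ι → ℝ) :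
    pair G p X Y = pair G p Y X := by
  rw [pair_eq_sum, pair_eq_sum, Finset.sum_comm]
  exact Finset.sum_congr rfl fun i _ => Finset.sum_congr rfl fun j _ => by rw [hG p i j]; ring

/-- All entries of the matrix valued function `A` are differentiable at `p`. -/
def EntriesDifferentiableAt {κ κ' : Type*} (A : (ι → ℝ) → Matrix κ κ' ℝ) (p : ι → ℝ) : Prop :=
  ∀ i j, DifferentiableAt ℝ (fun q => A q i j) p

theorem EntriesDifferentiableAt.pair {G : (ι → ℝ) → Matrix ι ι ℝ} {p : ι → ℝ}
    (hG : EntriesDifferentiableAt G p) (X Y : ι → ℝ) :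
    DifferentiableAt ℝ (fun q => pair G q X Y) p := by
  have h := hG
  unfold EntriesDifferentiableAt at h
  simp only [pair_eq_sum]
  fun_prop

theorem EntriesDifferentiableAt.mulVec {G : (ι → ℝ) → Matrix ι ι ℝ} {p : ι → ℝ}
    (hG : EntriesDifferentiableAt G p) (X : ι → ℝ) :
    DifferentiableAt ℝ (fun q => G q *ᵥ X) p := by
  have h := hG
  unfold EntriesDifferentiableAt at h
  rw [differentiableAt_pi]
  intro i
  simp only [Matrix.mulVec, dotProduct]
  fun_prop

theorem fderiv_pair {G : (ι → ℝ) → Matrix ι ι ℝ} {p : ι → ℝ}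
    (hG : EntriesDifferentiableAt G p) (X Y v : ι → ℝ) :
    fderiv ℝ (fun q => pair G q X Y) p v =
      ∑ i, ∑ j, X i * Y j * fderiv ℝ (fun q => G q i j) p v := by
  have h := hG
  unfold EntriesDifferentiableAt at h
  simp only [pair_eq_sum]
  rw [fderiv_fun_sum (fun i _ => by fun_prop), _root_.sum_apply]
  refine Finset.sum_congr rfl fun i _ => ?_
  rw [fderiv_fun_sum (fun i _ => by fun_prop), _root_.sum_apply]
  refine Finset.sum_congr rfl fun j _ => ?_
  rw [fderiv_const_mul (h i j)]
  simp

theorem fderiv_pair_mulVec {G J : (ι → ℝ) → Matrix ι ι ℝ} {p : ι → ℝ}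
    (hG : EntriesDifferentiableAt G p) (hJ : EntriesDifferentiableAt J p) (X Y v : ι → ℝ) :
    fderiv ℝ (fun q => pair G q X (J q *ᵥ Y)) p v =
      pair G p X (fderiv ℝ (fun q => J q *ᵥ Y) p v)
        + fderiv ℝ (fun q => pair G q X (J p *ᵥ Y)) p v := by
  have hJY := hJ.mulVec Y
  have hG' := hG
  unfold EntriesDifferentiableAt at hG'
  have hJi : ∀ j, HasFDerivAt (fun q => (J q *ᵥ Y) j)
      ((ContinuousLinearMap.proj j).comp (fderiv ℝ (fun q => J q *ᵥ Y) p)) p := fun j =>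
    (hasFDerivAt_pi'.1 hJY.hasFDerivAt) j
  have H : HasFDerivAt (fun q => pair G q X (J q *ᵥ Y))
      (∑ i, ∑ j, ((X i * (J p *ᵥ Y) j) • fderiv ℝ (fun q => G q i j) p + G p i j •
        (X i • (ContinuousLinearMap.proj j).comp (fderiv ℝ (fun q => J q *ᵥ Y) p)))) p := by
    simp only [pair_eq_sum]
    refine HasFDerivAt.fun_sum fun i _ => HasFDerivAt.fun_sum fun j _ => ?_
    exact ((hJi j).const_mul (X i)).mul (hG' i j).hasFDerivAt
  rw [H.fderiv, fderiv_pair hG, pair_eq_sum]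
  simp only [_root_.sum_apply, _root_.add_apply,
    _root_.smul_apply, ContinuousLinearMap.comp_apply, ContinuousLinearMap.proj_apply,
    smul_eq_mul, Finset.sum_add_distrib]
  rw [add_comm]
  congr 1
  exact Finset.sum_congr rfl fun i _ => Finset.sum_congr rfl fun j _ => by ring

variable [DecidableEq ι]

theorem fderiv_apply_eq_sum_pd (f : (ι → ℝ) → ℝ) (p v : ι → ℝ) :
    fderiv ℝ f p v = ∑ a, v a * pd a f p := by
  conv_lhs => rw [pi_eq_sum_univ' v]
  simp only [map_sum, map_smul, smul_eq_mul, pd]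

theorem pd_sum {κ : Type*} (s : Finset κ) (a : ι) (f : κ → (ι → ℝ) → ℝ) (p : ι → ℝ)
    (hf : ∀ k ∈ s, DifferentiableAt ℝ (f k) p) :
    pd a (fun q => ∑ k ∈ s, f k q) p = ∑ k ∈ s, pd a (f k) p := by
  simp only [pd]
  rw [fderiv_fun_sum hf]
  simp

theorem pd_const_mul (a : ι) (c : ℝ) (f : (ι → ℝ) → ℝ) (p : ι → ℝ)
    (hf : DifferentiableAt ℝ f p) :
    pd a (fun q => c * f q) p = c * pd a f p := by
  simp only [pd]
  rw [fderiv_const_mul hf]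
  simp

/-- The vector `∑ h, Γ^h_{ij} X^i Y^j ∂_h`. -/
def gam (G : (ι → ℝ) → Matrix ι ι ℝ) (p X Y : ι → ℝ) : ι → ℝ := fun h =>
  ∑ i, ∑ j, X i * Y j * christoffel G p h i j

theorem gam_add_left (G : (ι → ℝ) → Matrix ι ι ℝ) (p X X' Y : ι → ℝ) :
    gam G p (X + X') Y = gam G p X Y + gam G p X' Y := by
  ext h
  simp only [gam, Pi.add_apply, add_mul, Finset.sum_add_distrib]

theorem gam_add_right (G : (ι → ℝ) → Matrix ι ι ℝ) (p X Y Y' : ι → ℝ) :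
    gam G p X (Y + Y') = gam G p X Y + gam G p X Y' := by
  ext h
  simp only [gam, Pi.add_apply, mul_add, add_mul, Finset.sum_add_distrib]

theorem gam_smul_right (G : (ι → ℝ) → Matrix ι ι ℝ) (p X : ι → ℝ) (s : ℝ) (Y : ι → ℝ) :
    gam G p X (s • Y) = s • gam G p X Y := by
  ext h
  simp only [gam, Pi.smul_apply, smul_eq_mul, Finset.mul_sum]
  exact Finset.sum_congr rfl fun i _ => Finset.sum_congr rfl fun j _ => by ring

theorem gam_smul_left (G : (ι → ℝ) → Matrix ι ι ℝ) (p X : ι → ℝ) (s : ℝ) (Y : ι → ℝ) :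
    gam G p (s • X) Y = s • gam G p X Y := by
  ext h
  simp only [gam, Pi.smul_apply, smul_eq_mul, Finset.mul_sum]
  exact Finset.sum_congr rfl fun i _ => Finset.sum_congr rfl fun j _ => by ring

theorem gam_sub_left (G : (ι → ℝ) → Matrix ι ι ℝ) (p X X' Y : ι → ℝ) :
    gam G p (X - X') Y = gam G p X Y - gam G p X' Y := by
  ext h
  simp only [gam, Pi.sub_apply, sub_mul, Finset.sum_sub_distrib]

theorem christoffel_comm {G : (ι → ℝ) → Matrix ι ι ℝ} (hG : ∀ q i j, G q i j = G q j i)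
    (p : ι → ℝ) (h i j : ι) : christoffel G p h i j = christoffel G p h j i := by
  unfold christoffel
  congr 1
  refine Finset.sum_congr rfl fun k _ => ?_
  have : (fun q => G q i j) = fun q => G q j i := funext fun q => hG q i j
  rw [this]
  ring

theorem gam_comm {G : (ι → ℝ) → Matrix ι ι ℝ} (hG : ∀ q i j, G q i j = G q j i) (p X Y : ι → ℝ) :
    gam G p X Y = gam G p Y X := by
  ext h
  simp only [gam]
  rw [Finset.sum_comm]
  exact Finset.sum_congr rfl fun i _ => Finset.sum_congr rfl fun j _ => by
    rw [christoffel_comm hG p h i j]; ring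

theorem sum_mul_christoffel {G : (ι → ℝ) → Matrix ι ι ℝ} {p : ι → ℝ} (hdet : (G p).det ≠ 0)
    (m i j : ι) :
    ∑ h, G p m h * christoffel G p h i j =
      (1 / 2) * (pd i (fun q => G q j m) p + pd j (fun q => G q i m) p
        - pd m (fun q => G q i j) p) := by
  have hinv : G p * (G p)⁻¹ = 1 := Matrix.mul_nonsing_inv _ (isUnit_iff_ne_zero.mpr hdet)
  have hmk : ∀ k, ∑ h, G p m h * (G p)⁻¹ h k = if m = k then 1 else 0 := fun k => by
    have := congrFun (congrFun hinv m) k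
    rwa [Matrix.mul_apply, Matrix.one_apply] at this
  unfold christoffel
  set S : ι → ℝ := fun k =>
    pd i (fun q => G q j k) p + pd j (fun q => G q i k) p - pd k (fun q => G q i j) p with hS
  calc ∑ h, G p m h * ((1 / 2) * ∑ k, (G p)⁻¹ h k * S k)
      = (1 / 2) * ∑ k, (∑ h, G p m h * (G p)⁻¹ h k) * S k := by
        simp only [Finset.mul_sum, Finset.sum_mul]
        rw [Finset.sum_comm]
        exact Finset.sum_congr rfl fun i _ => Finset.sum_congr rfl fun j _ => by ring
    _ = (1 / 2) * S m := by simp [hmk]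

/-- Koszul formula for vector fields with constant components, whose brackets vanish. -/
theorem pair_gam {G : (ι → ℝ) → Matrix ι ι ℝ} {p : ι → ℝ} (hsymm : ∀ q i j, G q i j = G q j i)
    (hdet : (G p).det ≠ 0) (hG : EntriesDifferentiableAt G p) (X Y W : ι → ℝ) :
    pair G p (gam G p X Y) W =
      (1 / 2) * (fderiv ℝ (fun q => pair G q Y W) p X + fderiv ℝ (fun q => pair G q X W) p Y
        - fderiv ℝ (fun q => pair G q X Y) p W) := by
  have key : pair G p (gam G p X Y) W =
      ∑ m, ∑ i, ∑ j, W m * X i * Y j * ∑ h, G p m h * christoffel G p h i j := by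
    rw [pair_eq_sum, Finset.sum_comm]
    refine Finset.sum_congr rfl fun m _ => ?_
    simp only [gam, Finset.sum_mul, Finset.mul_sum]
    rw [Finset.sum_comm]
    refine Finset.sum_congr rfl fun i _ => ?_
    rw [Finset.sum_comm]
    refine Finset.sum_congr rfl fun j _ => Finset.sum_congr rfl fun h _ => ?_
    rw [hsymm p h m]; ring
  rw [key]
  simp only [fderiv_pair hG, fderiv_apply_eq_sum_pd, sum_mul_christoffel hdet]
  have e1 : ∑ i, ∑ j, Y i * W j * ∑ a, X a * pd a (fun q => G q i j) p =
      ∑ m, ∑ i, ∑ j, W m * X i * Y j * pd i (fun q => G q j m) p := by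
    rw [Finset.sum_comm]
    refine Finset.sum_congr rfl fun m _ => ?_
    simp only [Finset.mul_sum]
    rw [Finset.sum_comm]
    exact Finset.sum_congr rfl fun i _ => Finset.sum_congr rfl fun j _ => by ring
  have e2 : ∑ i, ∑ j, X i * W j * ∑ a, Y a * pd a (fun q => G q i j) p =
      ∑ m, ∑ i, ∑ j, W m * X i * Y j * pd j (fun q => G q i m) p := by
    rw [Finset.sum_comm]
    refine Finset.sum_congr rfl fun m _ => ?_
    simp only [Finset.mul_sum]
    exact Finset.sum_congr rfl fun i _ => Finset.sum_congr rfl fun j _ => by ring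
  have e3 : ∑ i, ∑ j, X i * Y j * ∑ a, W a * pd a (fun q => G q i j) p =
      ∑ m, ∑ i, ∑ j, W m * X i * Y j * pd m (fun q => G q i j) p := by
    simp only [Finset.mul_sum]
    rw [Finset.sum_congr rfl fun i _ => Finset.sum_comm, Finset.sum_comm]
    exact Finset.sum_congr rfl fun m _ => Finset.sum_congr rfl fun i _ =>
      Finset.sum_congr rfl fun j _ => by ring
  rw [e1, e2, e3]
  simp only [← Finset.sum_add_distrib, ← Finset.sum_sub_distrib, Finset.mul_sum]
  exact Finset.sum_congr rfl fun m _ => Finset.sum_congr rfl fun i _ =>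
    Finset.sum_congr rfl fun j _ => by ring

/-- The Levi-Civita connection is metric. -/
theorem fderiv_pair_eq_gam {G : (ι → ℝ) → Matrix ι ι ℝ} {p : ι → ℝ}
    (hsymm : ∀ q i j, G q i j = G q j i) (hdet : (G p).det ≠ 0)
    (hG : EntriesDifferentiableAt G p) (X Y v : ι → ℝ) :
    fderiv ℝ (fun q => pair G q X Y) p v = pair G p (gam G p v X) Y + pair G p X (gam G p v Y) := by
  rw [pair_comm hsymm p X, pair_gam hsymm hdet hG, pair_gam hsymm hdet hG]
  simp only [pair_comm hsymm _ Y X]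
  ring

/-- The Leibniz rule (∇_X J)Y = ∇_X(JY) - J∇_X Y, with Y extended by constant components. -/
theorem covDerivEnd_eq {G J : (ι → ℝ) → Matrix ι ι ℝ} {p : ι → ℝ}
    (hJ : EntriesDifferentiableAt J p) (X Y : ι → ℝ) :
    covDerivEnd G J p X Y = fderiv ℝ (fun q => J q *ᵥ Y) p X + gam G p X (J p *ᵥ Y)
      - J p *ᵥ gam G p X Y := by
  ext d
  have hd : fderiv ℝ (fun q => J q *ᵥ Y) p X d = ∑ a, ∑ b, X a * Y b * pd a (fun q => J q d b) p := by
    have h1 : fderiv ℝ (fun q => J q *ᵥ Y) p X d = fderiv ℝ (fun q => (J q *ᵥ Y) d) p X := by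
      rw [fderiv_apply (hJ.mulVec Y)]
      rfl
    have h2 := hJ
    unfold EntriesDifferentiableAt at h2
    rw [h1]
    simp only [Matrix.mulVec, dotProduct]
    rw [fderiv_apply_eq_sum_pd]
    refine Finset.sum_congr rfl fun a _ => ?_
    rw [pd_sum _ _ _ _ (fun k _ => by fun_prop), Finset.mul_sum]
    refine Finset.sum_congr rfl fun b _ => ?_
    simp only [mul_comm _ (Y b)]
    rw [pd_const_mul _ _ _ _ (h2 d b)]
    ring
  simp only [Pi.add_apply, Pi.sub_apply, hd]
  simp only [covDerivEnd, gam, Matrix.mulVec, dotProduct, mul_add, mul_sub, Finset.sum_add_distrib,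
    Finset.sum_sub_distrib, Finset.mul_sum, Finset.sum_mul]
  have e1 : ∑ a, ∑ b, ∑ e, X a * Y b * (christoffel G p d a e * J p e b) =
      ∑ a, ∑ e, ∑ b, X a * (J p e b * Y b) * christoffel G p d a e := by
    refine Finset.sum_congr rfl fun a _ => ?_
    rw [Finset.sum_comm]
    exact Finset.sum_congr rfl fun i _ => Finset.sum_congr rfl fun j _ => by ring
  have e2 : ∑ a, ∑ b, ∑ e, X a * Y b * (J p d e * christoffel G p e a b) =
      ∑ e, ∑ a, ∑ b, J p d e * (X a * Y b * christoffel G p e a b) := by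
    rw [Finset.sum_congr rfl fun i _ => Finset.sum_comm, Finset.sum_comm]
    exact Finset.sum_congr rfl fun m _ => Finset.sum_congr rfl fun i _ =>
      Finset.sum_congr rfl fun j _ => by ring
  rw [e1, e2]
  ring

/-- The value `F(X, X, X)` involves no Christoffel symbols. -/
theorem tensorF_self {G J : (ι → ℝ) → Matrix ι ι ℝ} {p : ι → ℝ}
    (hsymm : ∀ q i j, G q i j = G q j i) (hdet : (G p).det ≠ 0)
    (hG : EntriesDifferentiableAt G p) (hJ : EntriesDifferentiableAt J p)
    (hGJ : ∀ X Y, pair G p (J p *ᵥ X) Y = pair G p X (J p *ᵥ Y)) (X : ι → ℝ) :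
    tensorF G J p X X X = fderiv ℝ (fun q => pair G q X (J q *ᵥ X)) p X
      - 2 * fderiv ℝ (fun q => pair G q X (J p *ᵥ X)) p X
      + fderiv ℝ (fun q => pair G q X X) p (J p *ᵥ X) := by
  -- Let W be the constant extension of JX. By Koszul, G(Γ(X,W),X) is half the W-derivative of
  -- G(X,X), and G(Γ(X,X),W) is the X-derivative of G(X,W) minus that half. Self-adjointness of J
  -- brings the last Christoffel term of F(X,X,X) into this second form.
  rw [tensorF, covDerivEnd_eq hJ, pair_sub_left, pair_add_left, hGJ, pair_gam hsymm hdet hG,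
    pair_gam hsymm hdet hG, fderiv_pair_mulVec hG hJ, pair_comm hsymm p X]
  simp only [pair_comm hsymm _ (J p *ᵥ X) X]
  ring

end PointwiseCoordinates


/-! ### Covariant differentiation along coordinate lines of the base -/

section CovariantDerivative

variable {n : ℕ}

/-- `g` is a smooth Riemannian metric in coordinates on the open set `U`. -/
structure IsMetricOn (g : (Fin n → ℝ) → Matrix (Fin n) (Fin n) ℝ) (U : Set (Fin n → ℝ)) :
    Prop where
  isOpen : IsOpen U
  smooth : ∀ i j, ContDiffOn ℝ ∞ (fun x => g x i j) U
  symm : ∀ x i j, g x i j = g x j i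
  pos : ∀ x ∈ U, ∀ v : Fin n → ℝ, v ≠ 0 → 0 < pair g x v v

variable {g : (Fin n → ℝ) → Matrix (Fin n) (Fin n) ℝ} {U : Set (Fin n → ℝ)} {x : Fin n → ℝ}

theorem IsMetricOn.det_ne_zero (h : IsMetricOn g U) (hx : x ∈ U) : (g x).det ≠ 0 := by
  intro h0
  obtain ⟨v, hv, hv0⟩ := Matrix.exists_mulVec_eq_zero_iff.2 h0
  have := h.pos x hx v hv
  simp [pair, hv0] at this

theorem IsMetricOn.contDiffAt (h : IsMetricOn g U) (hx : x ∈ U) (i j : Fin n) :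
    ContDiffAt ℝ ∞ (fun x => g x i j) x :=
  (h.smooth i j).contDiffAt (h.isOpen.mem_nhds hx)

theorem IsMetricOn.entriesDifferentiableAt (h : IsMetricOn g U) (hx : x ∈ U) :
    EntriesDifferentiableAt g x := fun i j =>
  (h.contDiffAt hx i j).differentiableAt (by simp)

theorem EntriesDifferentiableAt.det {E κ : Type*} [Fintype E] [Fintype κ] [DecidableEq κ]
    {A : (E → ℝ) → Matrix κ κ ℝ} {p : E → ℝ} (hA : EntriesDifferentiableAt A p) :
    DifferentiableAt ℝ (fun q => (A q).det) p := by
  unfold EntriesDifferentiableAt at hA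
  simp only [Matrix.det_apply]
  fun_prop

theorem EntriesDifferentiableAt.inv {E κ : Type*} [Fintype E] [Fintype κ] [DecidableEq κ]
    {A : (E → ℝ) → Matrix κ κ ℝ} {p : E → ℝ} (hA : EntriesDifferentiableAt A p)
    (hdet : (A p).det ≠ 0) : EntriesDifferentiableAt (fun q => (A q)⁻¹) p := by
  intro i j
  have hadj : DifferentiableAt ℝ (fun q => (A q).adjugate i j) p := by
    simp only [Matrix.adjugate_apply]
    apply EntriesDifferentiableAt.det
    intro k l
    simp only [Matrix.updateRow_apply]
    split_ifs
    · fun_prop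
    · exact hA k l
  have h1 := (hA.det.inv hdet).mul hadj
  refine h1.congr_of_eventuallyEq (Filter.Eventually.of_forall fun q => ?_)
  simp [Matrix.inv_def]

theorem ContDiffAt.differentiableAt_pd {ι : Type*} [Fintype ι] [DecidableEq ι]
    {f : (ι → ℝ) → ℝ} {p : ι → ℝ} (hf : ContDiffAt ℝ ∞ f p) (a : ι) :
    DifferentiableAt ℝ (pd a f) p := by
  have h1 : ContDiffAt ℝ 1 (fderiv ℝ f) p := hf.fderiv_right (by norm_cast)
  exact (h1.differentiableAt (by simp)).clm_apply (differentiableAt_const _)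

theorem IsMetricOn.differentiableAt_christoffel (h : IsMetricOn g U) (hx : x ∈ U)
    (k i j : Fin n) : DifferentiableAt ℝ (fun q => christoffel g q k i j) x := by
  have hinv := (h.entriesDifferentiableAt hx).inv (h.det_ne_zero hx)
  unfold EntriesDifferentiableAt at hinv
  have hpd : ∀ a b c, DifferentiableAt ℝ (fun q => pd a (fun q => g q b c) q) x := fun a b c =>
    ContDiffAt.differentiableAt_pd (h.contDiffAt hx b c) a
  unfold christoffel
  refine DifferentiableAt.const_mul (DifferentiableAt.fun_sum fun l _ => ?_) _
  exact (hinv k l).fun_mul (((hpd i j l).fun_add (hpd j i l)).fun_sub (hpd l i j))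

theorem IsMetricOn.differentiableAt_gam (h : IsMetricOn g U) (hx : x ∈ U) (X Y : Fin n → ℝ) :
    DifferentiableAt ℝ (fun q => gam g q X Y) x := by
  have := h.differentiableAt_christoffel hx
  rw [differentiableAt_pi]
  intro k
  unfold gam
  fun_prop

/-- The vector field `a` along the line `s ↦ x + s v` has the covariant derivative `a'` at `0`. -/
def HasCovDerivAt (g : (Fin n → ℝ) → Matrix (Fin n) (Fin n) ℝ) (x v : Fin n → ℝ)
    (a : ℝ → Fin n → ℝ) (a' : Fin n → ℝ) : Prop :=
  HasDerivAt a (a' - gam g x v (a 0)) 0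

variable {v a' b' : Fin n → ℝ} {a b : ℝ → Fin n → ℝ}

theorem hasCovDerivAt_const (g : (Fin n → ℝ) → Matrix (Fin n) (Fin n) ℝ) (x v w : Fin n → ℝ) :
    HasCovDerivAt g x v (fun _ => w) (gam g x v w) := by
  simpa [HasCovDerivAt] using hasDerivAt_const (0 : ℝ) w

theorem HasCovDerivAt.add (ha : HasCovDerivAt g x v a a') (hb : HasCovDerivAt g x v b b') :
    HasCovDerivAt g x v (fun s => a s + b s) (a' + b') := by
  have h := HasDerivAt.fun_add ha hb
  rw [HasCovDerivAt, gam_add_right]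
  exact h.congr_deriv (by abel)

theorem HasCovDerivAt.congr (ha : HasCovDerivAt g x v a a') (h : a' = b') :
    HasCovDerivAt g x v a b' :=
  h ▸ ha

theorem gam_neg_right {ι : Type*} [Fintype ι] [DecidableEq ι] (G : (ι → ℝ) → Matrix ι ι ℝ)
    (p X Y : ι → ℝ) : gam G p X (-Y) = -gam G p X Y := by
  simpa using gam_smul_right G p X (-1) Y

theorem HasCovDerivAt.sub (ha : HasCovDerivAt g x v a a') (hb : HasCovDerivAt g x v b b') :
    HasCovDerivAt g x v (fun s => a s - b s) (a' - b') := by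
  have h := HasDerivAt.fun_sub ha hb
  rw [HasCovDerivAt, sub_eq_add_neg (a 0), gam_add_right, gam_neg_right]
  exact h.congr_deriv (by abel)

theorem HasCovDerivAt.smul {f : ℝ → ℝ} {f' : ℝ} (hf : HasDerivAt f f' 0)
    (ha : HasCovDerivAt g x v a a') :
    HasCovDerivAt g x v (fun s => f s • a s) (f' • a 0 + f 0 • a') := by
  have h := HasDerivAt.fun_smul hf ha
  rw [HasCovDerivAt, gam_smul_right]
  exact h.congr_deriv (by rw [smul_sub]; abel)

/-- Because g is parallel, the derivatives of its components cancel against the Christoffel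
corrections. Expressions built from g and fields along a line can thus be differentiated as if g
were constant, which is what makes the lifts computable. -/
theorem HasCovDerivAt.pair (hg : IsMetricOn g U) (hx : x ∈ U) (ha : HasCovDerivAt g x v a a')
    (hb : HasCovDerivAt g x v b b') :
    HasDerivAt (fun s : ℝ => pair g (x + s • v) (a s) (b s))
      (pair g x a' (b 0) + pair g x (a 0) b') 0 := by
  have hline : HasDerivAt (fun s : ℝ => x + s • v) v 0 := by
    simpa using ((hasDerivAt_id (0 : ℝ)).smul_const v).const_add x
  have hgl : ∀ i j, HasDerivAt (fun s : ℝ => g (x + s • v) i j)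
      (fderiv ℝ (fun q => g q i j) x v) 0 := fun i j => by
    have h1 : HasFDerivAt (fun q => g q i j) (fderiv ℝ (fun q => g q i j) x) (x + (0 : ℝ) • v) := by
      simpa using (hg.entriesDifferentiableAt hx i j).hasFDerivAt
    exact h1.comp_hasDerivAt (0 : ℝ) hline
  have ha1 := hasDerivAt_pi.1 ha
  have hb1 := hasDerivAt_pi.1 hb
  have H := HasDerivAt.fun_sum (u := Finset.univ) fun i _ =>
    HasDerivAt.fun_sum (u := Finset.univ) fun j _ => ((ha1 i).fun_mul (hb1 j)).fun_mul (hgl i j)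
  simp only [← pair_eq_sum] at H
  refine H.congr_deriv ?_
  simp only [zero_smul, add_zero, Finset.sum_add_distrib, add_mul]
  rw [← fderiv_pair (hg.entriesDifferentiableAt hx), ← pair_eq_sum, ← pair_eq_sum,
    fderiv_pair_eq_gam hg.symm (hg.det_ne_zero hx) (hg.entriesDifferentiableAt hx),
    pair_sub_left, pair_sub_right]
  ring

/-- The form `(a, b) ↦ c(t) g(a, b) + d(t) g(y, a) g(y, b)` with `t = g(y, y) / 2`. -/
def metricForm (g : (Fin n → ℝ) → Matrix (Fin n) (Fin n) ℝ) (c d : ℝ → ℝ)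
    (x y a b : Fin n → ℝ) : ℝ :=
  c ((1 / 2) * pair g x y y) * pair g x a b
    + d ((1 / 2) * pair g x y y) * (pair g x y a * pair g x y b)

/-- The derivative of `metricForm` in the vertical direction `u`. -/
def metricFormDot (g : (Fin n → ℝ) → Matrix (Fin n) (Fin n) ℝ) (c' d d' : ℝ)
    (x y u a b : Fin n → ℝ) : ℝ :=
  c' * pair g x y u * pair g x a b + d' * pair g x y u * (pair g x y a * pair g x y b)
    + d * (pair g x u a * pair g x y b + pair g x y a * pair g x u b)

/-- The endomorphism `z ↦ a(t) z + b(t) g(y, z) y` with `t = g(y, y) / 2`. -/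
def endForm (g : (Fin n → ℝ) → Matrix (Fin n) (Fin n) ℝ) (a b : ℝ → ℝ)
    (x y z : Fin n → ℝ) : Fin n → ℝ :=
  a ((1 / 2) * pair g x y y) • z + (b ((1 / 2) * pair g x y y) * pair g x y z) • y

/-- The derivative of `endForm` in the vertical direction `u`. -/
def endFormDot (g : (Fin n → ℝ) → Matrix (Fin n) (Fin n) ℝ) (a' b b' : ℝ)
    (x y u z : Fin n → ℝ) : Fin n → ℝ :=
  (a' * pair g x y u) • z + (b' * pair g x y u * pair g x y z + b * pair g x u z) • y
    + (b * pair g x y z) • u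

variable {y : ℝ → Fin n → ℝ} {u : Fin n → ℝ}

theorem HasCovDerivAt.energy (hg : IsMetricOn g U) (hx : x ∈ U) (hy : HasCovDerivAt g x v y u) :
    HasDerivAt (fun s : ℝ => (1 / 2) * NaturalLift.pair g (x + s • v) (y s) (y s))
      (NaturalLift.pair g x (y 0) u) 0 := by
  refine ((hy.pair hg hx hy).const_mul (1 / 2)).congr_deriv ?_
  rw [pair_comm hg.symm x u]
  ring

theorem HasCovDerivAt.comp_energy (hg : IsMetricOn g U) (hx : x ∈ U)
    (hy : HasCovDerivAt g x v y u) {c : ℝ → ℝ} {c' : ℝ}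
    (hc : HasDerivAt c c' ((1 / 2) * NaturalLift.pair g x (y 0) (y 0))) :
    HasDerivAt (fun s : ℝ => c ((1 / 2) * NaturalLift.pair g (x + s • v) (y s) (y s)))
      (c' * NaturalLift.pair g x (y 0) u) 0 :=
  HasDerivAt.comp (h₂ := c) (0 : ℝ) (by simpa using hc) (hy.energy hg hx)

theorem HasCovDerivAt.metricForm (hg : IsMetricOn g U) (hx : x ∈ U)
    (hy : HasCovDerivAt g x v y u) (ha : HasCovDerivAt g x v a a') (hb : HasCovDerivAt g x v b b')
    {c d : ℝ → ℝ} {c' d' : ℝ}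
    (hc : HasDerivAt c c' ((1 / 2) * NaturalLift.pair g x (y 0) (y 0)))
    (hd : HasDerivAt d d' ((1 / 2) * NaturalLift.pair g x (y 0) (y 0))) :
    HasDerivAt (fun s : ℝ => metricForm g c d (x + s • v) (y s) (a s) (b s))
      (metricFormDot g c' (d ((1 / 2) * NaturalLift.pair g x (y 0) (y 0))) d' x (y 0) u (a 0) (b 0)
        + NaturalLift.metricForm g c d x (y 0) a' (b 0)
        + NaturalLift.metricForm g c d x (y 0) (a 0) b') 0 := by
  have h1 := (hy.comp_energy hg hx hc).mul (ha.pair hg hx hb)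
  have h2 := (hy.comp_energy hg hx hd).mul ((hy.pair hg hx ha).mul (hy.pair hg hx hb))
  refine (h1.add h2).congr_deriv ?_
  simp only [NaturalLift.metricForm, metricFormDot, zero_smul, add_zero, Pi.mul_apply]
  ring

theorem HasCovDerivAt.endForm (hg : IsMetricOn g U) (hx : x ∈ U)
    (hy : HasCovDerivAt g x v y u) (ha : HasCovDerivAt g x v a a')
    {c d : ℝ → ℝ} {c' d' : ℝ}
    (hc : HasDerivAt c c' ((1 / 2) * NaturalLift.pair g x (y 0) (y 0)))
    (hd : HasDerivAt d d' ((1 / 2) * NaturalLift.pair g x (y 0) (y 0))) :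
    HasCovDerivAt g x v (fun s : ℝ => endForm g c d (x + s • v) (y s) (a s))
      (endFormDot g c' (d ((1 / 2) * NaturalLift.pair g x (y 0) (y 0))) d' x (y 0) u (a 0)
        + NaturalLift.endForm g c d x (y 0) a') := by
  have h1 := HasCovDerivAt.smul (hy.comp_energy hg hx hc) ha
  have h2 := HasCovDerivAt.smul ((hy.comp_energy hg hx hd).mul (hy.pair hg hx ha)) hy
  refine HasCovDerivAt.congr (h1.add h2) ?_
  simp only [NaturalLift.endForm, endFormDot, zero_smul, add_zero, Pi.mul_apply]
  module

end CovariantDerivative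


/-! ### The lifts in the adapted frame and their differentiability -/

section LiftsInAdaptedFrame

variable {n : ℕ} (g : (Fin n → ℝ) → Matrix (Fin n) (Fin n) ℝ) (A : EndCoeffs) (C : MetricCoeffs)

/-- The vertical components of the vector `X` at `p` in the adapted frame. -/
def ver (p X : Fin n ⊕ Fin n → ℝ) : Fin n → ℝ :=
  fib X + gam g (base p) (fib p) (base X)

/-- The value of the natural metric on vectors with the adapted components `(ξ, η)`, `(ξ', η')`. -/
def liftedForm (x y ξ η ξ' η' : Fin n → ℝ) : ℝ :=
  metricForm g C.c₁ C.d₁ x y ξ ξ' + metricForm g C.c₃ C.d₃ x y ξ η'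
    + metricForm g C.c₃ C.d₃ x y η ξ' + metricForm g C.c₂ C.d₂ x y η η'

/-- The horizontal components of `J` applied to the vector with the adapted components `(ξ, η)`. -/
def horJ (x y ξ η : Fin n → ℝ) : Fin n → ℝ :=
  endForm g A.a₄ A.b₄ x y ξ - endForm g A.a₂ A.b₂ x y η

/-- The vertical components of `J` applied to the vector with the adapted components `(ξ, η)`. -/
def verJ (x y ξ η : Fin n → ℝ) : Fin n → ℝ :=
  endForm g A.a₁ A.b₁ x y ξ + endForm g A.a₃ A.b₃ x y η

theorem nonlinConn_mulVec (p : Fin n ⊕ Fin n → ℝ) (ξ : Fin n → ℝ) :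
    nonlinConn g p *ᵥ ξ = gam g (base p) (fib p) ξ := by
  ext h
  simp only [nonlinConn, Matrix.mulVec, dotProduct, gam, Finset.sum_mul]
  rw [Finset.sum_comm]
  exact Finset.sum_congr rfl fun i _ => Finset.sum_congr rfl fun j _ => by ring

theorem coframe_mulVec (p X : Fin n ⊕ Fin n → ℝ) :
    coframe g p *ᵥ X = Sum.elim (base X) (ver g p X) := by
  rw [coframe, Matrix.fromBlocks_mulVec]
  have h1 : X ∘ Sum.inl = base X := rfl
  have h2 : X ∘ Sum.inr = fib X := rfl
  simp [h1, h2, nonlinConn_mulVec, ver, add_comm]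

theorem frame_mulVec (p : Fin n ⊕ Fin n → ℝ) (ξ η : Fin n → ℝ) :
    frame g p *ᵥ Sum.elim ξ η = Sum.elim ξ (η - gam g (base p) (fib p) ξ) := by
  rw [frame, Matrix.fromBlocks_mulVec]
  simp [Matrix.neg_mulVec, nonlinConn_mulVec, sub_eq_add_neg, add_comm]

theorem base_elim (ξ η : Fin n → ℝ) : base (Sum.elim ξ η) = ξ := rfl

theorem fib_elim (ξ η : Fin n → ℝ) : fib (Sum.elim ξ η) = η := rfl

theorem ver_frame (p : Fin n ⊕ Fin n → ℝ) (ξ η : Fin n → ℝ) :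
    ver g p (frame g p *ᵥ Sum.elim ξ η) = η := by
  simp [frame_mulVec, ver, base_elim, fib_elim]

theorem base_frame (p : Fin n ⊕ Fin n → ℝ) (ξ η : Fin n → ℝ) :
    base (frame g p *ᵥ Sum.elim ξ η) = ξ := by
  simp [frame_mulVec, base_elim]

theorem energy_eq (p : Fin n ⊕ Fin n → ℝ) :
    energy g p = (1 / 2) * pair g (base p) (fib p) (fib p) := by
  rw [energy, pair_eq_sum]
  congr 1
  exact Finset.sum_congr rfl fun i _ => Finset.sum_congr rfl fun j _ => by ring

theorem lower_dotProduct (p : Fin n ⊕ Fin n → ℝ) (a : Fin n → ℝ) :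
    lower g p ⬝ᵥ a = pair g (base p) (fib p) a := by
  simp only [dotProduct, lower, pair_eq_sum, Finset.sum_mul]
  rw [Finset.sum_comm]
  exact Finset.sum_congr rfl fun i _ => Finset.sum_congr rfl fun j _ => by ring

theorem endBlock_mulVec (a b : ℝ → ℝ) (p : Fin n ⊕ Fin n → ℝ) (z : Fin n → ℝ) :
    endBlock g a b p *ᵥ z = endForm g a b (base p) (fib p) z := by
  ext i
  simp [endBlock, endForm, Matrix.add_mulVec, Matrix.smul_mulVec, Matrix.vecMulVec_mulVec,
    lower_dotProduct, energy_eq]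
  ring

theorem dotProduct_metricBlock (c d : ℝ → ℝ) (p : Fin n ⊕ Fin n → ℝ) (a b : Fin n → ℝ) :
    a ⬝ᵥ (metricBlock g c d p *ᵥ b) = metricForm g c d (base p) (fib p) a b := by
  rw [metricBlock, metricForm, ← energy_eq, ← lower_dotProduct, ← lower_dotProduct,
    Matrix.add_mulVec, Matrix.smul_mulVec, Matrix.smul_mulVec, Matrix.vecMulVec_mulVec]
  simp only [dotProduct_add, dotProduct_smul, smul_eq_mul, op_smul_eq_smul,
    dotProduct_comm a (lower g p), pair]
  ring

theorem pair_liftG (p X W : Fin n ⊕ Fin n → ℝ) :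
    pair (liftG g C) p X W =
      liftedForm g C (base p) (fib p) (base X) (ver g p X) (base W) (ver g p W) := by
  rw [pair, liftG, ← Matrix.mulVec_mulVec, ← Matrix.mulVec_mulVec, Matrix.dotProduct_mulVec,
    Matrix.vecMul_transpose, coframe_mulVec, coframe_mulVec, Matrix.fromBlocks_mulVec,
    sumElim_dotProduct_sumElim]
  simp only [dotProduct_add, Sum.elim_comp_inl, Sum.elim_comp_inr, dotProduct_metricBlock,
    liftedForm]
  ring

theorem liftJ_mulVec (p W : Fin n ⊕ Fin n → ℝ) :
    liftJ g A p *ᵥ W = frame g p *ᵥ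
      Sum.elim (horJ g A (base p) (fib p) (base W) (ver g p W))
        (verJ g A (base p) (fib p) (base W) (ver g p W)) := by
  rw [liftJ, ← Matrix.mulVec_mulVec, ← Matrix.mulVec_mulVec, coframe_mulVec,
    Matrix.fromBlocks_mulVec]
  simp only [Sum.elim_comp_inl, Sum.elim_comp_inr, Matrix.neg_mulVec, endBlock_mulVec, horJ, verJ,
    sub_eq_add_neg]

variable {g A C}

theorem pair_liftG_comm (hsymm : ∀ x i j, g x i j = g x j i) (p X W : Fin n ⊕ Fin n → ℝ) :
    pair (liftG g C) p X W = pair (liftG g C) p W X := by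
  simp only [pair_liftG, liftedForm, metricForm]
  rw [pair_comm hsymm _ (base X) (base W), pair_comm hsymm _ (base X) (ver g p W),
    pair_comm hsymm _ (ver g p X) (base W), pair_comm hsymm _ (ver g p X) (ver g p W)]
  ring

theorem liftG_comm (hsymm : ∀ x i j, g x i j = g x j i) (p : Fin n ⊕ Fin n → ℝ)
    (i j : Fin n ⊕ Fin n) : liftG g C p i j = liftG g C p j i := by
  have h := pair_liftG_comm (C := C) hsymm p (Pi.single i 1) (Pi.single j 1)
  simpa [pair] using h

theorem EntriesDifferentiableAt.mul {E κ : Type*} [Fintype E] [Fintype κ]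
    {A B : (E → ℝ) → Matrix κ κ ℝ} {p : E → ℝ} (hA : EntriesDifferentiableAt A p)
    (hB : EntriesDifferentiableAt B p) : EntriesDifferentiableAt (fun q => A q * B q) p := by
  intro i j
  unfold EntriesDifferentiableAt at hA hB
  simp only [Matrix.mul_apply]
  fun_prop

theorem EntriesDifferentiableAt.fromBlocks {E κ : Type*} [Fintype E] [Fintype κ]
    {A B C D : (E → ℝ) → Matrix κ κ ℝ} {p : E → ℝ} (hA : EntriesDifferentiableAt A p)
    (hB : EntriesDifferentiableAt B p) (hC : EntriesDifferentiableAt C p)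
    (hD : EntriesDifferentiableAt D p) :
    EntriesDifferentiableAt (fun q => Matrix.fromBlocks (A q) (B q) (C q) (D q)) p := by
  rintro (i | i) (j | j)
  · exact hA i j
  · exact hB i j
  · exact hC i j
  · exact hD i j

theorem EntriesDifferentiableAt.transpose {E κ : Type*} [Fintype E] [Fintype κ]
    {A : (E → ℝ) → Matrix κ κ ℝ} {p : E → ℝ} (hA : EntriesDifferentiableAt A p) :
    EntriesDifferentiableAt (fun q => (A q)ᵀ) p := fun i j => hA j i

theorem EntriesDifferentiableAt.neg {E κ : Type*} [Fintype E] [Fintype κ]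
    {A : (E → ℝ) → Matrix κ κ ℝ} {p : E → ℝ} (hA : EntriesDifferentiableAt A p) :
    EntriesDifferentiableAt (fun q => -A q) p := fun i j => (hA i j).fun_neg

theorem entriesDifferentiableAt_const {E κ : Type*} [Fintype E] [Fintype κ]
    (B : Matrix κ κ ℝ) (p : E → ℝ) : EntriesDifferentiableAt (fun _ => B) p := fun _ _ =>
  differentiableAt_const _

variable {U : Set (Fin n → ℝ)} {p : Fin n ⊕ Fin n → ℝ}

theorem differentiable_base : Differentiable ℝ (base : (Fin n ⊕ Fin n → ℝ) → Fin n → ℝ) := by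
  unfold base
  fun_prop

theorem differentiableAt_fib_apply (p : Fin n ⊕ Fin n → ℝ) (k : Fin n) :
    DifferentiableAt ℝ (fun q : Fin n ⊕ Fin n → ℝ => fib q k) p := by
  unfold fib
  fun_prop

theorem IsMetricOn.entriesDifferentiableAt_base (hg : IsMetricOn g U) (hx : base p ∈ U) :
    EntriesDifferentiableAt (fun q : Fin n ⊕ Fin n → ℝ => g (base q)) p := fun i j =>
  (hg.entriesDifferentiableAt hx i j).comp (f := base) p (differentiable_base p)

theorem IsMetricOn.entriesDifferentiableAt_nonlinConn (hg : IsMetricOn g U) (hx : base p ∈ U) :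
    EntriesDifferentiableAt (nonlinConn g) p := by
  intro h i
  unfold nonlinConn
  have h2 : ∀ k, DifferentiableAt ℝ (fun q : Fin n ⊕ Fin n → ℝ => christoffel g (base q) h k i) p :=
    fun k => (hg.differentiableAt_christoffel hx h k i).comp (f := base) p (differentiable_base p)
  have h3 := differentiableAt_fib_apply p
  fun_prop

theorem IsMetricOn.entriesDifferentiableAt_coframe (hg : IsMetricOn g U) (hx : base p ∈ U) :
    EntriesDifferentiableAt (coframe g) p :=
  .fromBlocks (entriesDifferentiableAt_const _ _) (entriesDifferentiableAt_const _ _)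
    (hg.entriesDifferentiableAt_nonlinConn hx) (entriesDifferentiableAt_const _ _)

theorem IsMetricOn.entriesDifferentiableAt_frame (hg : IsMetricOn g U) (hx : base p ∈ U) :
    EntriesDifferentiableAt (frame g) p :=
  .fromBlocks (entriesDifferentiableAt_const _ _) (entriesDifferentiableAt_const _ _)
    (hg.entriesDifferentiableAt_nonlinConn hx).neg (entriesDifferentiableAt_const _ _)

theorem IsMetricOn.differentiableAt_lower (hg : IsMetricOn g U) (hx : base p ∈ U) (i : Fin n) :
    DifferentiableAt ℝ (fun q => lower g q i) p := by
  have h1 := hg.entriesDifferentiableAt_base hx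
  have h2 := differentiableAt_fib_apply p
  exact DifferentiableAt.fun_sum fun h _ => (h2 h).fun_mul (h1 h i)

theorem IsMetricOn.differentiableAt_energy (hg : IsMetricOn g U) (hx : base p ∈ U) :
    DifferentiableAt ℝ (energy g) p := by
  have h1 := hg.entriesDifferentiableAt_base hx
  have h2 := differentiableAt_fib_apply p
  exact (DifferentiableAt.fun_sum fun i _ => DifferentiableAt.fun_sum fun k _ =>
    ((h1 i k).fun_mul (h2 i)).fun_mul (h2 k)).const_mul _

theorem IsMetricOn.entriesDifferentiableAt_endBlock (hg : IsMetricOn g U) (hx : base p ∈ U)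
    {a b : ℝ → ℝ} (ha : DifferentiableAt ℝ a (energy g p))
    (hb : DifferentiableAt ℝ b (energy g p)) : EntriesDifferentiableAt (endBlock g a b) p := by
  intro i j
  have h1 := hg.differentiableAt_lower hx
  have h2 := differentiableAt_fib_apply p
  have h3 := ha.comp p (hg.differentiableAt_energy hx)
  have h4 := hb.comp p (hg.differentiableAt_energy hx)
  exact (h3.fun_mul (differentiableAt_const _)).fun_add (h4.fun_mul ((h2 i).fun_mul (h1 j)))

theorem IsMetricOn.entriesDifferentiableAt_metricBlock (hg : IsMetricOn g U) (hx : base p ∈ U)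
    {a b : ℝ → ℝ} (ha : DifferentiableAt ℝ a (energy g p))
    (hb : DifferentiableAt ℝ b (energy g p)) : EntriesDifferentiableAt (metricBlock g a b) p := by
  intro i j
  have h1 := hg.differentiableAt_lower hx
  have h2 := hg.entriesDifferentiableAt_base hx i j
  have h3 := ha.comp p (hg.differentiableAt_energy hx)
  have h4 := hb.comp p (hg.differentiableAt_energy hx)
  exact (h3.fun_mul h2).fun_add (h4.fun_mul ((h1 i).fun_mul (h1 j)))

/-- Only for t > 0 is the one-sided derivative two-sided. All differentiation on the tangent bundle
is therefore done off the zero section, and t = 0 is recovered at the end as a limit. -/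
theorem hasDerivAt_dt {f : ℝ → ℝ} (hf : ContDiffOn ℝ ∞ f (Set.Ici 0)) {t : ℝ} (ht : 0 < t) :
    HasDerivAt f (dt f t) t := by
  have h := ((hf t ht.le).differentiableWithinAt (by simp)).hasDerivWithinAt
  exact h.hasDerivAt (Ici_mem_nhds ht)

theorem IsMetricOn.entriesDifferentiableAt_liftJ (hg : IsMetricOn g U) (hx : base p ∈ U)
    (ht : 0 < energy g p) (A : EndCoeffs) : EntriesDifferentiableAt (liftJ g A) p :=
  ((hg.entriesDifferentiableAt_frame hx).mul
    (.fromBlocks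
      (hg.entriesDifferentiableAt_endBlock hx (hasDerivAt_dt A.smooth_a₄ ht).differentiableAt
        (hasDerivAt_dt A.smooth_b₄ ht).differentiableAt)
      (hg.entriesDifferentiableAt_endBlock hx (hasDerivAt_dt A.smooth_a₂ ht).differentiableAt
        (hasDerivAt_dt A.smooth_b₂ ht).differentiableAt).neg
      (hg.entriesDifferentiableAt_endBlock hx (hasDerivAt_dt A.smooth_a₁ ht).differentiableAt
        (hasDerivAt_dt A.smooth_b₁ ht).differentiableAt)
      (hg.entriesDifferentiableAt_endBlock hx (hasDerivAt_dt A.smooth_a₃ ht).differentiableAt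
        (hasDerivAt_dt A.smooth_b₃ ht).differentiableAt))).mul
    (hg.entriesDifferentiableAt_coframe hx)

theorem IsMetricOn.entriesDifferentiableAt_liftG (hg : IsMetricOn g U) (hx : base p ∈ U)
    (ht : 0 < energy g p) (C : MetricCoeffs) : EntriesDifferentiableAt (liftG g C) p :=
  ((hg.entriesDifferentiableAt_coframe hx).transpose.mul
    (.fromBlocks
      (hg.entriesDifferentiableAt_metricBlock hx (hasDerivAt_dt C.smooth_c₁ ht).differentiableAt
        (hasDerivAt_dt C.smooth_d₁ ht).differentiableAt)
      (hg.entriesDifferentiableAt_metricBlock hx (hasDerivAt_dt C.smooth_c₃ ht).differentiableAt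
        (hasDerivAt_dt C.smooth_d₃ ht).differentiableAt)
      (hg.entriesDifferentiableAt_metricBlock hx (hasDerivAt_dt C.smooth_c₃ ht).differentiableAt
        (hasDerivAt_dt C.smooth_d₃ ht).differentiableAt)
      (hg.entriesDifferentiableAt_metricBlock hx (hasDerivAt_dt C.smooth_c₂ ht).differentiableAt
        (hasDerivAt_dt C.smooth_d₂ ht).differentiableAt))).mul
    (hg.entriesDifferentiableAt_coframe hx)

end LiftsInAdaptedFrame


/-! ### Algebraic curvature tensors -/

section AlgebraicCurvature

variable {V : Type*} {D : V → V → V → V → ℝ}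

/-- The pair symmetry of algebraic curvature tensors. -/
theorem algebraicCurvature_pair_symm (h12 : ∀ X Y Z W, D X Y Z W = -D Y X Z W)
    (h34 : ∀ X Y Z W, D X Y Z W = -D X Y W Z)
    (hB : ∀ X Y Z W, D X Y Z W + D Y Z X W + D Z X Y W = 0) (X Y Z W : V) :
    D X Y Z W = D Z W X Y := by
  -- The octahedron argument: the four Bianchi identities on cyclic shifts of X, Y, Z, W, combined
  -- through the two skew symmetries.
  linarith [hB X Y Z W, hB Y Z W X, hB Z W X Y, hB W X Y Z, h12 X Y Z W, h12 Z W X Y,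
    h34 X Y Z W, h34 Z W X Y, h34 Y Z X W, h34 Z X Y W, h12 Z X Y W, h12 W Y Z X, h34 Y Z W X,
    h34 Z W Y X, h34 W Y Z X, h12 W X Z Y, h34 W X Z Y, h34 X Z W Y, h12 X Z W Y,
    h34 W X Y Z, h34 X Y W Z, h34 Y W X Z, h12 Y W X Z, h12 X Z Y W, h12 Z W Y X, h12 X Y W Z]

variable [AddCommGroup V]

/-- An algebraic curvature tensor with vanishing sectional curvatures vanishes. -/
theorem algebraicCurvature_eq_zero (h1 : ∀ X X' Y Z W, D (X + X') Y Z W = D X Y Z W + D X' Y Z W)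
    (h4 : ∀ X Y Z W W', D X Y Z (W + W') = D X Y Z W + D X Y Z W')
    (h12 : ∀ X Y Z W, D X Y Z W = -D Y X Z W)
    (h34 : ∀ X Y Z W, D X Y Z W = -D X Y W Z)
    (hB : ∀ X Y Z W, D X Y Z W + D Y Z X W + D Z X Y W = 0)
    (h0 : ∀ X Y, D X Y Y X = 0) (X Y Z W : V) : D X Y Z W = 0 := by
  have h2 : ∀ X Y Y' Z W, D X (Y + Y') Z W = D X Y Z W + D X Y' Z W := fun X Y Y' Z W => by
    rw [h12, h1, h12 Y, h12 Y']; ring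
  have h3 : ∀ X Y Z Z' W, D X Y (Z + Z') W = D X Y Z W + D X Y Z' W := fun X Y Z Z' W => by
    rw [h34, h4, h34 X Y W, h34 X Y W]; ring
  -- Polarisation in X gives D X Y Y W + D W Y Y X = 0, and by pair symmetry the two terms are
  -- equal.
  have hp : ∀ X Y W, D X Y Y W = 0 := fun X Y W => by
    have e1 := h0 (X + W) Y
    rw [h1, h4, h4, h0, h0] at e1
    have e2 := algebraicCurvature_pair_symm h12 h34 hB X Y Y W
    have e3 := h12 Y W X Y
    have e4 := h34 W Y X Y
    linarith
  have hq : ∀ X Y Z W, D X Y Z W = -D X Z Y W := fun X Y Z W => by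
    have e1 := hp X (Y + Z) W
    rw [h2, h3, h3, hp, hp] at e1
    linarith
  -- D is now alternating in its first three arguments, so the Bianchi sum is 3 D.
  linarith [hB X Y Z W, hq X Y Z W, h12 X Z Y W, h12 Y Z X W, hq Y X Z W, h12 X Y Z W]

end AlgebraicCurvature

/-! ### The curvature operator and its determination by sectional curvatures -/

section CurvatureOperator

variable {n : ℕ} (g : (Fin n → ℝ) → Matrix (Fin n) (Fin n) ℝ)

/-- The derivative of `∑ h, Γ^h_{ij} X^i Y^j ∂_h` in the direction `v`. -/
def dgam (x v X Y : Fin n → ℝ) : Fin n → ℝ := fderiv ℝ (fun q => gam g q X Y) x v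

/-- The vector `R(X, Y) Z`. -/
def curvOp (x X Y Z : Fin n → ℝ) : Fin n → ℝ :=
  dgam g x X Y Z - dgam g x Y X Z + gam g x X (gam g x Y Z) - gam g x Y (gam g x X Z)

theorem curvOp_swap (x X Y Z : Fin n → ℝ) : curvOp g x X Y Z = -curvOp g x Y X Z := by
  simp only [curvOp]
  abel

variable {g} {U : Set (Fin n → ℝ)} {x : Fin n → ℝ}

theorem dgam_comm (hsymm : ∀ q i j, g q i j = g q j i) (x v X Y : Fin n → ℝ) :
    dgam g x v X Y = dgam g x v Y X := by
  simp only [dgam, gam_comm hsymm _ X Y]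

theorem curvOp_bianchi (hsymm : ∀ q i j, g q i j = g q j i) (x X Y Z : Fin n → ℝ) :
    curvOp g x X Y Z + curvOp g x Y Z X + curvOp g x Z X Y = 0 := by
  simp only [curvOp, dgam_comm hsymm x X Y Z, dgam_comm hsymm x Y X Z, dgam_comm hsymm x Z X Y,
    gam_comm hsymm x Y X, gam_comm hsymm x Z X, gam_comm hsymm x Z Y]
  abel

theorem IsMetricOn.dgam_apply (hg : IsMetricOn g U) (hx : x ∈ U) (v X Y : Fin n → ℝ) (h : Fin n) :
    dgam g x v X Y h =
      ∑ i, ∑ j, ∑ k, v i * X j * Y k * pd i (fun q => christoffel g q h j k) x := by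
  have hc := hg.differentiableAt_christoffel hx
  have e1 : dgam g x v X Y h = fderiv ℝ (fun q => gam g q X Y h) x v := by
    rw [dgam, fderiv_apply (hg.differentiableAt_gam hx X Y)]
    rfl
  rw [e1, fderiv_apply_eq_sum_pd]
  refine Finset.sum_congr rfl fun i _ => ?_
  simp only [gam]
  rw [pd_sum _ _ _ _ (fun j _ => by fun_prop), Finset.mul_sum]
  refine Finset.sum_congr rfl fun j _ => ?_
  rw [pd_sum _ _ _ _ (fun j _ => by fun_prop), Finset.mul_sum]
  refine Finset.sum_congr rfl fun k _ => ?_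
  rw [pd_const_mul _ _ _ _ (hc h j k)]
  ring

theorem gam_gam_apply (g : (Fin n → ℝ) → Matrix (Fin n) (Fin n) ℝ) (x X Y Z : Fin n → ℝ)
    (h : Fin n) : gam g x X (gam g x Y Z) h =
      ∑ i, ∑ j, ∑ k, X i * Y j * Z k * ∑ l, christoffel g x h i l * christoffel g x l j k := by
  simp only [gam, Finset.mul_sum, Finset.sum_mul]
  refine Finset.sum_congr rfl fun i _ => ?_
  rw [Finset.sum_comm]
  refine Finset.sum_congr rfl fun j _ => ?_
  rw [Finset.sum_comm]
  exact Finset.sum_congr rfl fun k _ => Finset.sum_congr rfl fun l _ => by ring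

theorem IsMetricOn.curvOp_apply (hg : IsMetricOn g U) (hx : x ∈ U) (X Y Z : Fin n → ℝ)
    (h : Fin n) : curvOp g x X Y Z h =
      ∑ i, ∑ j, ∑ k, X i * Y j * Z k * curvature g x h k i j := by
  have hcomm : ∀ f : Fin n → Fin n → Fin n → ℝ, ∑ i, ∑ j, ∑ k, Y i * X j * Z k * f i j k =
      ∑ i, ∑ j, ∑ k, X i * Y j * Z k * f j i k := fun f => by
    rw [Finset.sum_comm]
    exact Finset.sum_congr rfl fun i _ => Finset.sum_congr rfl fun j _ =>
      Finset.sum_congr rfl fun k _ => by ring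
  simp only [curvOp, Pi.add_apply, Pi.sub_apply, hg.dgam_apply hx, gam_gam_apply, hcomm]
  simp only [← Finset.sum_add_distrib, ← Finset.sum_sub_distrib]
  refine Finset.sum_congr rfl fun i _ => Finset.sum_congr rfl fun j _ =>
      Finset.sum_congr rfl fun k _ => ?_
  rw [curvature, Finset.sum_sub_distrib]
  ring

theorem IsMetricOn.curvOp_single (hg : IsMetricOn g U) (hx : x ∈ U) (i j k h : Fin n) :
    curvOp g x (Pi.single i 1) (Pi.single j 1) (Pi.single k 1) h = curvature g x h k i j := by
  rw [hg.curvOp_apply hx, Finset.sum_eq_single i, Finset.sum_eq_single j, Finset.sum_eq_single k] <;>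
    simp +contextual

theorem IsMetricOn.curvOp_add_left (hg : IsMetricOn g U) (hx : x ∈ U) (X X' Y Z : Fin n → ℝ) :
    curvOp g x (X + X') Y Z = curvOp g x X Y Z + curvOp g x X' Y Z := by
  ext h
  simp only [Pi.add_apply, hg.curvOp_apply hx, add_mul, Finset.sum_add_distrib]

theorem IsMetricOn.curvOp_smul_left (hg : IsMetricOn g U) (hx : x ∈ U) (s : ℝ)
    (X Y Z : Fin n → ℝ) : curvOp g x (s • X) Y Z = s • curvOp g x X Y Z := by
  ext h
  simp only [Pi.smul_apply, smul_eq_mul, hg.curvOp_apply hx, Finset.mul_sum]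
  exact Finset.sum_congr rfl fun i _ => Finset.sum_congr rfl fun j _ =>
      Finset.sum_congr rfl fun k _ => by ring

theorem IsMetricOn.curvOp_add_right (hg : IsMetricOn g U) (hx : x ∈ U) (X Y Z Z' : Fin n → ℝ) :
    curvOp g x X Y (Z + Z') = curvOp g x X Y Z + curvOp g x X Y Z' := by
  ext h
  simp only [Pi.add_apply, hg.curvOp_apply hx, mul_add, add_mul, Finset.sum_add_distrib]

theorem IsMetricOn.curvOp_smul_right (hg : IsMetricOn g U) (hx : x ∈ U) (s : ℝ)
    (X Y Z : Fin n → ℝ) : curvOp g x X Y (s • Z) = s • curvOp g x X Y Z := by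
  ext h
  simp only [Pi.smul_apply, smul_eq_mul, hg.curvOp_apply hx, Finset.mul_sum]
  exact Finset.sum_congr rfl fun i _ => Finset.sum_congr rfl fun j _ =>
      Finset.sum_congr rfl fun k _ => by ring

theorem IsMetricOn.curvOp_add_middle (hg : IsMetricOn g U) (hx : x ∈ U) (X Y Y' Z : Fin n → ℝ) :
    curvOp g x X (Y + Y') Z = curvOp g x X Y Z + curvOp g x X Y' Z := by
  rw [curvOp_swap, hg.curvOp_add_left hx, neg_add, ← curvOp_swap, ← curvOp_swap]

theorem IsMetricOn.curvOp_smul_middle (hg : IsMetricOn g U) (hx : x ∈ U) (s : ℝ)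
    (X Y Z : Fin n → ℝ) : curvOp g x X (s • Y) Z = s • curvOp g x X Y Z := by
  rw [curvOp_swap, hg.curvOp_smul_left hx, ← smul_neg, ← curvOp_swap]

theorem curvOp_self (g : (Fin n → ℝ) → Matrix (Fin n) (Fin n) ℝ) (x X Z : Fin n → ℝ) :
    curvOp g x X X Z = 0 := by
  simp only [curvOp]
  abel

theorem hasDerivAt_line {ι : Type*} [Fintype ι] (x v : ι → ℝ) :
    HasDerivAt (fun s : ℝ => x + s • v) v 0 := by
  simpa using ((hasDerivAt_id (0 : ℝ)).smul_const v).const_add x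

theorem IsMetricOn.hasDerivAt_gam_line (hg : IsMetricOn g U) (hx : x ∈ U) (v X Y : Fin n → ℝ) :
    HasDerivAt (fun s : ℝ => gam g (x + s • v) X Y) (dgam g x v X Y) 0 := by
  have h1 : HasFDerivAt (fun q => gam g q X Y) (fderiv ℝ (fun q => gam g q X Y) x)
      (x + (0 : ℝ) • v) := by
    simpa using (hg.differentiableAt_gam hx X Y).hasFDerivAt
  exact h1.comp_hasDerivAt (0 : ℝ) (hasDerivAt_line x v)

theorem IsMetricOn.hasCovDerivAt_gam (hg : IsMetricOn g U) (hx : x ∈ U) (v X Y : Fin n → ℝ) :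
    HasCovDerivAt g x v (fun s => gam g (x + s • v) X Y)
      (dgam g x v X Y + gam g x v (gam g x X Y)) :=
  (hg.hasDerivAt_gam_line hx v X Y).congr_deriv (by simp)

theorem hasDerivAt_apply_line {ι : Type*} [Fintype ι] {F : (ι → ℝ) → (ι → ℝ) →L[ℝ] ℝ} {x : ι → ℝ}
    (hF : DifferentiableAt ℝ F x) (v w : ι → ℝ) :
    HasDerivAt (fun s : ℝ => F (x + s • v) w) (fderiv ℝ F x v w) 0 := by
  have hf : HasFDerivAt F (fderiv ℝ F x) (x + (0 : ℝ) • v) := by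
    simpa using hF.hasFDerivAt
  have h := hf.comp_hasDerivAt (0 : ℝ) (hasDerivAt_line x v)
  exact (ContinuousLinearMap.apply ℝ ℝ w).hasFDerivAt.comp_hasDerivAt (0 : ℝ) h

/-- The Hessian of q ↦ g(Z,Z), for constant Z, is symmetric. Metricity applied twice expresses it by
Γ and its derivative; the term g(Γ(Y,Z),Γ(X,Z)) is symmetric in X, Y, and the antisymmetric
remainder is 2 g(R(X,Y)Z,Z). -/
theorem IsMetricOn.pair_curvOp_self (hg : IsMetricOn g U) (hx : x ∈ U) (X Y Z : Fin n → ℝ) :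
    pair g x (curvOp g x X Y Z) Z = 0 := by
  have hsm : ContDiffAt ℝ ∞ (fun q => pair g q Z Z) x := by
    simp only [pair_eq_sum]
    exact ContDiffAt.sum fun i _ => ContDiffAt.sum fun j _ =>
      contDiffAt_const.mul (hg.contDiffAt hx i j)
  have hsym : IsSymmSndFDerivAt ℝ (fun q => pair g q Z Z) x :=
    hsm.isSymmSndFDerivAt (by rw [minSmoothness_of_isRCLikeNormedField]; norm_cast)
  have hd : DifferentiableAt ℝ (fderiv ℝ (fun q => pair g q Z Z)) x :=
    (hsm.fderiv_right (m := 1) (by norm_cast)).differentiableAt (by simp)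
  have key : ∀ X Y, fderiv ℝ (fderiv ℝ (fun q => pair g q Z Z)) x X Y =
      2 * (pair g x (dgam g x X Y Z + gam g x X (gam g x Y Z)) Z
        + pair g x (gam g x Y Z) (gam g x X Z)) := fun X Y => by
    have h1 : HasDerivAt (fun s : ℝ => fderiv ℝ (fun q => pair g q Z Z) (x + s • X) Y)
        (fderiv ℝ (fderiv ℝ (fun q => pair g q Z Z)) x X Y) 0 :=
      hasDerivAt_apply_line hd X Y
    have h2 := ((hg.hasCovDerivAt_gam hx X Y Z).pair hg hx
      (hasCovDerivAt_const g x X Z)).const_mul 2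
    have hU : ∀ᶠ s : ℝ in nhds 0, x + s • X ∈ U := by
      have hc : ContinuousAt (fun s : ℝ => x + s • X) 0 := (hasDerivAt_line x X).continuousAt
      exact hc.eventually (by simpa using hg.isOpen.mem_nhds hx)
    refine h1.unique ((h2.congr_of_eventuallyEq ?_).congr_deriv (by simp))
    filter_upwards [hU] with s hs
    rw [fderiv_pair_eq_gam hg.symm (hg.det_ne_zero hs) (hg.entriesDifferentiableAt hs),
      pair_comm hg.symm _ Z]
    ring
  have h3 := hsym X Y
  rw [key, key, pair_comm hg.symm x (gam g x X Z)] at h3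
  simp only [curvOp, pair_sub_left, pair_add_left] at h3 ⊢
  linarith

theorem IsMetricOn.pair_curvOp_swap (hg : IsMetricOn g U) (hx : x ∈ U) (X Y Z W : Fin n → ℝ) :
    pair g x (curvOp g x X Y Z) W = -pair g x (curvOp g x X Y W) Z := by
  have h := hg.pair_curvOp_self hx X Y (Z + W)
  rw [hg.curvOp_add_right hx, pair_add_left, pair_add_right, pair_add_right,
    hg.pair_curvOp_self hx, hg.pair_curvOp_self hx] at h
  linarith

/-- If all sectional curvatures equal `c`, the curvature operator is that of a space form. -/
theorem IsMetricOn.curvOp_eq_of_sectional (hg : IsMetricOn g U) (hx : x ∈ U) {c : ℝ}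
    (hc : ∀ e y, e ≠ 0 → y ≠ 0 → pair g x y e = 0 →
      pair g x (curvOp g x e y y) e = c * (pair g x e e * pair g x y y)) (X Y Z : Fin n → ℝ) :
    curvOp g x X Y Z = c • (pair g x Y Z • X - pair g x X Z • Y) := by
  set D : (Fin n → ℝ) → (Fin n → ℝ) → (Fin n → ℝ) → (Fin n → ℝ) → ℝ := fun X Y Z W =>
    pair g x (curvOp g x X Y Z) W
      - c * (pair g x Y Z * pair g x X W - pair g x X Z * pair g x Y W) with hD
  have hz : ∀ X Y Z W, D X Y Z W = 0 := by
    refine algebraicCurvature_eq_zero ?_ ?_ ?_ ?_ ?_ ?_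
    · intro X X' Y Z W
      simp only [hD, hg.curvOp_add_left hx, pair_add_left]
      ring
    · intro X Y Z W W'
      simp only [hD, pair_add_right]
      ring
    · intro X Y Z W
      simp only [hD]
      rw [curvOp_swap, pair_neg_left]
      ring
    · intro X Y Z W
      simp only [hD]
      rw [hg.pair_curvOp_swap hx]
      ring
    · intro X Y Z W
      have h := congrArg (fun V => pair g x V W) (curvOp_bianchi hg.symm x X Y Z)
      simp only [pair_add_left, pair_zero_left] at h
      simp only [hD]
      rw [pair_comm hg.symm x Z X, pair_comm hg.symm x Z Y, pair_comm hg.symm x Y X]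
      linarith
    · intro X y
      simp only [hD]
      by_cases hy : y = 0
      · subst hy
        rw [hg.pair_curvOp_swap hx, pair_zero_right, pair_zero_right, pair_zero_left]
        ring
      have hr := (hg.pos x hx y hy).ne'
      -- Removing from X its component along y changes neither side: R(y,y) = 0, R is skew in its
      -- last pair, and the Gram determinant of X, y is unchanged. So the hypothesis on orthogonal
      -- pairs suffices.
      set μ := pair g x y X / pair g x y y with hμ
      obtain ⟨e, he⟩ : ∃ e, e = X + (-μ) • y := ⟨_, rfl⟩
      have hX : X = e + μ • y := by rw [he]; module
      have hperp : pair g x y e = 0 := by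
        rw [he, pair_add_right, pair_smul_right, hμ]
        field_simp
        ring
      have hR : pair g x (curvOp g x X y y) X = pair g x (curvOp g x e y y) e := by
        rw [hX, hg.curvOp_add_left hx, hg.curvOp_smul_left hx, curvOp_self, smul_zero, add_zero,
          pair_add_right, pair_smul_right, hg.pair_curvOp_self hx]
        ring
      have hXX : pair g x X X = pair g x e e + μ ^ 2 * pair g x y y := by
        rw [hX, pair_add_right, pair_add_left, pair_add_left, pair_smul_right, pair_smul_left,
          pair_smul_right, pair_smul_left, pair_comm hg.symm x e y, hperp]
        ring
      have hXy : pair g x y X = μ * pair g x y y := by rw [hμ]; field_simp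
      rw [hR, hXX, pair_comm hg.symm x X y, hXy]
      by_cases he0 : e = 0
      · rw [he0]
        simp only [pair_zero_right]
        ring
      · rw [hc e y he0 hy hperp]
        ring
  by_contra hne
  have hpos := hg.pos x hx _ (sub_ne_zero.2 hne)
  -- Test D against the difference vector itself; positive definiteness makes that vector zero.
  have h := hz X Y Z (curvOp g x X Y Z - c • (pair g x Y Z • X - pair g x X Z • Y))
  simp only [hD] at h
  rw [pair_sub_left, pair_smul_left, pair_sub_left, pair_smul_left, pair_smul_left] at hpos
  linarith

end CurvatureOperator


/-! ### The cubic form F(X,X,X) in adapted components -/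

section CubicForm

variable {n : ℕ} (g : (Fin n → ℝ) → Matrix (Fin n) (Fin n) ℝ) (A : EndCoeffs) (C : MetricCoeffs)

/-- The derivative of `liftedForm` in the vertical direction `u`. -/
def liftedFormDot (x y u ξ η ξ' η' : Fin n → ℝ) : ℝ :=
  metricFormDot g (dt C.c₁ ((1 / 2) * pair g x y y)) (C.d₁ ((1 / 2) * pair g x y y))
      (dt C.d₁ ((1 / 2) * pair g x y y)) x y u ξ ξ'
    + metricFormDot g (dt C.c₃ ((1 / 2) * pair g x y y)) (C.d₃ ((1 / 2) * pair g x y y))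
      (dt C.d₃ ((1 / 2) * pair g x y y)) x y u ξ η'
    + metricFormDot g (dt C.c₃ ((1 / 2) * pair g x y y)) (C.d₃ ((1 / 2) * pair g x y y))
      (dt C.d₃ ((1 / 2) * pair g x y y)) x y u η ξ'
    + metricFormDot g (dt C.c₂ ((1 / 2) * pair g x y y)) (C.d₂ ((1 / 2) * pair g x y y))
      (dt C.d₂ ((1 / 2) * pair g x y y)) x y u η η'

/-- The derivative of `horJ` in the vertical direction `u`. -/
def horJDot (x y u ξ η : Fin n → ℝ) : Fin n → ℝ :=
  endFormDot g (dt A.a₄ ((1 / 2) * pair g x y y)) (A.b₄ ((1 / 2) * pair g x y y))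
      (dt A.b₄ ((1 / 2) * pair g x y y)) x y u ξ
    - endFormDot g (dt A.a₂ ((1 / 2) * pair g x y y)) (A.b₂ ((1 / 2) * pair g x y y))
      (dt A.b₂ ((1 / 2) * pair g x y y)) x y u η

/-- The derivative of `verJ` in the vertical direction `u`. -/
def verJDot (x y u ξ η : Fin n → ℝ) : Fin n → ℝ :=
  endFormDot g (dt A.a₁ ((1 / 2) * pair g x y y)) (A.b₁ ((1 / 2) * pair g x y y))
      (dt A.b₁ ((1 / 2) * pair g x y y)) x y u ξ
    + endFormDot g (dt A.a₃ ((1 / 2) * pair g x y y)) (A.b₃ ((1 / 2) * pair g x y y))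
      (dt A.b₃ ((1 / 2) * pair g x y y)) x y u η

theorem metricForm_add_right (c d : ℝ → ℝ) (x y a b b' : Fin n → ℝ) :
    metricForm g c d x y a (b + b') = metricForm g c d x y a b + metricForm g c d x y a b' := by
  simp only [metricForm, pair_add_right]
  ring

theorem liftedForm_add_right (x y ξ η ξ' η' ξ'' η'' : Fin n → ℝ) :
    liftedForm g C x y ξ η (ξ' + ξ'') (η' + η'') =
      liftedForm g C x y ξ η ξ' η' + liftedForm g C x y ξ η ξ'' η'' := by
  simp only [liftedForm, metricForm_add_right]
  ring

variable {g} {U : Set (Fin n → ℝ)} {x v u : Fin n → ℝ} {y ξ η ξ' η' : ℝ → Fin n → ℝ}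
  {aξ aη aξ' aη' : Fin n → ℝ}

theorem liftedForm_comm (hsymm : ∀ x i j, g x i j = g x j i) (x y ξ η ξ' η' : Fin n → ℝ) :
    liftedForm g C x y ξ η ξ' η' = liftedForm g C x y ξ' η' ξ η := by
  simp only [liftedForm, metricForm]
  rw [pair_comm hsymm x ξ ξ', pair_comm hsymm x ξ η', pair_comm hsymm x η ξ', pair_comm hsymm x η η']
  ring

theorem HasCovDerivAt.liftedForm (hg : IsMetricOn g U) (hx : x ∈ U)
    (ht : 0 < (1 / 2) * NaturalLift.pair g x (y 0) (y 0)) (hy : HasCovDerivAt g x v y u)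
    (hξ : HasCovDerivAt g x v ξ aξ) (hη : HasCovDerivAt g x v η aη)
    (hξ' : HasCovDerivAt g x v ξ' aξ') (hη' : HasCovDerivAt g x v η' aη') :
    HasDerivAt
      (fun s : ℝ => liftedForm g C (x + s • v) (y s) (ξ s) (η s) (ξ' s) (η' s))
      (liftedFormDot g C x (y 0) u (ξ 0) (η 0) (ξ' 0) (η' 0)
        + NaturalLift.liftedForm g C x (y 0) aξ aη (ξ' 0) (η' 0)
        + NaturalLift.liftedForm g C x (y 0) (ξ 0) (η 0) aξ' aη') 0 := by
  have h1 := hy.metricForm hg hx hξ hξ' (hasDerivAt_dt C.smooth_c₁ ht) (hasDerivAt_dt C.smooth_d₁ ht)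
  have h2 := hy.metricForm hg hx hξ hη' (hasDerivAt_dt C.smooth_c₃ ht) (hasDerivAt_dt C.smooth_d₃ ht)
  have h3 := hy.metricForm hg hx hη hξ' (hasDerivAt_dt C.smooth_c₃ ht) (hasDerivAt_dt C.smooth_d₃ ht)
  have h4 := hy.metricForm hg hx hη hη' (hasDerivAt_dt C.smooth_c₂ ht) (hasDerivAt_dt C.smooth_d₂ ht)
  refine (((h1.fun_add h2).fun_add h3).fun_add h4).congr_deriv ?_
  simp only [NaturalLift.liftedForm, liftedFormDot]
  ring

theorem HasCovDerivAt.horJ (hg : IsMetricOn g U) (hx : x ∈ U)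
    (ht : 0 < (1 / 2) * NaturalLift.pair g x (y 0) (y 0)) (hy : HasCovDerivAt g x v y u)
    (hξ : HasCovDerivAt g x v ξ aξ) (hη : HasCovDerivAt g x v η aη) :
    HasCovDerivAt g x v (fun s : ℝ => horJ g A (x + s • v) (y s) (ξ s) (η s))
      (horJDot g A x (y 0) u (ξ 0) (η 0) + NaturalLift.horJ g A x (y 0) aξ aη) := by
  have h1 := hy.endForm hg hx hξ (hasDerivAt_dt A.smooth_a₄ ht) (hasDerivAt_dt A.smooth_b₄ ht)
  have h2 := hy.endForm hg hx hη (hasDerivAt_dt A.smooth_a₂ ht) (hasDerivAt_dt A.smooth_b₂ ht)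
  refine (h1.sub h2).congr ?_
  simp only [NaturalLift.horJ, horJDot]
  abel

theorem HasCovDerivAt.verJ (hg : IsMetricOn g U) (hx : x ∈ U)
    (ht : 0 < (1 / 2) * NaturalLift.pair g x (y 0) (y 0)) (hy : HasCovDerivAt g x v y u)
    (hξ : HasCovDerivAt g x v ξ aξ) (hη : HasCovDerivAt g x v η aη) :
    HasCovDerivAt g x v (fun s : ℝ => verJ g A (x + s • v) (y s) (ξ s) (η s))
      (verJDot g A x (y 0) u (ξ 0) (η 0) + NaturalLift.verJ g A x (y 0) aξ aη) := by
  have h1 := hy.endForm hg hx hξ (hasDerivAt_dt A.smooth_a₁ ht) (hasDerivAt_dt A.smooth_b₁ ht)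
  have h2 := hy.endForm hg hx hη (hasDerivAt_dt A.smooth_a₃ ht) (hasDerivAt_dt A.smooth_b₃ ht)
  refine (h1.add h2).congr ?_
  simp only [NaturalLift.verJ, verJDot]
  abel

variable {p : Fin n ⊕ Fin n → ℝ}

theorem base_line (p V : Fin n ⊕ Fin n → ℝ) (s : ℝ) : base (p + s • V) = base p + s • base V := rfl

theorem fib_line (p V : Fin n ⊕ Fin n → ℝ) (s : ℝ) : fib (p + s • V) = fib p + s • fib V := rfl

/-- The vertical component of V is precisely the covariant derivative of y along V. Hence in the
adapted frame only this component enters the derivatives of the coefficient functions. -/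
theorem IsMetricOn.hasCovDerivAt_fib (hg : IsMetricOn g U) (p V : Fin n ⊕ Fin n → ℝ) :
    HasCovDerivAt g (base p) (base V) (fun s => fib (p + s • V)) (ver g p V) := by
  refine (hasDerivAt_line (fib p) (fib V)).congr_deriv ?_
  simp [ver, gam_comm hg.symm _ (base V)]

/-- X is constant in the natural frame, so its vertical part fib X + Γ(y, base X) varies through
both Γ and y. The derivative of Γ that appears here is the source of the curvature term. -/
theorem IsMetricOn.hasCovDerivAt_ver (hg : IsMetricOn g U) (hx : base p ∈ U)
    (V X : Fin n ⊕ Fin n → ℝ) :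
    HasCovDerivAt g (base p) (base V) (fun s => ver g (p + s • V) X)
      (gam g (base p) (base V) (ver g p X) + dgam g (base p) (base V) (fib p) (base X)
        + gam g (base p) (fib V) (base X)) := by
  have h1 := hg.hasDerivAt_gam_line hx (base V) (fib p) (base X)
  have h2 := HasDerivAt.fun_smul (hasDerivAt_id (0 : ℝ))
    (hg.hasDerivAt_gam_line hx (base V) (fib V) (base X))
  have h3 := (h1.fun_add h2).const_add (fib X)
  have e : (fun s : ℝ => ver g (p + s • V) X) = fun s : ℝ =>
      fib X + (gam g (base p + s • base V) (fib p) (base X)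
        + id s • gam g (base p + s • base V) (fib V) (base X)) := by
    funext s
    simp only [ver, base_line, fib_line, gam_add_left, gam_smul_left, id]
  rw [HasCovDerivAt, e]
  refine h3.congr_deriv ?_
  simp [ver]
  abel

theorem fderiv_eq_of_line {ι : Type*} [Fintype ι] {f : (ι → ℝ) → ℝ} {p V : ι → ℝ} {f' : ℝ}
    (hf : DifferentiableAt ℝ f p) (h : HasDerivAt (fun s : ℝ => f (p + s • V)) f' 0) :
    fderiv ℝ f p V = f' := by
  have h1 : HasFDerivAt f (fderiv ℝ f p) (p + (0 : ℝ) • V) := by simpa using hf.hasFDerivAt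
  exact (h1.comp_hasDerivAt (0 : ℝ) (hasDerivAt_line p V)).unique h

theorem IsMetricOn.fderiv_pair_liftG (hg : IsMetricOn g U) (hx : base p ∈ U)
    (ht : 0 < energy g p) (V X W : Fin n ⊕ Fin n → ℝ) :
    fderiv ℝ (fun q => pair (liftG g C) q X W) p V =
      liftedFormDot g C (base p) (fib p) (ver g p V) (base X) (ver g p X) (base W) (ver g p W)
        + liftedForm g C (base p) (fib p) (gam g (base p) (base V) (base X))
          (gam g (base p) (base V) (ver g p X) + dgam g (base p) (base V) (fib p) (base X)
            + gam g (base p) (fib V) (base X)) (base W) (ver g p W)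
        + liftedForm g C (base p) (fib p) (base X) (ver g p X) (gam g (base p) (base V) (base W))
          (gam g (base p) (base V) (ver g p W) + dgam g (base p) (base V) (fib p) (base W)
            + gam g (base p) (fib V) (base W)) := by
  apply fderiv_eq_of_line ((hg.entriesDifferentiableAt_liftG hx ht C).pair X W)
  simp only [pair_liftG, base_line]
  rw [energy_eq] at ht
  refine (HasCovDerivAt.liftedForm C hg hx (by simpa using ht) (hg.hasCovDerivAt_fib p V)
    (hasCovDerivAt_const _ _ _ (base X)) (hg.hasCovDerivAt_ver hx V X)
    (hasCovDerivAt_const _ _ _ (base W)) (hg.hasCovDerivAt_ver hx V W)).congr_deriv ?_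
  simp only [zero_smul, add_zero]

theorem base_liftJ (A : EndCoeffs) (p X : Fin n ⊕ Fin n → ℝ) :
    base (liftJ g A p *ᵥ X) = horJ g A (base p) (fib p) (base X) (ver g p X) := by
  rw [liftJ_mulVec, base_frame]

theorem ver_liftJ (A : EndCoeffs) (p X : Fin n ⊕ Fin n → ℝ) :
    ver g p (liftJ g A p *ᵥ X) = verJ g A (base p) (fib p) (base X) (ver g p X) := by
  rw [liftJ_mulVec, ver_frame]

theorem IsMetricOn.fderiv_pair_liftG_liftJ (hg : IsMetricOn g U) (hx : base p ∈ U)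
    (ht : 0 < energy g p) (V X : Fin n ⊕ Fin n → ℝ) :
    fderiv ℝ (fun q => pair (liftG g C) q X (liftJ g A q *ᵥ X)) p V =
      liftedFormDot g C (base p) (fib p) (ver g p V) (base X) (ver g p X)
          (horJ g A (base p) (fib p) (base X) (ver g p X))
          (verJ g A (base p) (fib p) (base X) (ver g p X))
        + liftedForm g C (base p) (fib p) (gam g (base p) (base V) (base X))
          (gam g (base p) (base V) (ver g p X) + dgam g (base p) (base V) (fib p) (base X)
            + gam g (base p) (fib V) (base X))
          (horJ g A (base p) (fib p) (base X) (ver g p X))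
          (verJ g A (base p) (fib p) (base X) (ver g p X))
        + liftedForm g C (base p) (fib p) (base X) (ver g p X)
          (horJDot g A (base p) (fib p) (ver g p V) (base X) (ver g p X)
            + horJ g A (base p) (fib p) (gam g (base p) (base V) (base X))
              (gam g (base p) (base V) (ver g p X) + dgam g (base p) (base V) (fib p) (base X)
                + gam g (base p) (fib V) (base X)))
          (verJDot g A (base p) (fib p) (ver g p V) (base X) (ver g p X)
            + verJ g A (base p) (fib p) (gam g (base p) (base V) (base X))
              (gam g (base p) (base V) (ver g p X) + dgam g (base p) (base V) (fib p) (base X)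
                + gam g (base p) (fib V) (base X))) := by
  have hG := hg.entriesDifferentiableAt_liftG hx ht C
  have hJ := hg.entriesDifferentiableAt_liftJ hx ht A
  have hd : DifferentiableAt ℝ (fun q => pair (liftG g C) q X (liftJ g A q *ᵥ X)) p := by
    have hJX := differentiableAt_pi.1 (hJ.mulVec X)
    unfold EntriesDifferentiableAt at hG
    simp only [pair_eq_sum]
    fun_prop
  apply fderiv_eq_of_line hd
  simp only [pair_liftG, base_liftJ, ver_liftJ, base_line]
  rw [energy_eq] at ht
  have ht' : 0 < (1 / 2) * pair g (base p) (fib (p + (0 : ℝ) • V)) (fib (p + (0 : ℝ) • V)) := by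
    simpa using ht
  have hy := hg.hasCovDerivAt_fib p V
  have hc := hasCovDerivAt_const g (base p) (base V) (base X)
  have hv := hg.hasCovDerivAt_ver hx V X
  refine (HasCovDerivAt.liftedForm C hg hx ht' hy hc hv (HasCovDerivAt.horJ A hg hx ht' hy hc hv)
    (HasCovDerivAt.verJ A hg hx ht' hy hc hv)).congr_deriv ?_
  simp only [zero_smul, add_zero]

/-- The cubic form `F(X, X, X)` in adapted components. -/
theorem IsMetricOn.tensorF_lift_self (hg : IsMetricOn g U) (hx : base p ∈ U)
    (ht : 0 < energy g p) (hdet : (liftG g C p).det ≠ 0)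
    (hGJ : ∀ X Y, pair (liftG g C) p (liftJ g A p *ᵥ X) Y = pair (liftG g C) p X (liftJ g A p *ᵥ Y))
    (ξ η ξ' η' : Fin n → ℝ) (hξ' : ξ' = horJ g A (base p) (fib p) ξ η)
    (hη' : η' = verJ g A (base p) (fib p) ξ η) :
    tensorF (liftG g C) (liftJ g A) p (frame g p *ᵥ Sum.elim ξ η) (frame g p *ᵥ Sum.elim ξ η)
        (frame g p *ᵥ Sum.elim ξ η) =
      liftedForm g C (base p) (fib p) ξ η (horJDot g A (base p) (fib p) η ξ η)
          (verJDot g A (base p) (fib p) η ξ η)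
        - liftedFormDot g C (base p) (fib p) η ξ η ξ' η'
        + liftedFormDot g C (base p) (fib p) η' ξ η ξ η
        + 2 * liftedForm g C (base p) (fib p) ξ η 0 (curvOp g (base p) ξ' ξ (fib p)) := by
  set X := frame g p *ᵥ Sum.elim ξ η with hX
  have hbX : base X = ξ := base_frame g p ξ η
  have hvX : ver g p X = η := ver_frame g p ξ η
  have hfX : fib X = η - gam g (base p) (fib p) ξ := by rw [hX, frame_mulVec, fib_elim]
  set W := liftJ g A p *ᵥ X with hW
  have hbW : base W = ξ' := by rw [hW, base_liftJ, hbX, hvX, hξ']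
  have hvW : ver g p W = η' := by rw [hW, ver_liftJ, hbX, hvX, hη']
  have hfW : fib W = η' - gam g (base p) (fib p) ξ' := by
    rw [← hbW, ← hvW, ver]
    abel
  -- Self-adjointness of J, in adapted components: it turns the connection terms inside the
  -- derivative of J into the same shape as those from differentiating G.
  have hB : ∀ a b, liftedForm g C (base p) (fib p) ξ η (horJ g A (base p) (fib p) a b)
      (verJ g A (base p) (fib p) a b) = liftedForm g C (base p) (fib p) a b ξ' η' := fun a b => by
    have h := hGJ X (frame g p *ᵥ Sum.elim a b)
    rw [pair_liftG, pair_liftG, base_liftJ, ver_liftJ, base_liftJ, ver_liftJ, hbX, hvX,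
      base_frame, ver_frame, ← hξ', ← hη'] at h
    rw [← h, liftedForm_comm C hg.symm]
  rw [tensorF_self (liftG_comm hg.symm) hdet (hg.entriesDifferentiableAt_liftG hx ht C)
    (hg.entriesDifferentiableAt_liftJ hx ht A) hGJ, hg.fderiv_pair_liftG_liftJ A C hx ht,
    hg.fderiv_pair_liftG C hx ht, hg.fderiv_pair_liftG C hx ht, ← hW, hbX, hvX, hfX, hbW, hvW, hfW,
    liftedForm_add_right, hB, ← hξ', ← hη']
  set P := gam g (base p) ξ η + dgam g (base p) ξ (fib p) ξ
    + gam g (base p) (η - gam g (base p) (fib p) ξ) ξ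
  have e1 : gam g (base p) ξ' ξ = gam g (base p) ξ ξ' + 0 := by rw [gam_comm hg.symm, add_zero]
  -- Interchanging X and JX in the connection terms costs exactly R(ξ', ξ)y. Everything else that
  -- involves the connection of g cancels in the combination of `tensorF_self`.
  have e2 : gam g (base p) ξ' η + dgam g (base p) ξ' (fib p) ξ
      + gam g (base p) (η' - gam g (base p) (fib p) ξ') ξ =
      (gam g (base p) ξ η' + dgam g (base p) ξ (fib p) ξ'
        + gam g (base p) (η - gam g (base p) (fib p) ξ) ξ')
      + curvOp g (base p) ξ' ξ (fib p) := by
    simp only [curvOp, gam_sub_left, dgam_comm hg.symm _ _ (fib p), gam_comm hg.symm _ (fib p),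
      gam_comm hg.symm _ η', gam_comm hg.symm _ η, gam_comm hg.symm _ (gam g (base p) ξ' (fib p)) ξ,
      gam_comm hg.symm _ (gam g (base p) ξ (fib p)) ξ']
    abel
  rw [liftedForm_comm C hg.symm _ _ (gam g (base p) ξ' ξ), e1, e2, liftedForm_add_right]
  ring

end CubicForm


/-! ### Jets of the coefficients; the cubic form on the lifts of y and e -/

/-- The values and the first derivatives of the coefficients at a point of `[0, ∞)`. -/
structure Jet where
  (a₁ a₂ a₃ a₄ b₁ b₂ b₃ b₄ c₁ c₂ c₃ d₁ d₂ d₃ : ℝ)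
  (a₁' a₂' a₃' a₄' b₁' b₂' b₃' b₄' c₁' c₂' c₃' d₁' d₂' d₃' : ℝ)

/-- The `1`-jet of the coefficients at `t`. -/
def jet (A : EndCoeffs) (C : MetricCoeffs) (t : ℝ) : Jet where
  a₁ := A.a₁ t
  a₂ := A.a₂ t
  a₃ := A.a₃ t
  a₄ := A.a₄ t
  b₁ := A.b₁ t
  b₂ := A.b₂ t
  b₃ := A.b₃ t
  b₄ := A.b₄ t
  c₁ := C.c₁ t
  c₂ := C.c₂ t
  c₃ := C.c₃ t
  d₁ := C.d₁ t
  d₂ := C.d₂ t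
  d₃ := C.d₃ t
  a₁' := dt A.a₁ t
  a₂' := dt A.a₂ t
  a₃' := dt A.a₃ t
  a₄' := dt A.a₄ t
  b₁' := dt A.b₁ t
  b₂' := dt A.b₂ t
  b₃' := dt A.b₃ t
  b₄' := dt A.b₄ t
  c₁' := dt C.c₁ t
  c₂' := dt C.c₂ t
  c₃' := dt C.c₃ t
  d₁' := dt C.d₁ t
  d₂' := dt C.d₂ t
  d₃' := dt C.d₃ t

/-- The symmetric bilinear form on `ℝ²` with the matrix `!![c₁, c₃; c₃, c₂]`. -/
def qf (c₁ c₂ c₃ ξ η ξ' η' : ℝ) : ℝ := c₁ * ξ * ξ' + c₃ * (ξ * η' + η * ξ') + c₂ * η * η'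

/-- The part of the cubic form that is of degree three in `(ξ, η)`, on the vectors `ξ y^H + η y^V`,
with `r = g(y, y)`. -/
def Jet.radial (j : Jet) (r ξ η : ℝ) : ℝ :=
  qf (j.c₁ + r * j.d₁) (j.c₂ + r * j.d₂) (j.c₃ + r * j.d₃) ξ η
      (η * ((j.a₄' + r * j.b₄' + 2 * j.b₄) * ξ - (j.a₂' + r * j.b₂' + 2 * j.b₂) * η))
      (η * ((j.a₁' + r * j.b₁' + 2 * j.b₁) * ξ + (j.a₃' + r * j.b₃' + 2 * j.b₃) * η))
    - η * qf (j.c₁' + r * j.d₁' + 2 * j.d₁) (j.c₂' + r * j.d₂' + 2 * j.d₂)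
        (j.c₃' + r * j.d₃' + 2 * j.d₃) ξ η
        ((j.a₄ + r * j.b₄) * ξ - (j.a₂ + r * j.b₂) * η)
        ((j.a₁ + r * j.b₁) * ξ + (j.a₃ + r * j.b₃) * η)
    + ((j.a₁ + r * j.b₁) * ξ + (j.a₃ + r * j.b₃) * η)
      * qf (j.c₁' + r * j.d₁' + 2 * j.d₁) (j.c₂' + r * j.d₂' + 2 * j.d₂)
        (j.c₃' + r * j.d₃' + 2 * j.d₃) ξ η ξ η

/-- The part of the cubic form on the vectors `ξ₁ y^H + η₁ y^V + ξ₂ e^H + η₂ e^V`, with `e`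
orthogonal to `y`, that is linear in `(ξ₁, η₁)` and quadratic in `(ξ₂, η₂)`. The number `κ` is the
sectional curvature of the plane of `y` and `e`, with the opposite sign. -/
def Jet.mixed (j : Jet) (r κ ξ₁ η₁ ξ₂ η₂ : ℝ) : ℝ :=
  qf (j.c₁ + r * j.d₁) (j.c₂ + r * j.d₂) (j.c₃ + r * j.d₃) ξ₁ η₁
      (η₂ * (j.b₄ * ξ₂ - j.b₂ * η₂)) (η₂ * (j.b₁ * ξ₂ + j.b₃ * η₂))
    + qf j.c₁ j.c₂ j.c₃ ξ₂ η₂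
      (η₁ * (j.a₄' * ξ₂ - j.a₂' * η₂) + η₂ * (j.b₄ * ξ₁ - j.b₂ * η₁))
      (η₁ * (j.a₁' * ξ₂ + j.a₃' * η₂) + η₂ * (j.b₁ * ξ₁ + j.b₃ * η₁))
    - (η₁ * qf j.c₁' j.c₂' j.c₃' ξ₂ η₂ (j.a₄ * ξ₂ - j.a₂ * η₂) (j.a₁ * ξ₂ + j.a₃ * η₂)
      + η₂ * (qf j.d₁ j.d₂ j.d₃ ξ₁ η₁ (j.a₄ * ξ₂ - j.a₂ * η₂) (j.a₁ * ξ₂ + j.a₃ * η₂)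
        + qf j.d₁ j.d₂ j.d₃ ξ₂ η₂ ((j.a₄ + r * j.b₄) * ξ₁ - (j.a₂ + r * j.b₂) * η₁)
          ((j.a₁ + r * j.b₁) * ξ₁ + (j.a₃ + r * j.b₃) * η₁)))
    + ((j.a₁ + r * j.b₁) * ξ₁ + (j.a₃ + r * j.b₃) * η₁) * qf j.c₁' j.c₂' j.c₃' ξ₂ η₂ ξ₂ η₂
    + 2 * (j.a₁ * ξ₂ + j.a₃ * η₂) * qf j.d₁ j.d₂ j.d₃ ξ₁ η₁ ξ₂ η₂
    + 2 * κ * (((j.a₄ + r * j.b₄) * ξ₁ - (j.a₂ + r * j.b₂) * η₁) * ξ₂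
        - (j.a₄ * ξ₂ - j.a₂ * η₂) * ξ₁) * (j.c₃ * ξ₂ + j.c₂ * η₂)

section Span

variable {n : ℕ} {g : (Fin n → ℝ) → Matrix (Fin n) (Fin n) ℝ} {x y e : Fin n → ℝ} {r s : ℝ}

theorem endForm_span (hr : pair g x y y = r) (hye : pair g x y e = 0) (a b : ℝ → ℝ) (z₁ z₂ : ℝ) :
    endForm g a b x y (z₁ • y + z₂ • e) =
      ((a (1 / 2 * r) + r * b (1 / 2 * r)) * z₁) • y + (a (1 / 2 * r) * z₂) • e := by
  simp only [endForm, pair_add_right, pair_smul_right, hr, hye]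
  module

theorem metricForm_span (hsymm : ∀ x i j, g x i j = g x j i) (hr : pair g x y y = r)
    (hs : pair g x e e = s) (hye : pair g x y e = 0) (c d : ℝ → ℝ) (z₁ z₂ w₁ w₂ : ℝ) :
    metricForm g c d x y (z₁ • y + z₂ • e) (w₁ • y + w₂ • e) =
      r * (c (1 / 2 * r) + r * d (1 / 2 * r)) * z₁ * w₁ + s * c (1 / 2 * r) * z₂ * w₂ := by
  have hey : pair g x e y = 0 := by rw [pair_comm hsymm, hye]
  simp only [metricForm, pair_add_right, pair_smul_right, pair_add_left, pair_smul_left, hr, hs,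
    hye, hey]
  ring

theorem endFormDot_span (hsymm : ∀ x i j, g x i j = g x j i) (hr : pair g x y y = r)
    (hs : pair g x e e = s) (hye : pair g x y e = 0) (a' b b' u₁ u₂ z₁ z₂ : ℝ) :
    endFormDot g a' b b' x y (u₁ • y + u₂ • e) (z₁ • y + z₂ • e) =
      (r * (a' + r * b' + 2 * b) * u₁ * z₁ + s * b * u₂ * z₂) • y
        + (r * (a' * u₁ * z₂ + b * z₁ * u₂)) • e := by
  have hey : pair g x e y = 0 := by rw [pair_comm hsymm, hye]
  simp only [endFormDot, pair_add_right, pair_smul_right, pair_add_left, pair_smul_left, hr, hs,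
    hye, hey]
  module

theorem metricFormDot_span (hsymm : ∀ x i j, g x i j = g x j i) (hr : pair g x y y = r)
    (hs : pair g x e e = s) (hye : pair g x y e = 0) (c' d d' u₁ u₂ z₁ z₂ w₁ w₂ : ℝ) :
    metricFormDot g c' d d' x y (u₁ • y + u₂ • e) (z₁ • y + z₂ • e) (w₁ • y + w₂ • e) =
      r ^ 2 * (c' + r * d' + 2 * d) * u₁ * z₁ * w₁
        + r * s * (c' * u₁ * z₂ * w₂ + d * u₂ * (z₁ * w₂ + z₂ * w₁)) := by
  have hey : pair g x e y = 0 := by rw [pair_comm hsymm, hye]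
  simp only [metricFormDot, pair_add_right, pair_smul_right, pair_add_left, pair_smul_left, hr, hs,
    hye, hey]
  ring

theorem horJ_span (A : EndCoeffs) (C : MetricCoeffs) (hr : pair g x y y = r)
    (hye : pair g x y e = 0) {j : Jet} (hj : j = jet A C (1 / 2 * r)) (ξ₁ η₁ ξ₂ η₂ : ℝ) :
    horJ g A x y (ξ₁ • y + ξ₂ • e) (η₁ • y + η₂ • e) =
      ((j.a₄ + r * j.b₄) * ξ₁ - (j.a₂ + r * j.b₂) * η₁) • y + (j.a₄ * ξ₂ - j.a₂ * η₂) • e := by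
  subst hj
  simp only [horJ, endForm_span hr hye, jet]
  module

theorem verJ_span (A : EndCoeffs) (C : MetricCoeffs) (hr : pair g x y y = r)
    (hye : pair g x y e = 0) {j : Jet} (hj : j = jet A C (1 / 2 * r)) (ξ₁ η₁ ξ₂ η₂ : ℝ) :
    verJ g A x y (ξ₁ • y + ξ₂ • e) (η₁ • y + η₂ • e) =
      ((j.a₁ + r * j.b₁) * ξ₁ + (j.a₃ + r * j.b₃) * η₁) • y + (j.a₁ * ξ₂ + j.a₃ * η₂) • e := by
  subst hj
  simp only [verJ, endForm_span hr hye, jet]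
  module

theorem liftedForm_span (A : EndCoeffs) (C : MetricCoeffs) (hsymm : ∀ x i j, g x i j = g x j i)
    (hr : pair g x y y = r) (hs : pair g x e e = s) (hye : pair g x y e = 0) {j : Jet}
    (hj : j = jet A C (1 / 2 * r)) (ξ₁ η₁ ξ₂ η₂ ξ₁' η₁' ξ₂' η₂' : ℝ) :
    liftedForm g C x y (ξ₁ • y + ξ₂ • e) (η₁ • y + η₂ • e) (ξ₁' • y + ξ₂' • e)
        (η₁' • y + η₂' • e) =
      r * qf (j.c₁ + r * j.d₁) (j.c₂ + r * j.d₂) (j.c₃ + r * j.d₃) ξ₁ η₁ ξ₁' η₁'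
        + s * qf j.c₁ j.c₂ j.c₃ ξ₂ η₂ ξ₂' η₂' := by
  subst hj
  simp only [liftedForm, metricForm_span hsymm hr hs hye, jet, qf]
  ring

theorem liftedFormDot_span (A : EndCoeffs) (C : MetricCoeffs) (hsymm : ∀ x i j, g x i j = g x j i)
    (hr : pair g x y y = r) (hs : pair g x e e = s) (hye : pair g x y e = 0) {j : Jet}
    (hj : j = jet A C (1 / 2 * r)) (u₁ u₂ ξ₁ η₁ ξ₂ η₂ ξ₁' η₁' ξ₂' η₂' : ℝ) :
    liftedFormDot g C x y (u₁ • y + u₂ • e) (ξ₁ • y + ξ₂ • e) (η₁ • y + η₂ • e)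
        (ξ₁' • y + ξ₂' • e) (η₁' • y + η₂' • e) =
      r ^ 2 * (u₁ * qf (j.c₁' + r * j.d₁' + 2 * j.d₁) (j.c₂' + r * j.d₂' + 2 * j.d₂)
          (j.c₃' + r * j.d₃' + 2 * j.d₃) ξ₁ η₁ ξ₁' η₁')
        + r * s * (u₁ * qf j.c₁' j.c₂' j.c₃' ξ₂ η₂ ξ₂' η₂'
          + u₂ * (qf j.d₁ j.d₂ j.d₃ ξ₁ η₁ ξ₂' η₂' + qf j.d₁ j.d₂ j.d₃ ξ₂ η₂ ξ₁' η₁')) := by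
  subst hj
  simp only [liftedFormDot, hr, metricFormDot_span hsymm hr hs hye, jet, qf]
  ring

theorem horJDot_span (A : EndCoeffs) (C : MetricCoeffs) (hsymm : ∀ x i j, g x i j = g x j i)
    (hr : pair g x y y = r) (hs : pair g x e e = s) (hye : pair g x y e = 0) {j : Jet}
    (hj : j = jet A C (1 / 2 * r)) (u₁ u₂ ξ₁ η₁ ξ₂ η₂ : ℝ) :
    horJDot g A x y (u₁ • y + u₂ • e) (ξ₁ • y + ξ₂ • e) (η₁ • y + η₂ • e) =
      (r * (u₁ * ((j.a₄' + r * j.b₄' + 2 * j.b₄) * ξ₁ - (j.a₂' + r * j.b₂' + 2 * j.b₂) * η₁))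
        + s * (u₂ * (j.b₄ * ξ₂ - j.b₂ * η₂))) • y
      + (r * (u₁ * (j.a₄' * ξ₂ - j.a₂' * η₂) + u₂ * (j.b₄ * ξ₁ - j.b₂ * η₁))) • e := by
  subst hj
  simp only [horJDot, hr, endFormDot_span hsymm hr hs hye, jet]
  module

theorem verJDot_span (A : EndCoeffs) (C : MetricCoeffs) (hsymm : ∀ x i j, g x i j = g x j i)
    (hr : pair g x y y = r) (hs : pair g x e e = s) (hye : pair g x y e = 0) {j : Jet}
    (hj : j = jet A C (1 / 2 * r)) (u₁ u₂ ξ₁ η₁ ξ₂ η₂ : ℝ) :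
    verJDot g A x y (u₁ • y + u₂ • e) (ξ₁ • y + ξ₂ • e) (η₁ • y + η₂ • e) =
      (r * (u₁ * ((j.a₁' + r * j.b₁' + 2 * j.b₁) * ξ₁ + (j.a₃' + r * j.b₃' + 2 * j.b₃) * η₁))
        + s * (u₂ * (j.b₁ * ξ₂ + j.b₃ * η₂))) • y
      + (r * (u₁ * (j.a₁' * ξ₂ + j.a₃' * η₂) + u₂ * (j.b₁ * ξ₁ + j.b₃ * η₁))) • e := by
  subst hj
  simp only [verJDot, hr, endFormDot_span hsymm hr hs hye, jet]
  module

theorem IsMetricOn.curvOp_span {U : Set (Fin n → ℝ)} (hg : IsMetricOn g U) (hx : x ∈ U)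
    (z₁ z₂ w₁ w₂ : ℝ) (v : Fin n → ℝ) :
    curvOp g x (z₁ • y + z₂ • e) (w₁ • y + w₂ • e) v = (z₁ * w₂ - z₂ * w₁) • curvOp g x y e v := by
  simp only [hg.curvOp_add_left hx, hg.curvOp_add_middle hx, hg.curvOp_smul_left hx,
    hg.curvOp_smul_middle hx, curvOp_self]
  rw [curvOp_swap g x e y]
  module

theorem IsMetricOn.liftedForm_span_vertical {U : Set (Fin n → ℝ)} (hg : IsMetricOn g U)
    (A : EndCoeffs) (C : MetricCoeffs) (hr : pair g x y y = r) {j : Jet}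
    (hj : j = jet A C (1 / 2 * r)) {v : Fin n → ℝ}
    (hvy : pair g x v y = 0) (ξ₁ η₁ ξ₂ η₂ : ℝ) :
    liftedForm g C x y (ξ₁ • y + ξ₂ • e) (η₁ • y + η₂ • e) 0 v =
      (j.c₃ * ξ₂ + j.c₂ * η₂) * pair g x v e := by
  subst hj
  have hyv : pair g x y v = 0 := by rw [pair_comm hg.symm, hvy]
  simp only [liftedForm, metricForm, pair_zero_right, pair_add_left, pair_smul_left, hr, hyv, jet,
    pair_comm hg.symm x e v]
  ring

/-- The cubic form `F(X, X, X)` on the span of the lifts of `y` and of a vector orthogonal to it. -/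
theorem IsMetricOn.tensorF_lift_span {U : Set (Fin n → ℝ)} {p : Fin n ⊕ Fin n → ℝ}
    (hg : IsMetricOn g U) (hx : base p ∈ U) (A : EndCoeffs) (C : MetricCoeffs)
    (hdet : (liftG g C p).det ≠ 0)
    (hGJ : ∀ X Y, pair (liftG g C) p (liftJ g A p *ᵥ X) Y = pair (liftG g C) p X (liftJ g A p *ᵥ Y))
    (hr0 : 0 < r) (hr : pair g (base p) (fib p) (fib p) = r)
    (hs : pair g (base p) e e = s) (hye : pair g (base p) (fib p) e = 0) {j : Jet}
    (hj : j = jet A C (1 / 2 * r)) {κ : ℝ}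
    (hκ : pair g (base p) (curvOp g (base p) (fib p) e (fib p)) e = r * s * κ)
    (ξ₁ η₁ ξ₂ η₂ : ℝ) {X : Fin n ⊕ Fin n → ℝ}
    (hX : X = frame g p *ᵥ Sum.elim (ξ₁ • fib p + ξ₂ • e) (η₁ • fib p + η₂ • e)) :
    tensorF (liftG g C) (liftJ g A) p X X X =
      r ^ 2 * j.radial r ξ₁ η₁ + r * s * j.mixed r κ ξ₁ η₁ ξ₂ η₂ := by
  have ht : 0 < energy g p := by rw [energy_eq, hr]; positivity
  rw [hX, hg.tensorF_lift_self A C hx ht hdet hGJ _ _ _ _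
    (horJ_span A C hr hye hj ξ₁ η₁ ξ₂ η₂).symm (verJ_span A C hr hye hj ξ₁ η₁ ξ₂ η₂).symm,
    horJDot_span A C hg.symm hr hs hye hj, verJDot_span A C hg.symm hr hs hye hj,
    liftedForm_span A C hg.symm hr hs hye hj, liftedFormDot_span A C hg.symm hr hs hye hj,
    liftedFormDot_span A C hg.symm hr hs hye hj, hg.curvOp_span hx,
    hg.liftedForm_span_vertical A C hr hj, pair_smul_left, hκ]
  · simp only [Jet.radial, Jet.mixed, qf]
    ring
  · rw [pair_smul_left, hg.pair_curvOp_self hx, mul_zero]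

end Span


/-! ### Relations between the coefficients; values of the radial and mixed parts -/

/-- The algebraic relations between the coefficients, on the lifts of one vector, of an almost
anti-Hermitian structure. -/
structure LevelRel (a₁ a₂ a₃ a₄ c₁ c₂ c₃ : ℝ) : Prop where
  a₄_eq : a₄ = -a₃
  mul_eq : a₁ * a₂ = 1 + a₃ ^ 2
  c₂_mul : c₂ * a₁ = 2 * a₃ * c₃ - a₂ * c₁

/-- The derivatives of the relations `LevelRel`. -/
structure LevelRelDot (a₁ a₂ a₃ c₁ c₂ c₃ a₁' a₂' a₃' a₄' c₁' c₂' c₃' : ℝ) : Prop where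
  a₄_eq : a₄' = -a₃'
  mul_eq : a₁' * a₂ + a₁ * a₂' = 2 * a₃ * a₃'
  c₂_mul : c₂' * a₁ + c₂ * a₁' = 2 * (a₃' * c₃ + a₃ * c₃') - (a₂' * c₁ + a₂ * c₁')

theorem LevelRel.a₁_ne_zero {a₁ a₂ a₃ a₄ c₁ c₂ c₃ : ℝ} (h : LevelRel a₁ a₂ a₃ a₄ c₁ c₂ c₃) :
    a₁ ≠ 0 := by
  rintro rfl
  have := h.mul_eq
  nlinarith [sq_nonneg a₃]

/-- The relations between the `1`-jets of the coefficients of an almost anti-Hermitian structure,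
at a point with `g(y, y) = r`. -/
structure Jet.Compatible (j : Jet) (r : ℝ) : Prop where
  rel : LevelRel j.a₁ j.a₂ j.a₃ j.a₄ j.c₁ j.c₂ j.c₃
  relDot : LevelRelDot j.a₁ j.a₂ j.a₃ j.c₁ j.c₂ j.c₃ j.a₁' j.a₂' j.a₃' j.a₄' j.c₁' j.c₂' j.c₃'
  radialRel : LevelRel (j.a₁ + r * j.b₁) (j.a₂ + r * j.b₂) (j.a₃ + r * j.b₃) (j.a₄ + r * j.b₄)
    (j.c₁ + r * j.d₁) (j.c₂ + r * j.d₂) (j.c₃ + r * j.d₃)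
  radialRelDot : LevelRelDot (j.a₁ + r * j.b₁) (j.a₂ + r * j.b₂) (j.a₃ + r * j.b₃)
    (j.c₁ + r * j.d₁) (j.c₂ + r * j.d₂) (j.c₃ + r * j.d₃)
    (j.a₁' + r * j.b₁' + 2 * j.b₁) (j.a₂' + r * j.b₂' + 2 * j.b₂) (j.a₃' + r * j.b₃' + 2 * j.b₃)
    (j.a₄' + r * j.b₄' + 2 * j.b₄)
    (j.c₁' + r * j.d₁' + 2 * j.d₁) (j.c₂' + r * j.d₂' + 2 * j.d₂) (j.c₃' + r * j.d₃' + 2 * j.d₃)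

/-- `G(J e^H, e^H)` for a unit vector `e` orthogonal to `y`. -/
def Jet.u (j : Jet) : ℝ := j.a₁ * j.c₃ - j.a₃ * j.c₁

/-- The coefficient `m` in `G(J X^H, Y^H) = u g(X, Y) + m g(X, y) g(Y, y)`. -/
def Jet.m (j : Jet) (r : ℝ) : ℝ :=
  (j.a₁ + r * j.b₁) * j.d₃ - (j.a₃ + r * j.b₃) * j.d₁ + j.b₁ * j.c₃ - j.b₃ * j.c₁

variable {j : Jet} {r κ : ℝ}

/-- The same relations hold for (a, c) on the lifts of e and for (a + r b, c + r d) on the lifts of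
y. Subtracting the two versions and dividing by r isolates b₄; b₂ and d₂ are found in the same way
below. -/
theorem Jet.Compatible.b₄_eq (h : j.Compatible r) (hr : r ≠ 0) : j.b₄ = -j.b₃ := by
  have h1 := h.rel.a₄_eq
  have h2 := h.radialRel.a₄_eq
  apply mul_left_cancel₀ hr
  linarith

theorem Jet.Compatible.b₂_mul (h : j.Compatible r) (hr : r ≠ 0) :
    j.b₂ * (j.a₁ + r * j.b₁) = 2 * j.a₃ * j.b₃ + r * j.b₃ ^ 2 - j.b₁ * j.a₂ := by
  have h1 := h.rel.mul_eq
  have h2 := h.radialRel.mul_eq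
  apply mul_left_cancel₀ hr
  linear_combination h2 - h1

theorem Jet.Compatible.d₂_mul (h : j.Compatible r) (hr : r ≠ 0) :
    j.d₂ * (j.a₁ + r * j.b₁) = 2 * (j.a₃ * j.d₃ + j.b₃ * j.c₃ + r * j.b₃ * j.d₃)
      - j.a₂ * j.d₁ - j.b₂ * j.c₁ - r * j.b₂ * j.d₁ - j.c₂ * j.b₁ := by
  have h1 := h.rel.c₂_mul
  have h2 := h.radialRel.c₂_mul
  apply mul_left_cancel₀ hr
  linear_combination h2 - h1

/-- In the names `mixed_hh` to `mixed_vv` the first letter refers to the lifts of y, the second to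
those of e: h is the horizontal lift and v its image under J, with components (-(a₃ + r b₃), a₁ + r
b₁) for y and (-a₃, a₁) for e. On these vectors the indices 2 and 4 can be eliminated. -/
theorem Jet.Compatible.mixed_hh (h : j.Compatible r) (hr : r ≠ 0) :
    j.mixed r κ 1 0 1 0 = (j.a₁ + r * j.b₁) * j.c₁' + 2 * j.a₁ * j.d₁
      - 2 * κ * (r * j.b₃) * j.c₃ := by
  have e7 := h.b₄_eq hr
  simp only [Jet.mixed, qf, e7]
  ring

/-- Only the sum with `mixed_hh` matters, since the Φ-terms of the two values are opposite. The
factor a₁ clears the denominators of a₂ and c₂. -/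
theorem Jet.Compatible.mixed_hv (h : j.Compatible r) (hr : r ≠ 0) :
    j.a₁ * (j.mixed r κ 1 0 1 0 + j.mixed r κ 1 0 (-j.a₃) j.a₁) =
      2 * ((j.a₁ + r * j.b₁) * (j.c₁ * j.a₁' + j.u * (j.a₁ * j.a₃' - j.a₃ * j.a₁'))
      + 2 * j.a₁ ^ 2 * j.d₁ + j.a₁ * (j.u * (j.b₁ * j.a₃ - j.a₁ * j.b₃) - j.c₁ * j.b₁)
      + κ * (-(r * j.b₃) * j.a₁ * j.c₃
        + (1 + (j.a₃ + r * j.b₃) * j.a₃) * (j.u * j.a₃ - j.c₁))) := by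
  have e1 := h.rel.a₄_eq
  have e2 := h.rel.mul_eq
  have e3 := h.rel.c₂_mul
  have e4 := h.relDot.a₄_eq
  have e5 := h.relDot.mul_eq
  have e6 := h.relDot.c₂_mul
  have e7 := h.b₄_eq hr
  have e9 := h.d₂_mul hr
  clear h
  obtain ⟨a₁, a₂, a₃, a₄, b₁, b₂, b₃, b₄, c₁, c₂, c₃, d₁, d₂, d₃, a₁', a₂', a₃', a₄', b₁', b₂', b₃',
    b₄', c₁', c₂', c₃', d₁', d₂', d₃'⟩ := j
  simp only [Jet.mixed, Jet.u, qf] at *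
  subst e1 e4 e7
  -- `e2`, `e3` and `e9` remove a₂, c₂ and d₂, while `e5` and `e6` remove a₂' and c₂'; the b₂ terms
  -- cancel against those of `e9`.
  linear_combination (-a₁ ^ 3) * e9
    + (2 * a₁ ^ 2 * d₁ - 2 * a₁ * b₁ * c₁ + 2 * κ * a₁ * (c₂ * a₁ - a₃ * c₃)
      - 2 * κ * ((a₃ + r * b₃) * a₃ + 1) * c₁ - a₁ * (a₁ + r * b₁) * c₁'
      + 2 * (a₁ + r * b₁) * c₁ * a₁') * e2
    + (2 * a₁ ^ 2 * b₁ + 2 * κ * ((a₃ + r * b₃) * a₃ + 1) * a₁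
      - (a₁ + r * b₁) * a₁ * a₁') * e3
    + (-(a₁ + r * b₁) * a₁ * c₁) * e5 + (a₁ + r * b₁) * a₁ ^ 2 * e6

theorem Jet.Compatible.mixed_vh (h : j.Compatible r) (hr : r ≠ 0) :
    j.mixed r κ (-(j.a₃ + r * j.b₃)) (j.a₁ + r * j.b₁) 1 0 =
      (j.a₁ + r * j.b₁) * (j.c₃ * j.a₁' - j.c₁ * j.a₃' + j.a₃ * j.c₁' - j.a₁ * j.c₃')
      + 2 * j.a₁ * ((j.a₁ + r * j.b₁) * j.d₃ - (j.a₃ + r * j.b₃) * j.d₁)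
      - 2 * κ * (1 + j.a₃ * (j.a₃ + r * j.b₃)) * j.c₃ := by
  have e1 := h.rel.a₄_eq
  have e4 := h.relDot.a₄_eq
  have e7 := h.b₄_eq hr
  have f2 := h.radialRel.mul_eq
  clear h
  obtain ⟨a₁, a₂, a₃, a₄, b₁, b₂, b₃, b₄, c₁, c₂, c₃, d₁, d₂, d₃, a₁', a₂', a₃', a₄', b₁', b₂', b₃',
    b₄', c₁', c₂', c₃', d₁', d₂', d₃'⟩ := j
  simp only [Jet.mixed, qf] at *
  subst e1 e4 e7
  linear_combination (-2 * κ * c₃) * f2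

theorem Jet.Compatible.mixed_vv (h : j.Compatible r) (hr : r ≠ 0) :
    j.a₁ * j.mixed r κ (-(j.a₃ + r * j.b₃)) (j.a₁ + r * j.b₁) (-j.a₃) j.a₁ =
      j.a₁ * ((j.a₁ + r * j.b₁) * (j.a₁' * j.c₃ + j.a₁ * j.c₃' - j.a₃' * j.c₁ - j.a₃ * j.c₁')
        + 2 * j.a₁ * j.m r) - 2 * κ * (r * j.b₃) * (j.u * j.a₃ - j.c₁) := by
  have e1 := h.rel.a₄_eq
  have e2 := h.rel.mul_eq
  have e3 := h.rel.c₂_mul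
  have e4 := h.relDot.a₄_eq
  have e5 := h.relDot.mul_eq
  have e7 := h.b₄_eq hr
  have e8 := h.b₂_mul hr
  have f2 := h.radialRel.mul_eq
  have f3 := h.radialRel.c₂_mul
  clear h
  obtain ⟨a₁, a₂, a₃, a₄, b₁, b₂, b₃, b₄, c₁, c₂, c₃, d₁, d₂, d₃, a₁', a₂', a₃', a₄', b₁', b₂', b₃',
    b₄', c₁', c₂', c₃', d₁', d₂', d₃'⟩ := j
  simp only [Jet.mixed, Jet.u, Jet.m, qf] at *
  subst e1 e4 e7
  linear_combination (a₁ * (a₁ * (-b₁ * a₃ + b₃ * a₁))) * f3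
    + (a₁ * ((c₁ + r * d₁) * a₁ * a₃ - a₁ ^ 2 * (c₃ + r * d₃) + a₁ * a₃ * c₁ - a₁ ^ 2 * c₃)) * e8
    + (a₁ * (-(c₁ + r * d₁) * a₁ * b₃ + a₁ * b₁ * (c₃ + r * d₃) - (a₁ + r * b₁) * c₁ * a₃'
      + (a₁ + r * b₁) * c₃ * a₁' - b₃ * c₁ * a₁ + a₁ * b₁ * c₃
      + (a₁ + r * b₁) * (-a₃ * c₁' + a₁ * c₃')
      + a₁ * (-(a₃ + r * b₃) * d₁ + (a₁ + r * b₁) * d₃)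
      - 2 * κ * (a₃ + r * b₃) * (c₂ * a₁ - a₃ * c₃)) + 2 * κ * (r * b₃) * c₁) * e2
    + (a₁ * ((a₁ + r * b₁) * (-a₁' * a₃ + a₃' * a₁)
      + a₁ * (-b₁ * (a₃ + r * b₃) + b₃ * (a₁ + r * b₁)) - 2 * κ * (r * b₃))) * e3
    + (a₁ * ((a₁ + r * b₁) * c₁ * a₃ - (a₁ + r * b₁) * c₃ * a₁)) * e5
    + (a₁ * (a₁ * (a₁ * d₃ - a₃ * d₁) + 2 * κ * a₃ * (c₂ * a₁ - a₃ * c₃))) * f2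

/-- The second factor is the t-derivative of c₁ + 2t d₁ = G(y^H,y^H)/r at r = 2t. In
`Jet.Compatible.radial_v` it is likewise the derivative of G(Jy^H,y^H)/r. This is where d₁' and d₃'
enter the equations. -/
theorem Jet.radial_h (j : Jet) (r : ℝ) :
    j.radial r 1 0 = (j.a₁ + r * j.b₁) * (j.c₁' + r * j.d₁' + 2 * j.d₁) := by
  simp only [Jet.radial, qf]
  ring

theorem Jet.Compatible.radial_v (h : j.Compatible r) :
    j.radial r (-(j.a₃ + r * j.b₃)) (j.a₁ + r * j.b₁) = (j.a₁ + r * j.b₁)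
      * ((j.a₁' + r * j.b₁' + 2 * j.b₁) * (j.c₃ + r * j.d₃)
        + (j.a₁ + r * j.b₁) * (j.c₃' + r * j.d₃' + 2 * j.d₃)
        - (j.a₃' + r * j.b₃' + 2 * j.b₃) * (j.c₁ + r * j.d₁)
        - (j.a₃ + r * j.b₃) * (j.c₁' + r * j.d₁' + 2 * j.d₁)) := by
  have f1 := h.radialRel.a₄_eq
  have f2 := h.radialRel.mul_eq
  have f3 := h.radialRel.c₂_mul
  have f4 := h.radialRelDot.a₄_eq
  have f5 := h.radialRelDot.mul_eq
  simp only [Jet.radial, qf, f1, f4]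
  clear h
  generalize j.a₁ + r * j.b₁ = a₁ at *
  generalize j.a₂ + r * j.b₂ = a₂ at *
  generalize j.a₃ + r * j.b₃ = a₃ at *
  generalize j.c₁ + r * j.d₁ = c₁ at *
  generalize j.c₂ + r * j.d₂ = c₂ at *
  generalize j.c₃ + r * j.d₃ = c₃ at *
  generalize j.a₁' + r * j.b₁' + 2 * j.b₁ = a₁' at *
  generalize j.a₂' + r * j.b₂' + 2 * j.b₂ = a₂' at *
  generalize j.a₃' + r * j.b₃' + 2 * j.b₃ = a₃' at *
  linear_combination (a₁ * (-a₁' * a₃ + a₃' * a₁)) * f3 + (a₁ * c₁ * a₃ - a₁ ^ 2 * c₃) * f5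
    + (-a₁ * c₁ * a₃' + a₁ * c₃ * a₁'
      + a₁ * (a₁ * (j.c₃' + r * j.d₃' + 2 * j.d₃) - a₃ * (j.c₁' + r * j.d₁' + 2 * j.d₁))) * f2


/-! ### Elimination of Φ and determination of the curvature -/

/-- The determinant `Δ`, up to the factor `-a₁²` the determinant of the metric on the lifts of a
vector orthogonal to `y`. -/
def Jet.delta (j : Jet) : ℝ := j.c₁ ^ 2 + j.u ^ 2

/-- The derivative of `Jet.u`. -/
def Jet.u' (j : Jet) : ℝ := j.a₁' * j.c₃ + j.a₁ * j.c₃' - j.a₃' * j.c₁ - j.a₃ * j.c₁'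

/-- The derivative of `Jet.m`. -/
def Jet.m' (j : Jet) (r : ℝ) : ℝ :=
  (j.a₁' + 2 * j.b₁ + r * j.b₁') * j.d₃ + (j.a₁ + r * j.b₁) * j.d₃'
    - (j.a₃' + 2 * j.b₃ + r * j.b₃') * j.d₁ - (j.a₃ + r * j.b₃) * j.d₁'
    + j.b₁' * j.c₃ + j.b₁ * j.c₃' - j.b₃' * j.c₁ - j.b₃ * j.c₁'

/-- The relations between the `1`-jets of the coefficients that express the `ω₁ ⊕ ω₃` condition,
cleared of denominators. -/
structure Jet.Omega13 (j : Jet) (r κ : ℝ) : Prop where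
  eq_re : (j.a₁ + r * j.b₁) * (j.c₁ * j.a₁' + j.u * (j.a₁ * j.a₃' - j.a₃ * j.a₁'))
      + 2 * j.a₁ ^ 2 * j.d₁ + j.a₁ * (j.u * (j.b₁ * j.a₃ - j.a₁ * j.b₃) - j.c₁ * j.b₁)
      + κ * (-(r * j.b₃) * j.a₁ * j.c₃
        + (1 + (j.a₃ + r * j.b₃) * j.a₃) * (j.u * j.a₃ - j.c₁)) = 0
  eq_im : (j.a₁ + r * j.b₁) * (j.c₁ * (j.a₁ * j.a₃' - j.a₃ * j.a₁') - j.u * j.a₁')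
      - 2 * j.a₁ ^ 2 * j.m r + j.a₁ * (j.c₁ * (j.b₁ * j.a₃ - j.a₁ * j.b₃) + j.u * j.b₁)
      + κ * ((1 + j.a₃ * (j.a₃ + r * j.b₃)) * j.a₁ * j.c₃
        + r * j.b₃ * (j.u * j.a₃ - j.c₁)) = 0
  eq_d₁ : j.a₁ * j.delta * (j.a₁ + r * j.b₁) * j.d₁' =
    j.a₁ * ((j.m r * j.u + j.d₁ * j.c₁) * ((j.a₁ + r * j.b₁) * j.c₁' + 2 * j.a₁ * j.d₁)
      + (j.d₁ * j.u - j.m r * j.c₁) * ((j.a₁ + r * j.b₁) * j.u' + 2 * j.a₁ * j.m r))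
    - 2 * j.a₁ * j.b₁ * j.d₁ * j.delta
    - 2 * κ * j.b₃ * ((j.u + r * j.m r) + j.a₃ * (j.c₁ + r * j.d₁)) * j.delta
  eq_m : j.a₁ * j.delta * (j.a₁ + r * j.b₁) * j.m' r =
    j.a₁ * ((j.m r * j.u + j.d₁ * j.c₁) * ((j.a₁ + r * j.b₁) * j.u' + 2 * j.a₁ * j.m r)
      - (j.d₁ * j.u - j.m r * j.c₁) * ((j.a₁ + r * j.b₁) * j.c₁' + 2 * j.a₁ * j.d₁))
    - 2 * j.a₁ * j.b₁ * j.m r * j.delta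
    - 2 * κ * j.b₃ * (j.a₃ * (j.u + r * j.m r) - (j.c₁ + r * j.d₁)) * j.delta

variable {j : Jet} {r κ : ℝ}

/-- With (-a₃, a₁) = Je^H, this and `LevelRel.qf_v_j` are G(Je^H,Je^H) = -G(e^H,e^H) and
G(Je^H,J²e^H) = -G(e^H,Je^H) in coordinates. -/
theorem LevelRel.qf_v {a₁ a₂ a₃ a₄ c₁ c₂ c₃ : ℝ} (h : LevelRel a₁ a₂ a₃ a₄ c₁ c₂ c₃) :
    qf c₁ c₂ c₃ (-a₃) a₁ (-a₃) a₁ = -c₁ := by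
  unfold qf
  linear_combination a₁ * h.c₂_mul - c₁ * h.mul_eq

theorem LevelRel.qf_v_j {a₁ a₂ a₃ a₄ c₁ c₂ c₃ : ℝ} (h : LevelRel a₁ a₂ a₃ a₄ c₁ c₂ c₃) :
    qf c₁ c₂ c₃ (-a₃) a₁ (a₄ * -a₃ - a₂ * a₁) (a₁ * -a₃ + a₃ * a₁) = -(a₁ * c₃ - a₃ * c₁) := by
  unfold qf
  rw [h.a₄_eq]
  linear_combination (a₃ * c₁ - a₁ * c₃) * h.mul_eq

theorem LevelRel.qf_h_j {a₁ a₂ a₃ a₄ c₁ c₂ c₃ : ℝ} (h : LevelRel a₁ a₂ a₃ a₄ c₁ c₂ c₃) :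
    qf c₁ c₂ c₃ 1 0 (a₄ * 1 - a₂ * 0) (a₁ * 1 + a₃ * 0) = a₁ * c₃ - a₃ * c₁ := by
  unfold qf
  rw [h.a₄_eq]
  ring

theorem LevelRel.j_v {a₁ a₂ a₃ a₄ c₁ c₂ c₃ : ℝ} (h : LevelRel a₁ a₂ a₃ a₄ c₁ c₂ c₃) :
    a₄ * -a₃ - a₂ * a₁ = -1 := by
  rw [h.a₄_eq]
  linear_combination -h.mul_eq

/-- Let z = φ_h - iφ_v, with φ_h = φ₁ and φ_v = -(a₃ + r b₃)φ₁ + (a₁ + r b₁)φ₂, and write M, R for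
the mixed and radial values. The hypotheses at h and v say N r (M_hh + iM_vv) = (c₁ + iu) z and N r
(R_h + iR_v) = ((c₁ + r d₁) + i(u + r m)) z. Eliminating z gives `eq_d₁` and `eq_m` as real and
imaginary parts, while `eq_re` and `eq_im` come from the sums in which z cancels. -/
theorem Jet.Compatible.omega13 (h : j.Compatible r) (hr : r ≠ 0) {N φ₁ φ₂ : ℝ} (hN : N ≠ 0)
    (hrad : ∀ ξ η, N * r * j.radial r ξ η =
      qf (j.c₁ + r * j.d₁) (j.c₂ + r * j.d₂) (j.c₃ + r * j.d₃) ξ η ξ η * (ξ * φ₁ + η * φ₂)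
      + qf (j.c₁ + r * j.d₁) (j.c₂ + r * j.d₂) (j.c₃ + r * j.d₃) ξ η
          ((j.a₄ + r * j.b₄) * ξ - (j.a₂ + r * j.b₂) * η)
          ((j.a₁ + r * j.b₁) * ξ + (j.a₃ + r * j.b₃) * η)
        * (((j.a₄ + r * j.b₄) * ξ - (j.a₂ + r * j.b₂) * η) * φ₁
          + ((j.a₁ + r * j.b₁) * ξ + (j.a₃ + r * j.b₃) * η) * φ₂))
    (hmix : ∀ ξ₁ η₁ ξ₂ η₂, N * r * j.mixed r κ ξ₁ η₁ ξ₂ η₂ =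
      qf j.c₁ j.c₂ j.c₃ ξ₂ η₂ ξ₂ η₂ * (ξ₁ * φ₁ + η₁ * φ₂)
      + qf j.c₁ j.c₂ j.c₃ ξ₂ η₂ (j.a₄ * ξ₂ - j.a₂ * η₂) (j.a₁ * ξ₂ + j.a₃ * η₂)
        * (((j.a₄ + r * j.b₄) * ξ₁ - (j.a₂ + r * j.b₂) * η₁) * φ₁
          + ((j.a₁ + r * j.b₁) * ξ₁ + (j.a₃ + r * j.b₃) * η₁) * φ₂)) :
    j.Omega13 r κ := by
  have ha := h.rel.a₁_ne_zero
  have hNr : N * r ≠ 0 := mul_ne_zero hN hr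
  have hqh : ∀ c₁ c₂ c₃ : ℝ, qf c₁ c₂ c₃ 1 0 1 0 = c₁ := fun c₁ c₂ c₃ => by simp [qf]
  have g1 := hmix 1 0 1 0
  have g2 := hmix 1 0 (-j.a₃) j.a₁
  have g3 := hmix (-(j.a₃ + r * j.b₃)) (j.a₁ + r * j.b₁) 1 0
  have g4 := hmix (-(j.a₃ + r * j.b₃)) (j.a₁ + r * j.b₁) (-j.a₃) j.a₁
  have g5 := hrad 1 0
  have g6 := hrad (-(j.a₃ + r * j.b₃)) (j.a₁ + r * j.b₁)
  rw [hqh, h.rel.qf_h_j] at g1 g3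
  rw [h.rel.qf_v, h.rel.qf_v_j] at g2 g4
  rw [hqh, h.radialRel.qf_h_j] at g5
  rw [h.radialRel.qf_v, h.radialRel.qf_v_j] at g6
  rw [h.radialRel.j_v] at g3 g4 g6
  -- Passing from e^H to Je^H reverses both metric factors, so the Φ-terms of `g1` and `g2` cancel;
  -- likewise for `g3` and `g4`.
  have s1 : j.mixed r κ 1 0 1 0 + j.mixed r κ 1 0 (-j.a₃) j.a₁ = 0 := by
    apply mul_left_cancel₀ hNr
    linear_combination g1 + g2
  have s2 : j.mixed r κ (-(j.a₃ + r * j.b₃)) (j.a₁ + r * j.b₁) 1 0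
      + j.mixed r κ (-(j.a₃ + r * j.b₃)) (j.a₁ + r * j.b₁) (-j.a₃) j.a₁ = 0 := by
    apply mul_left_cancel₀ hNr
    linear_combination g3 + g4
  have v1 := h.mixed_hh (κ := κ) hr
  have v3 := h.mixed_vh (κ := κ) hr
  have v4 := h.mixed_vv (κ := κ) hr
  have v6 := h.radial_v
  have v5 := j.radial_h r
  have t1 := h.mixed_hv (κ := κ) hr
  rw [s1, mul_zero] at t1
  have f4 : (j.a₄ + r * j.b₄) = -(j.a₃ + r * j.b₃) := h.radialRel.a₄_eq
  rw [f4] at g1 g5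
  have hw : (j.a₁ + r * j.b₁) * (j.c₃ + r * j.d₃) - (j.a₃ + r * j.b₃) * (j.c₁ + r * j.d₁)
      = j.u + r * j.m r := by
    simp only [Jet.u, Jet.m]
    ring
  rw [hw] at g5 g6
  rw [v5] at g5
  rw [v6] at g6
  rw [v1] at g1
  have hu : j.a₁ * j.c₃ - j.a₃ * j.c₁ = j.u := rfl
  rw [hu] at g1 g4
  have hu' : j.a₁' * j.c₃ + j.a₁ * j.c₃' - j.a₃' * j.c₁ - j.a₃ * j.c₁' = j.u' := rfl
  rw [hu'] at v4
  have hac : j.a₁ * j.c₃ = j.u + j.a₃ * j.c₁ := by simp only [Jet.u]; ring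
  refine ⟨by linarith, ?_, ?_, ?_⟩
  · have t2 : j.a₁ * (j.mixed r κ (-(j.a₃ + r * j.b₃)) (j.a₁ + r * j.b₁) 1 0
      + j.mixed r κ (-(j.a₃ + r * j.b₃)) (j.a₁ + r * j.b₁) (-j.a₃) j.a₁) = 0 := by
      rw [s2, mul_zero]
    rw [mul_add, v4, v3] at t2
    simp only [Jet.u', Jet.u, Jet.m] at t2 ⊢
    linear_combination (-1 / 2) * t2
  -- The extra factor r is genuine: c₁ + r d₁ and u + r m differ from c₁ and u by multiples of r,
  -- and the terms without that factor cancel.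
  · apply mul_left_cancel₀ (mul_ne_zero hNr hr)
    generalize hM : j.mixed r κ (-(j.a₃ + r * j.b₃)) (j.a₁ + r * j.b₁) (-j.a₃) j.a₁ = M at *
    simp only [Jet.delta]
    linear_combination j.a₁ * (j.c₁ ^ 2 + j.u ^ 2) * g5
      - j.a₁ * (j.c₁ * (j.c₁ + r * j.d₁) + j.u * (j.u + r * j.m r)) * g1
      - j.a₁ * (j.u * (j.c₁ + r * j.d₁) - j.c₁ * (j.u + r * j.m r)) * g4
      + N * r * (j.u * (j.c₁ + r * j.d₁) - j.c₁ * (j.u + r * j.m r)) * v4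
      - 2 * N * r * κ * (r * j.b₃) * (j.c₁ * (j.c₁ + r * j.d₁) + j.u * (j.u + r * j.m r)) * hac
  · have hA := h.radialRel.a₁_ne_zero
    have hm' : (j.a₁' + r * j.b₁' + 2 * j.b₁) * (j.c₃ + r * j.d₃)
        + (j.a₁ + r * j.b₁) * (j.c₃' + r * j.d₃' + 2 * j.d₃)
        - (j.a₃' + r * j.b₃' + 2 * j.b₃) * (j.c₁ + r * j.d₁)
        - (j.a₃ + r * j.b₃) * (j.c₁' + r * j.d₁' + 2 * j.d₁) = j.u' + 2 * j.m r + r * j.m' r := by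
      simp only [Jet.u', Jet.m, Jet.m']
      ring
    rw [hm'] at g6
    apply mul_left_cancel₀ (mul_ne_zero hNr hr)
    generalize hM : j.mixed r κ (-(j.a₃ + r * j.b₃)) (j.a₁ + r * j.b₁) (-j.a₃) j.a₁ = M at *
    simp only [Jet.delta]
    linear_combination j.a₁ * (j.c₁ ^ 2 + j.u ^ 2) * g6
      - j.a₁ * (j.c₁ * (j.u + r * j.m r) - j.u * (j.c₁ + r * j.d₁)) * g1
      - j.a₁ * (j.u * (j.u + r * j.m r) + j.c₁ * (j.c₁ + r * j.d₁)) * g4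
      + N * r * (j.u * (j.u + r * j.m r) + j.c₁ * (j.c₁ + r * j.d₁)) * v4
      - 2 * N * r * κ * (r * j.b₃) * (j.c₁ * (j.u + r * j.m r) - j.u * (j.c₁ + r * j.d₁)) * hac

theorem Jet.delta_eq (j : Jet) : j.delta =
    (1 + j.a₃ ^ 2) * j.c₁ ^ 2 - j.a₁ * j.c₃ * (2 * j.a₃ * j.c₁ - j.a₁ * j.c₃) := by
  simp only [Jet.delta, Jet.u]
  ring

theorem LevelRel.delta_ne_zero (h : LevelRel j.a₁ j.a₂ j.a₃ j.a₄ j.c₁ j.c₂ j.c₃)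
    (hc : j.c₁ * j.c₂ - j.c₃ ^ 2 ≠ 0) : j.delta ≠ 0 := by
  have e : j.delta = -(j.a₁ ^ 2 * (j.c₁ * j.c₂ - j.c₃ ^ 2)) := by
    rw [Jet.delta_eq]
    linear_combination (j.a₁ * j.c₁) * h.c₂_mul - j.c₁ ^ 2 * h.mul_eq
  rw [e]
  exact neg_ne_zero.2 (mul_ne_zero (pow_ne_zero _ h.a₁_ne_zero) hc)

/-- The sectional curvature is determined by the `1`-jets of the coefficients. -/
theorem Jet.Omega13.unique {κ' : ℝ} (h : j.Omega13 r κ) (h' : j.Omega13 r κ')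
    (hΔ : j.delta ≠ 0) : κ = κ' := by
  have e1 : (κ - κ') * (-(r * j.b₃) * j.a₁ * j.c₃
        + (1 + (j.a₃ + r * j.b₃) * j.a₃) * (j.u * j.a₃ - j.c₁)) = 0 := by
    linear_combination h.eq_re - h'.eq_re
  have e2 : (κ - κ') * ((1 + j.a₃ * (j.a₃ + r * j.b₃)) * j.a₁ * j.c₃
        + r * j.b₃ * (j.u * j.a₃ - j.c₁)) = 0 := by
    linear_combination h.eq_im - h'.eq_im
  have hac : j.a₁ * j.c₃ = j.u + j.a₃ * j.c₁ := by simp only [Jet.u]; ring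
  have e3 : (κ - κ') * ((1 + j.a₃ ^ 2) ^ 2 * (1 + (j.a₃ + r * j.b₃) ^ 2) * j.delta) = 0 := by
    -- With A₃ = a₃ + r b₃, the sum of squares is ((A₃ - a₃)² + (1 + a₃A₃)²)((a₁c₃)² + (u a₃ -
    -- c₁)²). Since a₁c₃ = u + a₃c₁, each factor splits again: into (1 + a₃²)(1 + A₃²) and (1 +
    -- a₃²)Δ.
    have e : (1 + j.a₃ ^ 2) ^ 2 * (1 + (j.a₃ + r * j.b₃) ^ 2) * j.delta =
      (-(r * j.b₃) * j.a₁ * j.c₃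
        + (1 + (j.a₃ + r * j.b₃) * j.a₃) * (j.u * j.a₃ - j.c₁)) ^ 2
      + ((1 + j.a₃ * (j.a₃ + r * j.b₃)) * j.a₁ * j.c₃
        + r * j.b₃ * (j.u * j.a₃ - j.c₁)) ^ 2 := by
      rw [mul_assoc _ j.a₁, mul_assoc _ j.a₁, hac, Jet.delta]
      ring
    rw [e]
    linear_combination (-(r * j.b₃) * j.a₁ * j.c₃
        + (1 + (j.a₃ + r * j.b₃) * j.a₃) * (j.u * j.a₃ - j.c₁)) * e1
      + ((1 + j.a₃ * (j.a₃ + r * j.b₃)) * j.a₁ * j.c₃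
        + r * j.b₃ * (j.u * j.a₃ - j.c₁)) * e2
  have hne : (1 + j.a₃ ^ 2) ^ 2 * (1 + (j.a₃ + r * j.b₃) ^ 2) * j.delta ≠ 0 := by
    refine mul_ne_zero (by positivity) hΔ
  exact sub_eq_zero.1 ((mul_eq_zero.1 e3).resolve_right hne)


/-! ### Solving for the derivatives -/

section Formulas

variable {j : Jet} {t c : ℝ}

/-- `eq_re` is linear in a₁' with coefficient (a₁ + 2b₁t)(c₁ - a₃u), which is D; hence the extra
nonvanishing hypothesis. -/
theorem Jet.Omega13.a₁'_eq (h : j.Omega13 (2 * t) (-c)) (hA : j.a₁ + 2 * j.b₁ * t ≠ 0)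
    (hD : j.c₁ * (1 + j.a₃ ^ 2) - j.a₁ * j.a₃ * j.c₃ ≠ 0) {D : ℝ}
    (hD' : D = (j.c₁ * (1 + j.a₃ ^ 2) - j.a₁ * j.a₃ * j.c₃) * (j.a₁ + 2 * j.b₁ * t)) :
    j.a₁' =
      (j.a₁ ^ 3 * (j.b₃ - j.a₃') * j.c₃
          - (1 + j.a₃ ^ 2) * c * j.c₁ * (1 + j.a₃ ^ 2 + 2 * j.a₃ * j.b₃ * t)) / D
        + j.a₁ ^ 2 * ((j.a₃ * (j.c₁ * (j.a₃' - j.b₃) - j.b₁ * j.c₃)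
          - 2 * (j.d₁ + j.a₃' * j.b₁ * j.c₃ * t)) / D)
        + j.a₁ * ((j.b₁ * j.c₁ * (1 + j.a₃ ^ 2 + 2 * j.a₃ * j.a₃' * t)
          + c * j.c₃ * (j.a₃ * (1 + j.a₃ ^ 2) - 2 * j.b₃ * t * (1 - j.a₃ ^ 2))) / D) := by
  have hD0 : D ≠ 0 := hD' ▸ mul_ne_zero hD hA
  rw [← mul_div_assoc, ← mul_div_assoc, ← add_div, ← add_div, eq_div_iff hD0, hD']
  have h1 := h.eq_re
  simp only [Jet.u] at h1
  linear_combination h1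

theorem Jet.Omega13.a₃'_eq (h : j.Omega13 (2 * t) (-c)) (ha : j.a₁ ≠ 0)
    (hA : j.a₁ + 2 * j.b₁ * t ≠ 0) {Δ E : ℝ}
    (hΔ : Δ = (1 + j.a₃ ^ 2) * j.c₁ ^ 2 - j.a₁ * j.c₃ * (2 * j.a₃ * j.c₁ - j.a₁ * j.c₃))
    (hΔ0 : Δ ≠ 0) (hE : E = j.a₁ * Δ * (j.a₁ + 2 * j.b₁ * t)) :
    j.a₃' =
      (j.a₁ ^ 4 * j.c₃ * (j.b₃ * j.c₃ - 2 * j.a₃ * j.d₃)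
          - 2 * (1 + j.a₃ ^ 2) * j.b₃ * c * j.c₁ * t
            * ((1 + j.a₃ ^ 2) * j.c₁ - 2 * j.a₁ * j.a₃ * j.c₃)) / E
      - j.a₁ ^ 2 * (1 + j.a₃ ^ 2)
          * ((j.b₃ * (j.c₁ ^ 2 + 2 * c * j.c₃ ^ 2 * t + 4 * j.c₁ * j.d₁ * t)
            + 2 * j.c₁ * (j.a₃ * j.d₁ - j.b₁ * (j.c₃ + 2 * j.d₃ * t))) / E)
      + 2 * j.a₁ ^ 3
          * ((j.c₁ * j.d₃ - j.c₃ * j.d₁ + j.a₃ ^ 2 * (j.c₃ * j.d₁ + j.c₁ * j.d₃)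
            - j.a₃ * j.c₃ * (j.b₁ * (j.c₃ + 2 * j.d₃ * t) - 2 * j.b₃ * j.d₁ * t)) / E) := by
  have hE0 : E ≠ 0 := hE ▸ mul_ne_zero (mul_ne_zero ha hΔ0) hA
  rw [← mul_div_assoc, ← mul_div_assoc, ← sub_div, ← add_div, eq_div_iff hE0, hE, hΔ]
  have h1 := h.eq_re
  have h2 := h.eq_im
  simp only [Jet.u, Jet.m] at h1 h2
  -- a₁' has coefficient (a₁ + 2b₁t)(c₁ - a₃u) in `eq_re` and -(a₁ + 2b₁t)a₁c₃ in `eq_im`. The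
  -- combination cancels it and leaves a₃' with coefficient a₁Δ(a₁ + 2b₁t) = E, so no case
  -- distinction is needed.
  linear_combination (j.c₁ - j.a₃ * (j.a₁ * j.c₃ - j.a₃ * j.c₁)) * h2 + j.a₁ * j.c₃ * h1

/-- P - iQ is the quotient (d₁ + im)/(c₁ + iu). This formula is the real part of the equation for
d₁' + im'; the imaginary part gives m' in the next proof. -/
theorem Jet.Omega13.d₁'_eq (h : j.Omega13 (2 * t) (-c)) (ha : j.a₁ ≠ 0)
    (hA : j.a₁ + 2 * j.b₁ * t ≠ 0) {Δ u u' m v w P Q : ℝ}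
    (hΔ : Δ = j.delta) (hΔ0 : Δ ≠ 0)
    (hu : u = j.u) (hu' : u' = j.u') (hm : m = j.m (2 * t)) (hv : v = j.c₁ + 2 * j.d₁ * t)
    (hw : w = u + 2 * t * m) (hP : P = (m * u + j.d₁ * j.c₁) / Δ)
    (hQ : Q = (j.d₁ * u - m * j.c₁) / Δ) :
    j.d₁' = P * j.c₁' + Q * u'
      + (2 * j.a₁ * (m * Q + j.d₁ * P) - 2 * j.b₁ * j.d₁
        + 2 * c * j.b₃ * (w + j.a₃ * v) / j.a₁) / (j.a₁ + 2 * j.b₁ * t) := by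
  have h1 := h.eq_d₁
  subst hu hu' hm
  have e : j.a₁ + 2 * t * j.b₁ = j.a₁ + 2 * j.b₁ * t := by ring
  rw [← hΔ, e] at h1
  clear h e hΔ
  subst hP hQ hv hw
  generalize j.a₁ + 2 * j.b₁ * t = B at *
  field_simp
  linear_combination h1

theorem Jet.Omega13.d₃'_eq (h : j.Omega13 (2 * t) (-c)) (ha : j.a₁ ≠ 0)
    (hA : j.a₁ + 2 * j.b₁ * t ≠ 0) {Δ u u' m v w P Q : ℝ}
    (hΔ : Δ = j.delta) (hΔ0 : Δ ≠ 0)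
    (hu : u = j.u) (hu' : u' = j.u') (hm : m = j.m (2 * t)) (hv : v = j.c₁ + 2 * j.d₁ * t)
    (hw : w = u + 2 * t * m) (hP : P = (m * u + j.d₁ * j.c₁) / Δ)
    (hQ : Q = (j.d₁ * u - m * j.c₁) / Δ) :
    j.d₃' = (P * u' - Q * j.c₁'
      + (2 * j.a₁ * (m * P - j.d₁ * Q) - 2 * j.b₁ * m
          + 2 * c * j.b₃ * (j.a₃ * w - v) / j.a₁) / (j.a₁ + 2 * j.b₁ * t)
      - (j.a₁' + 2 * j.b₁ + 2 * j.b₁' * t) * j.d₃ + (j.a₃' + 2 * j.b₃ + 2 * j.b₃' * t) * j.d₁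
      + (j.a₃ + 2 * j.b₃ * t) * j.d₁'
      - j.b₁' * j.c₃ - j.b₁ * j.c₃' + j.b₃' * j.c₁ + j.b₃ * j.c₁') / (j.a₁ + 2 * j.b₁ * t) := by
  have h1 := h.eq_m
  subst hu hu' hm
  have e : j.a₁ + 2 * t * j.b₁ = j.a₁ + 2 * j.b₁ * t := by ring
  have hm' : j.m' (2 * t) = P * j.u' - Q * j.c₁'
      + (2 * j.a₁ * (j.m (2 * t) * P - j.d₁ * Q) - 2 * j.b₁ * j.m (2 * t)
          + 2 * c * j.b₃ * (j.a₃ * w - v) / j.a₁) / (j.a₁ + 2 * j.b₁ * t) := by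
    rw [← hΔ, e] at h1
    clear h e hΔ
    subst hP hQ hv hw
    generalize j.a₁ + 2 * j.b₁ * t = B at *
    field_simp
    linear_combination h1
  -- d₃' occurs in m' with coefficient a₁ + 2b₁t, so the value of m' just found yields d₃'.
  rw [eq_div_iff hA, ← hm', Jet.m']
  ring

end Formulas

/-! ### Passage to t = 0 -/

section Closure

theorem eq_zero_of_continuousOn_Ici {f : ℝ → ℝ} (hf : ContinuousOn f (Set.Ici 0))
    (h : ∀ t, 0 < t → f t = 0) {t : ℝ} (ht : 0 ≤ t) : f t = 0 := by
  rcases ht.eq_or_lt with rfl | ht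
  · have h1 : Filter.Tendsto f (nhdsWithin 0 (Set.Ioi 0)) (nhds (f 0)) :=
      (hf 0 Set.self_mem_Ici).mono_left (nhdsWithin_mono _ Set.Ioi_subset_Ici_self)
    have h2 : Filter.Tendsto f (nhdsWithin 0 (Set.Ioi 0)) (nhds 0) :=
      tendsto_const_nhds.congr' (by
        filter_upwards [self_mem_nhdsWithin] with s hs
        exact (h s hs).symm)
    exact tendsto_nhds_unique h1 h2
  · exact h t ht

theorem continuousOn_dt {f : ℝ → ℝ} (hf : ContDiffOn ℝ ∞ f (Set.Ici 0)) :
    ContinuousOn (dt f) (Set.Ici 0) :=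
  hf.continuousOn_derivWithin (uniqueDiffOn_Ici 0) (by simp)

/-- The four relations are polynomial in the 1-jets, and these are continuous on [0, ∞) with the
one-sided derivative at 0; so they extend from t > 0. -/
theorem omega13_of_pos (A : EndCoeffs) (C : MetricCoeffs) {κ : ℝ}
    (h : ∀ t, 0 < t → (jet A C t).Omega13 (2 * t) κ) {t : ℝ} (ht : 0 ≤ t) :
    (jet A C t).Omega13 (2 * t) κ := by
  have ha₁ := A.smooth_a₁.continuousOn
  have ha₃ := A.smooth_a₃.continuousOn
  have hb₁ := A.smooth_b₁.continuousOn
  have hb₃ := A.smooth_b₃.continuousOn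
  have hc₁ := C.smooth_c₁.continuousOn
  have hc₃ := C.smooth_c₃.continuousOn
  have hd₁ := C.smooth_d₁.continuousOn
  have hd₃ := C.smooth_d₃.continuousOn
  have ha₁' := continuousOn_dt A.smooth_a₁
  have ha₃' := continuousOn_dt A.smooth_a₃
  have hb₁' := continuousOn_dt A.smooth_b₁
  have hb₃' := continuousOn_dt A.smooth_b₃
  have hc₁' := continuousOn_dt C.smooth_c₁
  have hc₃' := continuousOn_dt C.smooth_c₃
  have hd₁' := continuousOn_dt C.smooth_d₁
  have hd₃' := continuousOn_dt C.smooth_d₃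
  have hu : ContinuousOn (fun t => (jet A C t).u) (Set.Ici 0) := by
    simp only [Jet.u, jet]
    fun_prop
  have hu' : ContinuousOn (fun t => (jet A C t).u') (Set.Ici 0) := by
    simp only [Jet.u', jet]
    fun_prop
  have hΔ : ContinuousOn (fun t => (jet A C t).delta) (Set.Ici 0) := by
    simp only [Jet.delta]
    exact (hc₁.pow 2).add (hu.pow 2)
  have hm : ContinuousOn (fun t => (jet A C t).m (2 * t)) (Set.Ici 0) := by
    simp only [Jet.m, jet]
    fun_prop
  have hm' : ContinuousOn (fun t => (jet A C t).m' (2 * t)) (Set.Ici 0) := by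
    simp only [Jet.m', jet]
    fun_prop
  refine ⟨?_, ?_, ?_, ?_⟩
  · refine eq_zero_of_continuousOn_Ici ?_ (fun t ht => (h t ht).eq_re) ht
    simp only [jet] at hu ⊢
    fun_prop
  · refine eq_zero_of_continuousOn_Ici ?_ (fun t ht => (h t ht).eq_im) ht
    simp only [jet] at hu hm ⊢
    fun_prop
  · refine sub_eq_zero.1 (eq_zero_of_continuousOn_Ici ?_
      (fun t ht => sub_eq_zero.2 (h t ht).eq_d₁) ht)
    simp only [jet] at hu hu' hm hΔ ⊢
    fun_prop
  · refine sub_eq_zero.1 (eq_zero_of_continuousOn_Ici ?_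
      (fun t ht => sub_eq_zero.2 (h t ht).eq_m) ht)
    simp only [jet] at hu hu' hm hm' hΔ ⊢
    fun_prop

end Closure


/-! ### Consequences of the almost anti-Hermitian condition -/

section AntiHermitian

variable {n : ℕ} {g : (Fin n → ℝ) → Matrix (Fin n) (Fin n) ℝ} {A : EndCoeffs} {C : MetricCoeffs}
  {U : Set (Fin n → ℝ)} {x y e : Fin n → ℝ} {r s : ℝ}

/-- If a₁ = 0, then `h1` reads a₄² = -1; so a₁ can be cancelled in `h2`, which makes the block of J
trace-free. -/
theorem LevelRel.of_matrix {a₁ a₂ a₃ a₄ c₁ c₂ c₃ : ℝ} (h1 : a₄ * a₄ - a₂ * a₁ = -1)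
    (h2 : a₁ * a₄ + a₃ * a₁ = 0) (h3 : a₁ * -a₂ + a₃ * a₃ = -1)
    (h4 : qf c₁ c₂ c₃ a₄ a₁ 0 (-1) = -qf c₁ c₂ c₃ 1 0 (-a₂) a₃) :
    LevelRel a₁ a₂ a₃ a₄ c₁ c₂ c₃ := by
  have ha : a₁ ≠ 0 := by
    rintro rfl
    nlinarith [sq_nonneg a₄]
  have h5 : a₄ = -a₃ := by
    apply mul_left_cancel₀ ha
    linarith
  unfold qf at h4
  exact ⟨h5, by linarith, by rw [h5] at h4; linarith⟩

/-- The lifts over the coordinate domain `U` are almost anti-Hermitian. -/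
def IsAntiHermitianOn (g : (Fin n → ℝ) → Matrix (Fin n) (Fin n) ℝ) (A : EndCoeffs)
    (C : MetricCoeffs) (U : Set (Fin n → ℝ)) : Prop :=
  ∀ p : Fin n ⊕ Fin n → ℝ, base p ∈ U →
    liftJ g A p * liftJ g A p = -1 ∧ (liftG g C p).det ≠ 0 ∧
    ∀ X Y : Fin n ⊕ Fin n → ℝ,
      pair (liftG g C) p (liftJ g A p *ᵥ X) (liftJ g A p *ᵥ Y) = -pair (liftG g C) p X Y

theorem IsAntiHermitianOn.pair_liftJ {p : Fin n ⊕ Fin n → ℝ} (h : IsAntiHermitianOn g A C U)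
    (hp : base p ∈ U) (X Y : Fin n ⊕ Fin n → ℝ) :
    pair (liftG g C) p (liftJ g A p *ᵥ X) Y = pair (liftG g C) p X (liftJ g A p *ᵥ Y) := by
  obtain ⟨h1, -, h2⟩ := h p hp
  have h3 := h2 X (liftJ g A p *ᵥ Y)
  rw [Matrix.mulVec_mulVec, h1, Matrix.neg_mulVec, Matrix.one_mulVec, pair_neg_right] at h3
  linarith

theorem IsAntiHermitianOn.horJ_verJ (h : IsAntiHermitianOn g A C U) (hx : x ∈ U)
    (ξ η : Fin n → ℝ) :
    horJ g A x y (horJ g A x y ξ η) (verJ g A x y ξ η) = -ξ ∧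
      verJ g A x y (horJ g A x y ξ η) (verJ g A x y ξ η) = -η := by
  obtain ⟨h1, -, -⟩ := h (Sum.elim x y) hx
  set p : Fin n ⊕ Fin n → ℝ := Sum.elim x y
  set X := frame g p *ᵥ Sum.elim ξ η with hX
  have h2 : liftJ g A p *ᵥ (liftJ g A p *ᵥ X) = frame g p *ᵥ Sum.elim (-ξ) (-η) := by
    rw [Matrix.mulVec_mulVec, h1, Matrix.neg_mulVec, Matrix.one_mulVec, hX, ← Matrix.mulVec_neg]
    congr 1
    ext (i | i) <;> rfl
  have e1 := congrArg base h2
  have e2 := congrArg (ver g p) h2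
  rw [base_liftJ, base_frame, base_liftJ, ver_liftJ, hX, base_frame, ver_frame] at e1
  rw [ver_liftJ, ver_frame, base_liftJ, ver_liftJ, hX, base_frame, ver_frame] at e2
  exact ⟨e1, e2⟩

theorem IsAntiHermitianOn.liftedForm_liftedForm (h : IsAntiHermitianOn g A C U) (hx : x ∈ U)
    (ξ η ξ' η' : Fin n → ℝ) :
    liftedForm g C x y (horJ g A x y ξ η) (verJ g A x y ξ η) (horJ g A x y ξ' η')
      (verJ g A x y ξ' η') = -liftedForm g C x y ξ η ξ' η' := by
  obtain ⟨-, -, h1⟩ := h (Sum.elim x y) hx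
  have h2 := h1 (frame g (Sum.elim x y) *ᵥ Sum.elim ξ η) (frame g (Sum.elim x y) *ᵥ Sum.elim ξ' η')
  simp only [pair_liftG, base_liftJ, ver_liftJ, base_frame, ver_frame] at h2
  exact h2

theorem coeff_of_span_eq (hsymm : ∀ x i j, g x i j = g x j i) (hr : pair g x y y = r)
    (hs : pair g x e e = s) (hye : pair g x y e = 0) {z₁ z₂ w₁ w₂ : ℝ}
    (h : z₁ • y + z₂ • e = w₁ • y + w₂ • e) : r * z₁ = r * w₁ ∧ s * z₂ = s * w₂ := by
  have hey : pair g x e y = 0 := by rw [pair_comm hsymm, hye]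
  have h1 := congrArg (pair g x y) h
  have h2 := congrArg (pair g x e) h
  simp only [pair_add_right, pair_smul_right, hr, hs, hye, hey] at h1 h2
  constructor <;> linarith

/-- J and G preserve the splitting into lifts of y and lifts of e. The relations on the lifts of e
survive at y = 0, whereas those on the lifts of y require r ≠ 0. -/
theorem IsAntiHermitianOn.relations (hg : IsMetricOn g U) (h : IsAntiHermitianOn g A C U)
    (hx : x ∈ U) (hr : pair g x y y = r) (he : e ≠ 0) (hye : pair g x y e = 0) {j : Jet}
    (hj : j = jet A C (1 / 2 * r)) :
    LevelRel j.a₁ j.a₂ j.a₃ j.a₄ j.c₁ j.c₂ j.c₃ ∧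
      (r ≠ 0 → LevelRel (j.a₁ + r * j.b₁) (j.a₂ + r * j.b₂) (j.a₃ + r * j.b₃) (j.a₄ + r * j.b₄)
        (j.c₁ + r * j.d₁) (j.c₂ + r * j.d₂) (j.c₃ + r * j.d₃)) := by
  obtain ⟨s, hs⟩ : ∃ s, pair g x e e = s := ⟨_, rfl⟩
  have hs0 : s ≠ 0 := hs ▸ (hg.pos x hx e he).ne'
  have hJ : ∀ ξ₁ η₁ ξ₂ η₂ : ℝ, _ := fun ξ₁ η₁ ξ₂ η₂ =>
    h.horJ_verJ (y := y) hx (ξ₁ • y + ξ₂ • e) (η₁ • y + η₂ • e)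
  have hB : ∀ ξ₁ η₁ ξ₂ η₂ ξ₁' η₁' ξ₂' η₂' : ℝ, _ := fun ξ₁ η₁ ξ₂ η₂ ξ₁' η₁' ξ₂' η₂' =>
    h.liftedForm_liftedForm (y := y) hx (ξ₁ • y + ξ₂ • e) (η₁ • y + η₂ • e)
      (ξ₁' • y + ξ₂' • e) (η₁' • y + η₂' • e)
  have hneg : ∀ z₁ z₂ : ℝ, -(z₁ • y + z₂ • e) = (-z₁) • y + (-z₂) • e := fun z₁ z₂ => by module
  simp only [horJ_span A C hr hye hj, verJ_span A C hr hye hj, hneg,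
    liftedForm_span A C hg.symm hr hs hye hj] at hJ hB
  constructor
  · have e1 := coeff_of_span_eq hg.symm hr hs hye (hJ 0 0 1 0).1
    have e2 := coeff_of_span_eq hg.symm hr hs hye (hJ 0 0 1 0).2
    have e3 := coeff_of_span_eq hg.symm hr hs hye (hJ 0 0 0 1).1
    have e4 := coeff_of_span_eq hg.symm hr hs hye (hJ 0 0 0 1).2
    have f1 := mul_left_cancel₀ hs0 e1.2
    have f2 := mul_left_cancel₀ hs0 e2.2
    have f3 := mul_left_cancel₀ hs0 e3.2
    have f4 := mul_left_cancel₀ hs0 e4.2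
    -- The second vector is Je^V, so its image under J is simply -e^V.
    have f5 := hB 0 0 1 0 0 0 (-j.a₂) j.a₃
    refine LevelRel.of_matrix (by linarith) (by linarith) (by linarith) ?_
    apply mul_left_cancel₀ hs0
    have g1 : j.a₄ * -j.a₂ - j.a₂ * j.a₃ = 0 := by linarith
    have g2 : j.a₁ * -j.a₂ + j.a₃ * j.a₃ = -1 := by linarith
    rw [g1, g2] at f5
    simp only [qf] at f5 ⊢
    linarith
  · intro hr0
    have e1 := coeff_of_span_eq hg.symm hr hs hye (hJ 1 0 0 0).1
    have e2 := coeff_of_span_eq hg.symm hr hs hye (hJ 1 0 0 0).2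
    have e3 := coeff_of_span_eq hg.symm hr hs hye (hJ 0 1 0 0).1
    have e4 := coeff_of_span_eq hg.symm hr hs hye (hJ 0 1 0 0).2
    have f1 := mul_left_cancel₀ hr0 e1.1
    have f2 := mul_left_cancel₀ hr0 e2.1
    have f3 := mul_left_cancel₀ hr0 e3.1
    have f4 := mul_left_cancel₀ hr0 e4.1
    have f5 := hB 1 0 0 0 (-(j.a₂ + r * j.b₂)) (j.a₃ + r * j.b₃) 0 0
    generalize j.a₁ + r * j.b₁ = a₁ at *
    generalize j.a₂ + r * j.b₂ = a₂ at *
    generalize j.a₃ + r * j.b₃ = a₃ at *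
    generalize j.a₄ + r * j.b₄ = a₄ at *
    refine LevelRel.of_matrix (by linarith) (by linarith) (by linarith) ?_
    apply mul_left_cancel₀ hr0
    have g1 : a₄ * -a₂ - a₂ * a₃ = 0 := by linarith
    have g2 : a₁ * -a₂ + a₃ * a₃ = -1 := by linarith
    rw [g1, g2] at f5
    simp only [qf] at f5 ⊢
    linarith

/-- Since e is orthogonal to y, the d-terms vanish on its lifts. A kernel vector (α, β) of the 2 × 2
matrix of c₁, c₃, c₂ then makes αe^H + βe^V degenerate for all of G. -/
theorem IsAntiHermitianOn.nondegenerate (hg : IsMetricOn g U) (h : IsAntiHermitianOn g A C U)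
    (hx : x ∈ U) (hr : pair g x y y = r) (he : e ≠ 0) (hye : pair g x y e = 0) {j : Jet}
    (hj : j = jet A C (1 / 2 * r)) : j.c₁ * j.c₂ - j.c₃ ^ 2 ≠ 0 := by
  obtain ⟨-, hdet, -⟩ := h (Sum.elim x y) hx
  intro h0
  have key : ∀ α β : ℝ, j.c₁ * α + j.c₃ * β = 0 → j.c₃ * α + j.c₂ * β = 0 → α = 0 ∧ β = 0 := by
    intro α β h1 h2
    have hker : liftG g C (Sum.elim x y) *ᵥ
        (frame g (Sum.elim x y) *ᵥ Sum.elim (α • e) (β • e)) = 0 := by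
      rw [← dotProduct_eq_zero_iff]
      intro W
      rw [dotProduct_comm]
      change pair (liftG g C) (Sum.elim x y) W _ = 0
      rw [pair_liftG_comm hg.symm, pair_liftG, base_frame, ver_frame]
      simp only [liftedForm, metricForm, base_elim, fib_elim, pair_smul_left, pair_smul_right, hye,
        hr]
      subst hj
      simp only [jet] at h1 h2
      linear_combination pair g x e (base W) * h1 + pair g x e (ver g (Sum.elim x y) W) * h2
    have hz : frame g (Sum.elim x y) *ᵥ Sum.elim (α • e) (β • e) = 0 := by
      by_contra hne
      exact hdet (Matrix.exists_mulVec_eq_zero_iff.1 ⟨_, hne, hker⟩)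
    have e1 := congrArg base hz
    have e2 := congrArg (ver g (Sum.elim x y)) hz
    rw [base_frame] at e1
    rw [ver_frame] at e2
    have e3 : ver g (Sum.elim x y) 0 = 0 := by
      have := ver_frame g (Sum.elim x y) (0 : Fin n → ℝ) 0
      rwa [show (Sum.elim (0 : Fin n → ℝ) 0 : Fin n ⊕ Fin n → ℝ) = 0 by ext (i | i) <;> rfl,
        Matrix.mulVec_zero] at this
    rw [e3] at e2
    exact ⟨(smul_eq_zero.1 e1).resolve_right he, (smul_eq_zero.1 e2).resolve_right he⟩
  -- Up to sign the columns of the adjugate lie in the kernel of a singular matrix. Their vanishing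
  -- makes the matrix zero, and then (1, 0) is in the kernel.
  obtain ⟨h1, h2⟩ := key (-j.c₃) j.c₁ (by ring) (by linarith)
  have h3 : j.c₃ = 0 := by linarith
  obtain ⟨h4, h5⟩ := key (-j.c₂) j.c₃ (by linarith) (by ring)
  exact one_ne_zero (key 1 0 (by rw [h2, h3]; ring) (by rw [h3]; ring)).1

theorem IsMetricOn.exists_orthogonal (hg : IsMetricOn g U) (hx : x ∈ U) (hn : 2 ≤ n)
    (hr : 0 ≤ r) : ∃ y e, pair g x y y = r ∧ e ≠ 0 ∧ pair g x y e = 0 := by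
  let i₀ : Fin n := ⟨0, by omega⟩
  let i₁ : Fin n := ⟨1, by omega⟩
  have hne : i₀ ≠ i₁ := by simp [i₀, i₁]
  set v : Fin n → ℝ := Pi.single i₀ 1
  set w : Fin n → ℝ := Pi.single i₁ 1
  have hv : 0 < pair g x v v := hg.pos x hx v (by simp [v])
  -- A rescaled first coordinate vector and a Gram–Schmidt correction of the second. For r = 0 this
  -- gives y = 0, which serves the nonvanishing claims at t = 0.
  refine ⟨√(r / pair g x v v) • v, w - (pair g x v w / pair g x v v) • v, ?_, ?_, ?_⟩
  · rw [pair_smul_left, pair_smul_right, ← mul_assoc, Real.mul_self_sqrt (by positivity)]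
    field_simp
  · intro h0
    have := congrFun h0 i₁
    simp [v, w, hne.symm] at this
  · rw [pair_smul_left, pair_sub_right, pair_smul_right]
    field_simp
    ring

theorem deriv_eq_of_eq_on_pos {F H : ℝ → ℝ} {F' H' t : ℝ} (hF : HasDerivAt F F' t)
    (hH : HasDerivAt H H' t) (ht : 0 < t) (h : ∀ s, 0 < s → F s = H s) : F' = H' := by
  refine hF.unique (hH.congr_of_eventuallyEq ?_)
  filter_upwards [Ioi_mem_nhds ht] with s hs
  exact h s hs

theorem levelRelDot_of_levelRel {a₁ a₂ a₃ a₄ c₁ c₂ c₃ : ℝ → ℝ}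
    {a₁' a₂' a₃' a₄' c₁' c₂' c₃' t : ℝ} (ht : 0 < t)
    (h : ∀ t, 0 < t → LevelRel (a₁ t) (a₂ t) (a₃ t) (a₄ t) (c₁ t) (c₂ t) (c₃ t))
    (ha₁ : HasDerivAt a₁ a₁' t) (ha₂ : HasDerivAt a₂ a₂' t) (ha₃ : HasDerivAt a₃ a₃' t)
    (ha₄ : HasDerivAt a₄ a₄' t) (hc₁ : HasDerivAt c₁ c₁' t) (hc₂ : HasDerivAt c₂ c₂' t)
    (hc₃ : HasDerivAt c₃ c₃' t) :
    LevelRelDot (a₁ t) (a₂ t) (a₃ t) (c₁ t) (c₂ t) (c₃ t) a₁' a₂' a₃' a₄' c₁' c₂' c₃' := by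
  refine ⟨deriv_eq_of_eq_on_pos ha₄ ha₃.fun_neg ht fun s hs => (h s hs).a₄_eq, ?_, ?_⟩
  · have := deriv_eq_of_eq_on_pos (ha₁.fun_mul ha₂) ((ha₃.fun_pow 2).const_add 1) ht
      fun s hs => (h s hs).mul_eq
    rw [this]
    ring
  · have := deriv_eq_of_eq_on_pos (hc₂.fun_mul ha₁)
      (((ha₃.const_mul 2).fun_mul hc₃).fun_sub (ha₂.fun_mul hc₁)) ht fun s hs => (h s hs).c₂_mul
    rw [this]
    ring

/-- Over a single base point, vectors y of every length are available. The relations are therefore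
identities between functions of t > 0 and may be differentiated. -/
theorem IsAntiHermitianOn.compatible (hg : IsMetricOn g U) (h : IsAntiHermitianOn g A C U)
    (hx : x ∈ U) (hn : 2 ≤ n) {t : ℝ} (ht : 0 < t) : (jet A C t).Compatible (2 * t) := by
  have hrel : ∀ t, 0 < t → LevelRel (A.a₁ t) (A.a₂ t) (A.a₃ t) (A.a₄ t) (C.c₁ t) (C.c₂ t) (C.c₃ t) ∧
      LevelRel (A.a₁ t + 2 * t * A.b₁ t) (A.a₂ t + 2 * t * A.b₂ t) (A.a₃ t + 2 * t * A.b₃ t)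
        (A.a₄ t + 2 * t * A.b₄ t) (C.c₁ t + 2 * t * C.d₁ t) (C.c₂ t + 2 * t * C.d₂ t)
        (C.c₃ t + 2 * t * C.d₃ t) := fun t ht => by
    obtain ⟨y, e, hr, he, hye⟩ := hg.exists_orthogonal (r := 2 * t) hx hn (by positivity)
    have h1 := h.relations (j := jet A C t) hg hx hr he hye (by congr 1; ring)
    exact ⟨h1.1, h1.2 (by positivity)⟩
  have hlin : ∀ {f k : ℝ → ℝ}, ContDiffOn ℝ ∞ f (Set.Ici 0) → ContDiffOn ℝ ∞ k (Set.Ici 0) →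
      HasDerivAt (fun t => f t + 2 * t * k t) (dt f t + 2 * t * dt k t + 2 * k t) t :=
    fun hf hk => by
    refine ((hasDerivAt_dt hf ht).fun_add
      (((hasDerivAt_id t).const_mul 2).fun_mul (hasDerivAt_dt hk ht))).congr_deriv ?_
    simp only [id]
    ring
  exact ⟨(hrel t ht).1,
    levelRelDot_of_levelRel ht (fun t ht => (hrel t ht).1) (hasDerivAt_dt A.smooth_a₁ ht)
      (hasDerivAt_dt A.smooth_a₂ ht) (hasDerivAt_dt A.smooth_a₃ ht) (hasDerivAt_dt A.smooth_a₄ ht)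
      (hasDerivAt_dt C.smooth_c₁ ht) (hasDerivAt_dt C.smooth_c₂ ht) (hasDerivAt_dt C.smooth_c₃ ht),
    (hrel t ht).2,
    levelRelDot_of_levelRel ht (fun t ht => (hrel t ht).2) (hlin A.smooth_a₁ A.smooth_b₁)
      (hlin A.smooth_a₂ A.smooth_b₂) (hlin A.smooth_a₃ A.smooth_b₃) (hlin A.smooth_a₄ A.smooth_b₄)
      (hlin C.smooth_c₁ C.smooth_d₁) (hlin C.smooth_c₂ C.smooth_d₂)
      (hlin C.smooth_c₃ C.smooth_d₃)⟩

theorem IsAntiHermitianOn.ne_zero (hg : IsMetricOn g U) (h : IsAntiHermitianOn g A C U)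
    (hx : x ∈ U) (hn : 2 ≤ n) {t : ℝ} (ht : 0 ≤ t) :
    (jet A C t).a₁ ≠ 0 ∧ (jet A C t).a₁ + 2 * (jet A C t).b₁ * t ≠ 0 ∧ (jet A C t).delta ≠ 0 := by
  obtain ⟨y, e, hr, he, hye⟩ := hg.exists_orthogonal (r := 2 * t) hx hn (by positivity)
  have hj : jet A C t = jet A C (1 / 2 * (2 * t)) := by congr 1; ring
  have h1 := h.relations hg hx hr he hye hj
  refine ⟨h1.1.a₁_ne_zero, ?_, h1.1.delta_ne_zero (h.nondegenerate hg hx hr he hye hj)⟩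
  rcases ht.eq_or_lt with rfl | ht
  · simpa using h1.1.a₁_ne_zero
  · have h2 := (h1.2 (by positivity)).a₁_ne_zero
    contrapose! h2
    linarith

end AntiHermitian

/-! ### The `ω₁ ⊕ ω₃` condition on the lifts of y and e -/

section Omega13

variable {n : ℕ} {g : (Fin n → ℝ) → Matrix (Fin n) (Fin n) ℝ} {A : EndCoeffs} {C : MetricCoeffs}
  {U : Set (Fin n → ℝ)} {x y e : Fin n → ℝ} {r s : ℝ}

theorem formPhi_add {ι : Type*} [Fintype ι] [DecidableEq ι] (G J : (ι → ℝ) → Matrix ι ι ℝ)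
    (p Z Z' : ι → ℝ) : formPhi G J p (Z + Z') = formPhi G J p Z + formPhi G J p Z' := by
  simp only [formPhi, tensorF, pair_add_right, mul_add, Finset.sum_add_distrib]

theorem formPhi_smul {ι : Type*} [Fintype ι] [DecidableEq ι] (G J : (ι → ℝ) → Matrix ι ι ℝ)
    (p : ι → ℝ) (c : ℝ) (Z : ι → ℝ) : formPhi G J p (c • Z) = c * formPhi G J p Z := by
  simp only [formPhi, tensorF, pair_smul_right, Finset.mul_sum]
  exact Finset.sum_congr rfl fun i _ => Finset.sum_congr rfl fun j _ => by ring

theorem formPhi_frame_span (G J : (Fin n ⊕ Fin n → ℝ) → Matrix (Fin n ⊕ Fin n) (Fin n ⊕ Fin n) ℝ)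
    (p : Fin n ⊕ Fin n → ℝ) (y e : Fin n → ℝ) (ξ₁ η₁ ξ₂ η₂ : ℝ) :
    formPhi G J p (frame g p *ᵥ Sum.elim (ξ₁ • y + ξ₂ • e) (η₁ • y + η₂ • e)) =
      ξ₁ * formPhi G J p (frame g p *ᵥ Sum.elim y 0)
        + η₁ * formPhi G J p (frame g p *ᵥ Sum.elim 0 y)
        + (ξ₂ * formPhi G J p (frame g p *ᵥ Sum.elim e 0)
          + η₂ * formPhi G J p (frame g p *ᵥ Sum.elim 0 e)) := by
  simp only [← formPhi_smul, ← formPhi_add, ← Matrix.mulVec_smul, ← Matrix.mulVec_add]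
  congr 2
  ext (i | i) <;> simp

/-- The diagonal identity is a polynomial identity in the four components of X. Its part of degree
zero in the e-components is the radial hypothesis of `Jet.Compatible.omega13`, its part of degree
two the mixed one. -/
theorem omega13_of_point (hg : IsMetricOn g U) (h : IsAntiHermitianOn g A C U)
    (hω : ∀ p : Fin n ⊕ Fin n → ℝ, base p ∈ U → Omega13At n (liftG g C) (liftJ g A) p)
    (hx : x ∈ U) (hn : 2 ≤ n) (hr0 : 0 < r) (hr : pair g x y y = r) (he : e ≠ 0)
    (hs : pair g x e e = s) (hye : pair g x y e = 0) {κ : ℝ}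
    (hκ : pair g x (curvOp g x y e y) e = r * s * κ) :
    (jet A C (1 / 2 * r)).Omega13 r κ := by
  have hs0 : s ≠ 0 := hs ▸ (hg.pos x hx e he).ne'
  have hN : (n : ℝ) ≠ 0 := by
    have : 0 < n := by omega
    positivity
  have hcompat := h.compatible hg hx hn (t := 1 / 2 * r) (by positivity)
  rw [show 2 * (1 / 2 * r) = r by ring] at hcompat
  obtain ⟨j, hj⟩ : ∃ j, j = jet A C (1 / 2 * r) := ⟨_, rfl⟩
  rw [← hj] at hcompat ⊢
  set p : Fin n ⊕ Fin n → ℝ := Sum.elim x y with hp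
  set Φ := formPhi (liftG g C) (liftJ g A) p
  have H : ∀ ξ₁ η₁ ξ₂ η₂ : ℝ,
      n * (r ^ 2 * j.radial r ξ₁ η₁ + r * s * j.mixed r κ ξ₁ η₁ ξ₂ η₂) =
      (r * qf (j.c₁ + r * j.d₁) (j.c₂ + r * j.d₂) (j.c₃ + r * j.d₃) ξ₁ η₁ ξ₁ η₁
        + s * qf j.c₁ j.c₂ j.c₃ ξ₂ η₂ ξ₂ η₂)
      * (ξ₁ * Φ (frame g p *ᵥ Sum.elim y 0) + η₁ * Φ (frame g p *ᵥ Sum.elim 0 y)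
        + (ξ₂ * Φ (frame g p *ᵥ Sum.elim e 0) + η₂ * Φ (frame g p *ᵥ Sum.elim 0 e)))
      + (r * qf (j.c₁ + r * j.d₁) (j.c₂ + r * j.d₂) (j.c₃ + r * j.d₃) ξ₁ η₁
          ((j.a₄ + r * j.b₄) * ξ₁ - (j.a₂ + r * j.b₂) * η₁)
          ((j.a₁ + r * j.b₁) * ξ₁ + (j.a₃ + r * j.b₃) * η₁)
        + s * qf j.c₁ j.c₂ j.c₃ ξ₂ η₂ (j.a₄ * ξ₂ - j.a₂ * η₂) (j.a₁ * ξ₂ + j.a₃ * η₂))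
      * (((j.a₄ + r * j.b₄) * ξ₁ - (j.a₂ + r * j.b₂) * η₁) * Φ (frame g p *ᵥ Sum.elim y 0)
        + ((j.a₁ + r * j.b₁) * ξ₁ + (j.a₃ + r * j.b₃) * η₁) * Φ (frame g p *ᵥ Sum.elim 0 y)
        + ((j.a₄ * ξ₂ - j.a₂ * η₂) * Φ (frame g p *ᵥ Sum.elim e 0)
          + (j.a₁ * ξ₂ + j.a₃ * η₂) * Φ (frame g p *ᵥ Sum.elim 0 e))) := by
    intro ξ₁ η₁ ξ₂ η₂
    obtain ⟨X, hX⟩ : ∃ X, X = frame g p *ᵥ Sum.elim (ξ₁ • y + ξ₂ • e) (η₁ • y + η₂ • e) := ⟨_, rfl⟩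
    have hJX : liftJ g A p *ᵥ X = frame g p *ᵥ
        Sum.elim (((j.a₄ + r * j.b₄) * ξ₁ - (j.a₂ + r * j.b₂) * η₁) • y
            + (j.a₄ * ξ₂ - j.a₂ * η₂) • e)
          (((j.a₁ + r * j.b₁) * ξ₁ + (j.a₃ + r * j.b₃) * η₁) • y
            + (j.a₁ * ξ₂ + j.a₃ * η₂) • e) := by
      rw [liftJ_mulVec, hX, base_frame, ver_frame]
      congr 2
      · exact horJ_span A C hr hye hj ξ₁ η₁ ξ₂ η₂
      · exact verJ_span A C hr hye hj ξ₁ η₁ ξ₂ η₂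
    have hF := hg.tensorF_lift_span (p := p) hx A C (h p hx).2.1 (h.pair_liftJ hx) hr0 hr hs hye hj
      hκ ξ₁ η₁ ξ₂ η₂ hX
    have hΩ := hω p hx X X X
    have hbX : base X = _ := hX ▸ base_frame g p (ξ₁ • y + ξ₂ • e) (η₁ • y + η₂ • e)
    have hvX : ver g p X = _ := hX ▸ ver_frame g p (ξ₁ • y + ξ₂ • e) (η₁ • y + η₂ • e)
    have e1 := pair_liftG g C p X X
    have e2 := pair_liftG g C p X (liftJ g A p *ᵥ X)
    rw [hbX, hvX] at e1
    rw [hbX, hvX, hJX, base_frame, ver_frame, ← hJX] at e2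
    replace e1 := e1.trans (liftedForm_span A C hg.symm hr hs hye hj ξ₁ η₁ ξ₂ η₂ ξ₁ η₁ ξ₂ η₂)
    replace e2 := e2.trans (liftedForm_span A C hg.symm hr hs hye hj ξ₁ η₁ ξ₂ η₂ _ _ _ _)
    have e3 := formPhi_frame_span (g := g) (liftG g C) (liftJ g A) p y e ξ₁ η₁ ξ₂ η₂
    have e4 := formPhi_frame_span (g := g) (liftG g C) (liftJ g A) p y e
      ((j.a₄ + r * j.b₄) * ξ₁ - (j.a₂ + r * j.b₂) * η₁)
      ((j.a₁ + r * j.b₁) * ξ₁ + (j.a₃ + r * j.b₃) * η₁) (j.a₄ * ξ₂ - j.a₂ * η₂)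
      (j.a₁ * ξ₂ + j.a₃ * η₂)
    rw [← hJX] at e4
    rw [← hX] at e3
    rw [hF, e1, e2, e3, e4] at hΩ
    linear_combination (1 / 3) * hΩ
  have hmix0 : ∀ ξ₁ η₁, j.mixed r κ ξ₁ η₁ 0 0 = 0 := fun ξ₁ η₁ => by
    simp only [Jet.mixed, qf]
    ring
  refine hcompat.omega13 hr0.ne' hN (φ₁ := Φ (frame g p *ᵥ Sum.elim y 0))
    (φ₂ := Φ (frame g p *ᵥ Sum.elim 0 y)) (fun ξ η => ?_) (fun ξ₁ η₁ ξ₂ η₂ => ?_)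
  · have h1 := H ξ η 0 0
    rw [hmix0] at h1
    apply mul_left_cancel₀ hr0.ne'
    simp only [qf] at h1 ⊢
    linear_combination h1
  · have h1 := H ξ₁ η₁ ξ₂ η₂
    have h2 := H ξ₁ η₁ (-ξ₂) (-η₂)
    have h3 := H ξ₁ η₁ 0 0
    have hev : j.mixed r κ ξ₁ η₁ (-ξ₂) (-η₂) = j.mixed r κ ξ₁ η₁ ξ₂ η₂ := by
      simp only [Jet.mixed, qf]
      ring
    rw [hev] at h2
    rw [hmix0] at h3
    apply mul_left_cancel₀ hs0
    generalize j.mixed r κ ξ₁ η₁ ξ₂ η₂ = K at *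
    generalize j.radial r ξ₁ η₁ = R at *
    simp only [qf] at h1 h2 h3 ⊢
    -- Averaging over the sign of e kills Φ(e^H) and Φ(e^V), which come with odd powers of the
    -- e-components; subtracting `h3` removes the radial part.
    linear_combination (1 / 2) * h1 + (1 / 2) * h2 - h3

end Omega13


/-! ### Components of a Riemannian metric in a chart -/

section Charts

variable {n : ℕ} {M : Type*} [TopologicalSpace M] [ChartedSpace (EuclideanSpace ℝ (Fin n)) M]
  [IsManifold (𝓡 n) ∞ M]

theorem contMDiffAt_const_tangent (v z : EuclideanSpace ℝ (Fin n)) :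
    ContMDiffAt (𝓡 n) ((𝓡 n).prod (𝓡 n)) ∞
      (fun y => (Bundle.TotalSpace.mk' (EuclideanSpace ℝ (Fin n)) y v :
        TangentBundle (𝓡 n) (EuclideanSpace ℝ (Fin n)))) z := by
  exact contMDiffAt_vectorSpace_iff_contDiffAt (V := fun _ => v) |>.mpr contDiffAt_const

theorem contMDiffAt_coordVec {e : OpenPartialHomeomorph M (EuclideanSpace ℝ (Fin n))}
    (he : e ∈ atlas (EuclideanSpace ℝ (Fin n)) M) {z : EuclideanSpace ℝ (Fin n)}
    (hz : z ∈ e.target) (v : EuclideanSpace ℝ (Fin n)) :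
    ContMDiffAt (𝓡 n) ((𝓡 n).prod (𝓡 n)) ∞
      (fun y => (Bundle.TotalSpace.mk' (EuclideanSpace ℝ (Fin n)) (e.symm y)
        (mfderiv (𝓡 n) (𝓡 n) e.symm y v) : TangentBundle (𝓡 n) M)) z := by
  have hs : ContMDiffAt (𝓡 n) (𝓡 n) ∞ e.symm z :=
    contMDiffAt_symm_of_mem_maximalAtlas (IsManifold.subset_maximalAtlas he) hz
  have : IsManifold (𝓡 n) 1 M := IsManifold.of_le (n := ∞) (by norm_cast)
  exact ContMDiffAt.clm_apply_of_inCoordinates (hs.mfderiv_const (by norm_cast))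
    (contMDiffAt_const_tangent v z) hs

theorem Metric.contMDiffAt_inChart (g : Metric n M)
    {e : OpenPartialHomeomorph M (EuclideanSpace ℝ (Fin n))}
    (he : e ∈ atlas (EuclideanSpace ℝ (Fin n)) M) {z : EuclideanSpace ℝ (Fin n)}
    (hz : z ∈ e.target) (v w : EuclideanSpace ℝ (Fin n)) :
    ContMDiffAt (𝓡 n) 𝓘(ℝ) ∞ (fun y => g.inner (e.symm y)
      (mfderiv (𝓡 n) (𝓡 n) e.symm y v) (mfderiv (𝓡 n) (𝓡 n) e.symm y w)) z := by
  have hs : ContMDiffAt (𝓡 n) (𝓡 n) ∞ e.symm z :=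
    contMDiffAt_symm_of_mem_maximalAtlas (IsManifold.subset_maximalAtlas he) hz
  have key : ContMDiffAt (𝓡 n) ((𝓡 n).prod 𝓘(ℝ)) ∞
      (fun y => Bundle.TotalSpace.mk' ℝ (E := Bundle.Trivial M ℝ) (e.symm y)
        (g.inner (e.symm y) (mfderiv (𝓡 n) (𝓡 n) e.symm y v)
          (mfderiv (𝓡 n) (𝓡 n) e.symm y w))) z := by
    apply ContMDiffAt.clm_bundle_apply₂ (F₁ := EuclideanSpace ℝ (Fin n))
      (F₂ := EuclideanSpace ℝ (Fin n))
    · exact g.contMDiff.contMDiffAt.comp z hs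
    · exact contMDiffAt_coordVec he hz v
    · exact contMDiffAt_coordVec he hz w
  simp only [Bundle.contMDiffAt_totalSpace] at key
  exact key.2

theorem Metric.pair_inChart (g : Metric n M)
    (e : OpenPartialHomeomorph M (EuclideanSpace ℝ (Fin n))) (x v w : Fin n → ℝ) :
    pair (g.inChart e) x v w = g.inner (e.symm (WithLp.toLp 2 x))
      (mfderiv (𝓡 n) (𝓡 n) e.symm (WithLp.toLp 2 x) (WithLp.toLp 2 v))
      (mfderiv (𝓡 n) (𝓡 n) e.symm (WithLp.toLp 2 x) (WithLp.toLp 2 w)) := by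
  have hsum : ∀ v : Fin n → ℝ,
      (mfderiv (𝓡 n) (𝓡 n) e.symm (WithLp.toLp 2 x) (WithLp.toLp 2 v) :
        TangentSpace (𝓡 n) (e.symm (WithLp.toLp 2 x))) = ∑ i, v i • coordVec e x i := by
    intro v
    have : (WithLp.toLp 2 v : EuclideanSpace ℝ (Fin n))
        = ∑ i, v i • EuclideanSpace.single i (1 : ℝ) := by
      ext j
      simp [Finset.sum_apply, Pi.single_apply]
    rw [this]
    unfold coordVec
    exact (map_sum (mfderiv (𝓡 n) (𝓡 n) e.symm (WithLp.toLp 2 x)) _ _).trans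
      (Finset.sum_congr rfl fun i _ => map_smul _ _ _)
  rw [hsum v, hsum w, pair_eq_sum]
  simp only [map_sum, map_smul, FunLike.coe_sum, FunLike.coe_smul, Finset.sum_apply, Pi.smul_apply,
    smul_eq_mul, Metric.inChart]
  rw [Finset.sum_comm]
  exact Finset.sum_congr rfl fun j _ => by
    rw [Finset.mul_sum]
    exact Finset.sum_congr rfl fun i _ => by ring

theorem Metric.isMetricOn_inChart (g : Metric n M)
    {e : OpenPartialHomeomorph M (EuclideanSpace ℝ (Fin n))}
    (he : e ∈ atlas (EuclideanSpace ℝ (Fin n)) M) :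
    IsMetricOn (g.inChart e) (coordDomain e) where
  isOpen := e.open_target.preimage (PiLp.continuous_toLp 2 _)
  smooth i j := by
    intro x hx
    have h := (g.contMDiffAt_inChart he hx (EuclideanSpace.single i 1)
      (EuclideanSpace.single j 1)).contDiffAt
    exact (h.comp x PiLp.contDiff_toLp.contDiffAt).contDiffWithinAt
  symm x i j := g.symm _ _ _
  pos x hx v hv := by
    rw [g.pair_inChart]
    refine g.pos _ _ fun h0 => hv ?_
    -- Positivity transfers from the manifold because the differential of the inverse chart is
    -- injective.
    have hd := (mdifferentiable_of_mem_atlas (I := 𝓡 n) he).symm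
    have hinj := hd.mfderiv_injective hx
    have := hinj (h0.trans (map_zero _).symm)
    ext i
    exact congrFun (congrArg WithLp.ofLp this) i

end Charts


/-! ### Constancy of the curvature and assembly -/

section Main

variable {n : ℕ} {A : EndCoeffs} {C : MetricCoeffs}

/-- Rescaling y to g(y,y) = 2t leaves the curvature quotient unchanged, so one plane yields the
relations at every t > 0 with the same κ. -/
theorem omega13_sectional {g : (Fin n → ℝ) → Matrix (Fin n) (Fin n) ℝ} {U : Set (Fin n → ℝ)}
    {x y e : Fin n → ℝ} {t : ℝ} (hg : IsMetricOn g U) (h : IsAntiHermitianOn g A C U)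
    (hω : ∀ p, base p ∈ U → Omega13At n (liftG g C) (liftJ g A) p) (hx : x ∈ U) (hn : 2 ≤ n)
    (ht : 0 < t) (hy : y ≠ 0) (he : e ≠ 0) (hye : pair g x y e = 0) :
    (jet A C t).Omega13 (2 * t)
      (pair g x (curvOp g x y e y) e / (pair g x y y * pair g x e e)) := by
  have hyy := hg.pos x hx y hy
  have hee := hg.pos x hx e he
  have hs : √(2 * t / pair g x y y) * √(2 * t / pair g x y y) = 2 * t / pair g x y y :=
    Real.mul_self_sqrt (by positivity)
  have key := omega13_of_point (y := √(2 * t / pair g x y y) • y) (r := 2 * t)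
    (κ := pair g x (curvOp g x y e y) e / (pair g x y y * pair g x e e))
    hg h hω hx hn (by positivity) ?_ he rfl ?_ ?_
  · rwa [show 1 / 2 * (2 * t) = t by ring] at key
  · rw [pair_smul_left, pair_smul_right, ← mul_assoc, hs]
    field_simp
  · rw [pair_smul_left, hye, mul_zero]
  · rw [hg.curvOp_smul_left hx, hg.curvOp_smul_right hx, pair_smul_left, pair_smul_left,
      ← mul_assoc, hs]
    field_simp

variable {M : Type*} [TopologicalSpace M] [ChartedSpace (EuclideanSpace ℝ (Fin n)) M]
  [IsManifold (𝓡 n) ∞ M] {g : Metric n M}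

theorem Metric.hasConstantSectionalCurvature_of_sectional (g : Metric n M) {c : ℝ}
    (h : ∀ e ∈ atlas (EuclideanSpace ℝ (Fin n)) M, ∀ x ∈ coordDomain e, ∀ v y : Fin n → ℝ,
      v ≠ 0 → y ≠ 0 → pair (g.inChart e) x y v = 0 →
      pair (g.inChart e) x (curvOp (g.inChart e) x v y y) v =
        c * (pair (g.inChart e) x v v * pair (g.inChart e) x y y)) :
    HasConstantSectionalCurvature g c := by
  intro e he x hx h' k i j
  have hg := g.isMetricOn_inChart he
  have hs : ∀ a b : Fin n,
      pair (g.inChart e) x (Pi.single a 1) (Pi.single b 1) = g.inChart e x a b := by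
    intro a b
    simp [pair]
  rw [← hg.curvOp_single hx, hg.curvOp_eq_of_sectional hx (h e he x hx), hs, hs, hg.symm x j k,
    hg.symm x i k]
  simp only [Pi.smul_apply, Pi.sub_apply, smul_eq_mul, Pi.single_apply]
  ring

/-- A reference plane at one point supplies κ. Any other plane, at any point and in any chart,
satisfies the relations with the same jets, and `Jet.Omega13.unique` identifies its curvature; no
connectedness of M is required. -/
theorem exists_constant_curvature [Nonempty M] (hn : 2 ≤ n) (hAH : IsAlmostAntiHermitian g A C)
    (hω : IsOmega13 g A C) :
    ∃ c : ℝ, HasConstantSectionalCurvature g c ∧ ∀ t, 0 ≤ t →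
      ((jet A C t).a₁ ≠ 0 ∧ (jet A C t).a₁ + 2 * (jet A C t).b₁ * t ≠ 0 ∧ (jet A C t).delta ≠ 0) ∧
      (jet A C t).Omega13 (2 * t) (-c) := by
  obtain ⟨z⟩ := ‹Nonempty M›
  set e₀ := chartAt (EuclideanSpace ℝ (Fin n)) z
  have he₀ : e₀ ∈ atlas (EuclideanSpace ℝ (Fin n)) M := chart_mem_atlas _ _
  have hx₀ : WithLp.ofLp (e₀ z) ∈ coordDomain e₀ := mem_chart_target _ z
  have hg₀ := g.isMetricOn_inChart he₀
  have hne : ∀ t, 0 ≤ t → (jet A C t).a₁ ≠ 0 ∧ (jet A C t).a₁ + 2 * (jet A C t).b₁ * t ≠ 0 ∧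
      (jet A C t).delta ≠ 0 := fun t ht =>
    IsAntiHermitianOn.ne_zero hg₀ (hAH e₀ he₀) hx₀ hn ht
  obtain ⟨y₀, v₀, hy₀, hv₀, hyv₀⟩ := hg₀.exists_orthogonal hx₀ hn zero_le_one
  have hy₀' : y₀ ≠ 0 := by
    rintro rfl
    simp [pair_zero_left] at hy₀
  set κ := pair (g.inChart e₀) (WithLp.ofLp (e₀ z))
    (curvOp (g.inChart e₀) (WithLp.ofLp (e₀ z)) y₀ v₀ y₀) v₀
    / (pair (g.inChart e₀) (WithLp.ofLp (e₀ z)) y₀ y₀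
      * pair (g.inChart e₀) (WithLp.ofLp (e₀ z)) v₀ v₀)
  have hκ : ∀ t, 0 < t → (jet A C t).Omega13 (2 * t) κ := fun t ht =>
    omega13_sectional hg₀ (hAH e₀ he₀) (hω e₀ he₀) hx₀ hn ht hy₀' hv₀ hyv₀
  refine ⟨-κ, g.hasConstantSectionalCurvature_of_sectional ?_, fun t ht => ⟨hne t ht, ?_⟩⟩
  · intro e he x hx v y hv hy hyv
    have hg := g.isMetricOn_inChart he
    -- The value t = 1 is arbitrary; one positive t is enough to compare curvatures.
    have h1 := omega13_sectional hg (hAH e he) (hω e he) hx hn one_pos hy hv hyv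
    have h2 := h1.unique (hκ 1 one_pos) (hne 1 zero_le_one).2.2
    have hyy := hg.pos x hx y hy
    have hvv := hg.pos x hx v hv
    rw [div_eq_iff (by positivity)] at h2
    rw [curvOp_swap, pair_neg_left, h2]
    ring
  · rw [neg_neg]
    exact omega13_of_pos A C hκ ht

end Main

end NaturalLift
end

theorem mainTheorem8 {n : ℕ} (hn : 2 ≤ n) {M : Type*} [TopologicalSpace M]
    [ChartedSpace (EuclideanSpace ℝ (Fin n)) M] [IsManifold (𝓡 n) ∞ M] [Nonempty M]
    (g : NaturalLift.Metric n M) (A : NaturalLift.EndCoeffs) (C : NaturalLift.MetricCoeffs)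
    (hAH : NaturalLift.IsAlmostAntiHermitian g A C) (hω : NaturalLift.IsOmega13 g A C) :
    ∃ c : ℝ, NaturalLift.HasConstantSectionalCurvature g c ∧
      ∀ t : ℝ, 0 ≤ t →
        let a₁ := A.a₁ t
        let a₃ := A.a₃ t
        let b₁ := A.b₁ t
        let b₃ := A.b₃ t
        let c₁ := C.c₁ t
        let c₃ := C.c₃ t
        let d₁ := C.d₁ t
        let d₃ := C.d₃ t
        let a₁' := NaturalLift.dt A.a₁ t
        let a₃' := NaturalLift.dt A.a₃ t
        let b₁' := NaturalLift.dt A.b₁ t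
        let b₃' := NaturalLift.dt A.b₃ t
        let c₁' := NaturalLift.dt C.c₁ t
        let c₃' := NaturalLift.dt C.c₃ t
        let d₁' := NaturalLift.dt C.d₁ t
        let d₃' := NaturalLift.dt C.d₃ t
        let Δ := (1 + a₃ ^ 2) * c₁ ^ 2 - a₁ * c₃ * (2 * a₃ * c₁ - a₁ * c₃)
        let D := (c₁ * (1 + a₃ ^ 2) - a₁ * a₃ * c₃) * (a₁ + 2 * b₁ * t)
        let E := a₁ * Δ * (a₁ + 2 * b₁ * t)
        let u := a₁ * c₃ - a₃ * c₁
        let u' := a₁' * c₃ + a₁ * c₃' - a₃' * c₁ - a₃ * c₁'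
        let m := (a₁ + 2 * b₁ * t) * d₃ - (a₃ + 2 * b₃ * t) * d₁ + b₁ * c₃ - b₃ * c₁
        let v := c₁ + 2 * d₁ * t
        let w := (a₁ + 2 * b₁ * t) * (c₃ + 2 * d₃ * t) - (a₃ + 2 * b₃ * t) * v
        let P := (m * u + d₁ * c₁) / Δ
        let Q := (d₁ * u - m * c₁) / Δ
        (a₁ ≠ 0 ∧ a₁ + 2 * b₁ * t ≠ 0 ∧ Δ ≠ 0) ∧
        (c₁ * (1 + a₃ ^ 2) - a₁ * a₃ * c₃ ≠ 0 →
          a₁' =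
            (a₁ ^ 3 * (b₃ - a₃') * c₃
                - (1 + a₃ ^ 2) * c * c₁ * (1 + a₃ ^ 2 + 2 * a₃ * b₃ * t)) / D
            + a₁ ^ 2 * ((a₃ * (c₁ * (a₃' - b₃) - b₁ * c₃)
                - 2 * (d₁ + a₃' * b₁ * c₃ * t)) / D)
            + a₁ * ((b₁ * c₁ * (1 + a₃ ^ 2 + 2 * a₃ * a₃' * t)
                + c * c₃ * (a₃ * (1 + a₃ ^ 2) - 2 * b₃ * t * (1 - a₃ ^ 2))) / D)) ∧
        a₃' =
            (a₁ ^ 4 * c₃ * (b₃ * c₃ - 2 * a₃ * d₃)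
                - 2 * (1 + a₃ ^ 2) * b₃ * c * c₁ * t
                  * ((1 + a₃ ^ 2) * c₁ - 2 * a₁ * a₃ * c₃)) / E
            - a₁ ^ 2 * (1 + a₃ ^ 2)
                * ((b₃ * (c₁ ^ 2 + 2 * c * c₃ ^ 2 * t + 4 * c₁ * d₁ * t)
                  + 2 * c₁ * (a₃ * d₁ - b₁ * (c₃ + 2 * d₃ * t))) / E)
            + 2 * a₁ ^ 3
                * ((c₁ * d₃ - c₃ * d₁ + a₃ ^ 2 * (c₃ * d₁ + c₁ * d₃)
                  - a₃ * c₃ * (b₁ * (c₃ + 2 * d₃ * t) - 2 * b₃ * d₁ * t)) / E) ∧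
        d₁' =
            P * c₁' + Q * u'
              + (2 * a₁ * (m * Q + d₁ * P) - 2 * b₁ * d₁ + 2 * c * b₃ * (w + a₃ * v) / a₁)
                / (a₁ + 2 * b₁ * t) ∧
        d₃' =
            (P * u' - Q * c₁'
              + (2 * a₁ * (m * P - d₁ * Q) - 2 * b₁ * m + 2 * c * b₃ * (a₃ * w - v) / a₁)
                / (a₁ + 2 * b₁ * t)
              - (a₁' + 2 * b₁ + 2 * b₁' * t) * d₃ + (a₃' + 2 * b₃ + 2 * b₃' * t) * d₁
              + (a₃ + 2 * b₃ * t) * d₁'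
              - b₁' * c₃ - b₁ * c₃' + b₃' * c₁ + b₃ * c₁') / (a₁ + 2 * b₁ * t) := by
  obtain ⟨c, hc, h⟩ := NaturalLift.exists_constant_curvature hn hAH hω
  refine ⟨c, hc, fun t ht => ?_⟩
  obtain ⟨⟨ha, hA, hΔ⟩, hj⟩ := h t ht
  intro a₁ a₃ b₁ b₃ c₁ c₃ d₁ d₃ a₁' a₃' b₁' b₃' c₁' c₃' d₁' d₃' Δ D E u u' m v w P Q
  have hΔe : Δ = (NaturalLift.jet A C t).delta := (NaturalLift.jet A C t).delta_eq.symm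
  have hΔ0 : Δ ≠ 0 := hΔe ▸ hΔ
  have hm : m = (NaturalLift.jet A C t).m (2 * t) := by
    simp only [m, NaturalLift.Jet.m, NaturalLift.jet, a₁, a₃, b₁, b₃, c₁, c₃, d₁, d₃]
    ring
  have hw : w = u + 2 * t * m := by
    simp only [w, u, m, v]
    ring
  exact ⟨⟨ha, hA, hΔ0⟩, fun hD => hj.a₁'_eq hA hD rfl, hj.a₃'_eq ha hA rfl hΔ0 rfl,
    hj.d₁'_eq ha hA hΔe hΔ0 rfl rfl hm rfl hw rfl rfl,
    hj.d₃'_eq ha hA hΔe hΔ0 rfl rfl hm rfl hw rfl rfl⟩
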